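/- Let $R$ be a commutative ring with $1\ne 0$, and let $G$ be an abelian group that is the internal direct product of finitely many finite cyclic groups with generators $g_1,\dots,g_k$ of orders $n_1,\dots,n_k\ge 1$; thus every $a\in G$ is uniquely $a=\prod_i g_i^{a_i}$ with $0\le a_i<n_i$. A *group-category* over $R$ is an $R$-linear additive category with an $R$-bilinear monoidal product $\otimes$ and a specified class of simple objects such that every object is a finite direct sum of simple objects, there are no nonzero morphisms between non-isomorphic simple objects, every simple object $X$ is invertible ($X\otimes Y\cong 1$ for some $Y$), and $r\mapsto r\cdot\mathrm{id}_1$ is a bijection $R\to\mathrm{End}(1)$. Isomorphism classes of simple objects form a group under $\otimes$; the category has *underlying group* $G$ if this group is identified with $G$. Consider braided group-categories over $R$ with underlying group $G$, and call two of them equivalent if there is an $R$-linear braided monoidal equivalence inducing the identity of $G$. Write $c$ for the braiding. *Data* are units $\sigma_i\in R^\times$ ($1\le i\le k$) and $\sigma_{i,j}\in R^\times$ ($i>j$) such that $$\sigma_i^{2n_i}=1,\qquad \sigma_i^{n_i}=1\ \text{ if } n_i \text{ is odd},\qquad \sigma_{i,j}^{n_i}=\sigma_{i,j}^{n_j}=1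 .$$ (1) For each such category there are unique data, its *invariants*, with $c_{X,X}=\sigma_i\cdot\mathrm{id}$ for all simple $X$ of class $g_i$, and $c_{Y,X}\circ c_{X,Y}=\sigma_{i,j}\cdot\mathrm{id}$ for all $i>j$ and simple $X,Y$ of classes $g_i,g_j$. Two such categories are equivalent if and only if they have the same invariants. All data occur: on the category of $G$-graded free $R$-modules of finite total rank with the graded tensor product, multiply the standard isomorphisms $(ab)c\to a(bc)$ and $ab\to ba$ on homogeneous elements of degrees $a,b,c$ by $$\alpha(a,b,c)=\prod_i\begin{cases}1&\text{if } b_i+c_i<n_i,\\ \sigma_i^{n_ia_i}&\text{if } b_i+c_i\ge n_i,\end{cases}\qquad \sigma(a,b)=\prod_i\sigma_i^{a_ib_i}\prod_{i<j}\sigma_{j,i}^{a_ib_j};$$ this gives a braided group-category with underlying group $G$ and with invariants the given data, and every braided group-category with underlying group $G$ and these invariants is equivalent to it. (2) All these categories are tortile: every object has left and right duals, and there is a unique balance $\theta$ (natural automorphism of the identity functor with $\theta_{X\otimes Y}=(\theta_X\otimes\theta_Y)\,c_{Y,X}\,c_{X,Y}$) such that $\theta_X\otimes\mathrm{id}_X=c_{X,X}$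 for all simple $X$ (the *standard* one); it is compatible with duals, i.e. $(\theta_X\otimes\mathrm{id}_Y)\eta=(\mathrm{id}_X\otimes\theta_Y)\eta$ whenever $\eta:1\to X\otimes Y$ is the coevaluation of a duality. For any two balances $\theta,\theta'$ there is a unique homomorphism $\chi:G\to R^\times$ with $\theta'_X=\chi(a)\,\theta_X$ for all $a\in G$ and all simple $X$ of class $a$; conversely, for every balance $\theta$ and every homomorphism $\chi:G\to R^\times$ there is a unique balance $\theta'$ satisfying this. (3) Such a category is symmetric ($c_{Y,X}\circ c_{X,Y}=\mathrm{id}$ for all $X,Y$) if and only if its invariants satisfy $\sigma_i^2=1$ for all $i$ and $\sigma_{i,j}=1$ for all $i>j$. -/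

import Mathlib

universe w u v₁ u₁ v₂ u₂

namespace GroupCat

open CategoryTheory MonoidalCategory Limits
open scoped TensorProduct

section Arithmetic

variable {G : Type u} [CommGroup G]

/-- The elements `g i` have finite orders `n i ≥ 1`, and every element of the abelian group `G` is
uniquely of the form `∏ i, g i ^ r i` with `0 ≤ r i < n i`; that is, `G` is the internal direct
product of the finite cyclic groups generated by the `g i`. -/
structure IsCyclicBasis {k : ℕ} (g : Fin k → G) (n : Fin k → ℕ) : Prop where
  pos : ∀ i, 0 < n i
  orderOf_eq : ∀ i, orderOf (g i) = n i
  existsUnique : ∀ a : G, ∃! r : Fin k → ℕ, (∀ i, r i < n i) ∧ a = ∏ i, g i ^ r i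

/-- The numerical data: `diag i` is `σ_i`, and `off i j h` is `σ_{i,j}`, for `i > j`. -/
structure BraidingData (R : Type w) [CommRing R] {k : ℕ} (n : Fin k → ℕ) where
  diag : Fin k → Rˣ
  off : ∀ i j : Fin k, j < i → Rˣ
  diag_pow : ∀ i, diag i ^ (2 * n i) = 1
  diag_pow_of_odd : ∀ i, Odd (n i) → diag i ^ n i = 1
  off_pow_left : ∀ i j h, off i j h ^ n i = 1
  off_pow_right : ∀ i j h, off i j h ^ n j = 1

namespace IsCyclicBasis

variable {k : ℕ} {g : Fin k → G} {n : Fin k → ℕ} (hg : IsCyclicBasis g n)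

/-- The exponent `a_i` of the generator `g i` in `a`. -/
noncomputable def exponent (a : G) : Fin k → ℕ := (hg.existsUnique a).choose

theorem exponent_lt (a : G) (i : Fin k) : hg.exponent a i < n i :=
  (hg.existsUnique a).choose_spec.1.1 i

theorem eq_prod_exponent (a : G) : a = ∏ i, g i ^ hg.exponent a i :=
  (hg.existsUnique a).choose_spec.1.2

theorem exponent_eq {a : G} {r : Fin k → ℕ} (hr : ∀ i, r i < n i) (h : a = ∏ i, g i ^ r i) :
    hg.exponent a = r :=
  (hg.existsUnique a).unique (hg.existsUnique a).choose_spec.1 ⟨hr, h⟩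

theorem exponent_one : hg.exponent 1 = 0 :=
  hg.exponent_eq (fun i => hg.pos i) (by simp)

theorem exponent_mul (a b : G) (i : Fin k) :
    hg.exponent (a * b) i = (hg.exponent a i + hg.exponent b i) % n i := by
  have := hg.exponent_eq (a := a * b)
    (r := fun i => (hg.exponent a i + hg.exponent b i) % n i)
    (fun i => Nat.mod_lt _ (hg.pos i)) (by
      conv_lhs => rw [hg.eq_prod_exponent a, hg.eq_prod_exponent b, ← Finset.prod_mul_distrib]
      refine Finset.prod_congr rfl fun i _ => ?_
      rw [← pow_add, ← hg.orderOf_eq i, pow_mod_orderOf])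
  exact congrFun this i

end IsCyclicBasis

/-- An associativity factor `assoc a b c` for `(ab)c ⟶ a(bc)` and a commutativity factor
`comm a b` for `ab ⟶ ba`, satisfying the unit, pentagon and hexagon identities. -/
structure AbelianCocycle (G : Type u) [CommGroup G] (A : Type w) [CommGroup A] where
  assoc : G → G → G → A
  comm : G → G → A
  assoc_one : ∀ a b, assoc a 1 b = 1
  pentagon : ∀ a b c d,
    assoc a b c * assoc a (b * c) d * assoc b c d = assoc (a * b) c d * assoc a b (c * d)
  hexagon_forward : ∀ a b c,
    assoc a b c * comm a (b * c) * assoc b c a = comm a b * assoc b a c * comm a c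
  hexagon_reverse : ∀ a b c,
    (assoc a b c)⁻¹ * comm (a * b) c * (assoc c a b)⁻¹ =
      comm b c * (assoc a c b)⁻¹ * comm a c

theorem pow_mul_add_mod {A : Type w} [CommGroup A] {x : A} {n : ℕ} (hx : x ^ n = 1) (a b c : ℕ) :
    x ^ (a * ((b + c) % n)) = x ^ (a * b) * x ^ (a * c) := by
  have h : (a * ((b + c) % n)) ≡ a * b + a * c [MOD n] := by
    rw [← mul_add]; exact Nat.ModEq.mul_left _ (Nat.mod_modEq _ _)
  rw [← pow_add]
  exact pow_eq_pow_of_modEq h hx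

theorem carry_cocycle {n : ℕ} (b c d : ℕ) (hb : b < n) (hc : c < n) (hd : d < n) :
    (if b + c < n then 0 else 1) + (if (b + c) % n + d < n then 0 else 1) =
      (if c + d < n then 0 else 1) + (if b + (c + d) % n < n then 0 else 1) := by
  have h1 : (b + c) % n = if b + c < n then b + c else b + c - n := by
    split_ifs with h
    · exact Nat.mod_eq_of_lt h
    · rw [Nat.mod_eq_sub_mod (by omega), Nat.mod_eq_of_lt (by omega)]
  have h2 : (c + d) % n = if c + d < n then c + d else c + d - n := by
    split_ifs with h
    · exact Nat.mod_eq_of_lt h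
    · rw [Nat.mod_eq_sub_mod (by omega), Nat.mod_eq_of_lt (by omega)]
  rw [h1, h2]
  split_ifs <;> omega

theorem pow_mul_add_mod_carry {A : Type w} [CommGroup A] {x : A} {n : ℕ} (a b c : ℕ)
    (hb : b < n) (hc : c < n) :
    x ^ (a * b) * x ^ (a * c) =
      x ^ (a * ((b + c) % n)) * (if b + c < n then 1 else x ^ (n * a)) := by
  have h1 : b + c = (b + c) % n + if b + c < n then 0 else n := by
    split_ifs with h
    · rw [Nat.mod_eq_of_lt h]; rfl
    · rw [Nat.mod_eq_sub_mod (by omega), Nat.mod_eq_of_lt (by omega)]; omega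
  rw [← pow_add, ← mul_add]
  conv_lhs => rw [h1]
  split_ifs with h
  · simp
  · rw [mul_add, pow_add, mul_comm a n]

namespace BraidingData

variable {R : Type w} [CommRing R] {k : ℕ} {g : Fin k → G} {n : Fin k → ℕ}

/-- The factor `∏ i` of `1` if `b_i + c_i < n_i`, and of `σ_i ^ (n_i a_i)` if `b_i + c_i ≥ n_i`. -/
noncomputable def assocScalar (d : BraidingData R n) (hg : IsCyclicBasis g n) (a b c : G) : Rˣ :=
  ∏ i, if hg.exponent b i + hg.exponent c i < n i then 1
    else d.diag i ^ (n i * hg.exponent a i)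

/-- The product over all `i ≤ j` of `σ_{i,j} ^ (a_i b_j)`, where `σ_{i,i}` is `σ_i`, and where, for
`i < j`, `σ_{i,j}` stands for the datum `σ_{j,i} = off j i` of the pair. -/
noncomputable def commScalar (d : BraidingData R n) (hg : IsCyclicBasis g n) (a b : G) : Rˣ :=
  (∏ i, d.diag i ^ (hg.exponent a i * hg.exponent b i)) *
    ∏ i, ∏ j, if h : i < j then d.off j i h ^ (hg.exponent a i * hg.exponent b j) else 1

theorem diag_pow_sq (d : BraidingData R n) (i : Fin k) : (d.diag i ^ n i) ^ n i = 1 := by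
  rcases Nat.even_or_odd (n i) with ⟨m, hm⟩ | h
  · rw [← pow_mul, show n i * n i = 2 * n i * m by rw [hm]; ring, pow_mul, d.diag_pow, one_pow]
  · rw [d.diag_pow_of_odd i h, one_pow]

/-- The two factors attached to the data satisfy the coherence identities. -/
noncomputable def cocycle (d : BraidingData R n) (hg : IsCyclicBasis g n) :
    AbelianCocycle G Rˣ where
  assoc := d.assocScalar hg
  comm := d.commScalar hg
  assoc_one a b := by
    refine Finset.prod_eq_one fun i _ => ?_
    rw [hg.exponent_one, if_pos (by simpa using hg.exponent_lt b i)]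
  pentagon a b c e := by
    simp only [assocScalar, ← Finset.prod_mul_distrib]
    refine Finset.prod_congr rfl fun i _ => ?_
    have key (a' b' c' : G) : (if hg.exponent b' i + hg.exponent c' i < n i then (1 : Rˣ)
        else d.diag i ^ (n i * hg.exponent a' i)) = (d.diag i ^ n i) ^
          (hg.exponent a' i * if hg.exponent b' i + hg.exponent c' i < n i then 0 else 1) := by
      split_ifs <;> simp [pow_mul]
    simp only [key]
    have hc := carry_cocycle _ _ _ (hg.exponent_lt b i) (hg.exponent_lt c i) (hg.exponent_lt e i)
    simp only [hg.exponent_mul]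
    rw [mul_comm ((hg.exponent a i + hg.exponent b i) % n i),
      pow_mul_add_mod (d.diag_pow_sq i), ← pow_add, ← pow_add, ← pow_add, ← pow_add, ← mul_add, hc]
    ring_nf
  hexagon_forward a b c := by
    simp only [assocScalar, commScalar]
    have h1 : ∀ i j (h : i < j), d.off j i h ^ (hg.exponent a i * hg.exponent (b * c) j) =
        d.off j i h ^ (hg.exponent a i * hg.exponent b j) *
          d.off j i h ^ (hg.exponent a i * hg.exponent c j) := fun i j h => by
      rw [hg.exponent_mul, pow_mul_add_mod (d.off_pow_left _ _ _)]
    have h2 : (∏ i, ∏ j, if h : i < j then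
          d.off j i h ^ (hg.exponent a i * hg.exponent (b * c) j) else 1) =
        (∏ i, ∏ j, if h : i < j then d.off j i h ^ (hg.exponent a i * hg.exponent b j) else 1) *
        ∏ i, ∏ j, if h : i < j then d.off j i h ^ (hg.exponent a i * hg.exponent c j) else 1 := by
      simp only [← Finset.prod_mul_distrib]
      refine Finset.prod_congr rfl fun i _ => Finset.prod_congr rfl fun j _ => ?_
      split_ifs with h
      · exact h1 i j h
      · simp
    have h3 : (∏ i, if hg.exponent b i + hg.exponent c i < n i then (1 : Rˣ)
          else d.diag i ^ (n i * hg.exponent a i)) *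
        (∏ i, d.diag i ^ (hg.exponent a i * hg.exponent (b * c) i)) =
        (∏ i, d.diag i ^ (hg.exponent a i * hg.exponent b i)) *
        ∏ i, d.diag i ^ (hg.exponent a i * hg.exponent c i) := by
      simp only [← Finset.prod_mul_distrib]
      refine Finset.prod_congr rfl fun i _ => ?_
      rw [hg.exponent_mul, pow_mul_add_mod_carry _ _ _ (hg.exponent_lt b i) (hg.exponent_lt c i),
        mul_comm]
    have h4 : ∀ i, hg.exponent c i + hg.exponent a i = hg.exponent a i + hg.exponent c i :=
      fun i => add_comm _ _
    rw [h2, ← mul_assoc (∏ i, if hg.exponent b i + hg.exponent c i < n i then (1 : Rˣ) else _), h3]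
    simp only [h4]
    ac_rfl
  hexagon_reverse a b c := by
    have h2 : (∏ i, ∏ j, if h : i < j then
          d.off j i h ^ (hg.exponent (a * b) i * hg.exponent c j) else 1) =
        (∏ i, ∏ j, if h : i < j then d.off j i h ^ (hg.exponent a i * hg.exponent c j) else 1) *
        ∏ i, ∏ j, if h : i < j then d.off j i h ^ (hg.exponent b i * hg.exponent c j) else 1 := by
      simp only [← Finset.prod_mul_distrib]
      refine Finset.prod_congr rfl fun i _ => Finset.prod_congr rfl fun j _ => ?_
      split_ifs with h
      · rw [hg.exponent_mul, mul_comm, pow_mul_add_mod (d.off_pow_right _ _ _), mul_comm _ (hg.exponent c j),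
          mul_comm _ (hg.exponent c j)]
      · simp
    have h3 : (∏ i, d.diag i ^ (hg.exponent (a * b) i * hg.exponent c i)) =
        (∏ i, if hg.exponent a i + hg.exponent b i < n i then (1 : Rˣ)
          else d.diag i ^ (n i * hg.exponent c i)) *
        ((∏ i, d.diag i ^ (hg.exponent a i * hg.exponent c i)) *
        ∏ i, d.diag i ^ (hg.exponent b i * hg.exponent c i)) := by
      simp only [← Finset.prod_mul_distrib]
      refine Finset.prod_congr rfl fun i _ => ?_
      rw [hg.exponent_mul, mul_comm (hg.exponent a i), mul_comm (hg.exponent b i),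
        pow_mul_add_mod_carry _ _ _ (hg.exponent_lt a i) (hg.exponent_lt b i), mul_comm _ (hg.exponent c i)]
      split_ifs
      · simp
      · rw [mul_left_comm, ← pow_add, ← two_mul, ← mul_assoc 2, pow_mul (d.diag i) (2 * n i),
          d.diag_pow, one_pow, mul_one]
    have h4 : d.assocScalar hg a c b = d.assocScalar hg a b c := by
      simp only [assocScalar, add_comm]
    rw [h4]
    simp only [commScalar]
    rw [h2, h3]
    change _ * (d.assocScalar hg c a b * _ * _) * _ = _
    have h5 : ∀ x y p q r s : Rˣ,
        x⁻¹ * (y * (p * q) * (r * s)) * y⁻¹ = q * s * x⁻¹ * (p * r) := fun x y p q r s => by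
      rw [mul_assoc x⁻¹, mul_assoc y, mul_inv_cancel_comm]
      ac_rfl
    exact h5 _ _ _ _ _ _

end BraidingData

end Arithmetic


section Graded

/-- A `G`-graded free `R`-module of finite total rank: an `R`-module with submodules
`piece a`, for `a : G`, which has a finite basis of homogeneous elements such that `piece a` is
spanned by the basis elements of degree `a`.  Equivalently, it is the direct sum of its pieces,
all pieces are free, and the total rank is finite. -/
structure FreeGraded (R : Type w) [CommRing R] (G : Type u) where
  carrier : Type w
  [addCommGroup : AddCommGroup carrier]
  [module : Module R carrier]
  piece : G → Submodule R carrier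
  exists_basis : ∃ (ι : Type) (_ : Finite ι) (b : Module.Basis ι R carrier) (deg : ι → G),
    ∀ a, piece a = Submodule.span R (b '' {i | deg i = a})

attribute [instance] FreeGraded.addCommGroup FreeGraded.module

namespace FreeGraded

variable {R : Type w} [CommRing R] {G : Type u}

noncomputable section

/-- The index type of a chosen homogeneous basis. -/
def Index (M : FreeGraded R G) : Type := M.exists_basis.choose

instance (M : FreeGraded R G) : Finite M.Index := M.exists_basis.choose_spec.choose

/-- A chosen homogeneous basis. -/
def basis (M : FreeGraded R G) : Module.Basis M.Index R M.carrier :=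
  M.exists_basis.choose_spec.choose_spec.choose

/-- The degrees of the elements of the chosen homogeneous basis. -/
def deg (M : FreeGraded R G) : M.Index → G :=
  M.exists_basis.choose_spec.choose_spec.choose_spec.choose

theorem piece_eq (M : FreeGraded R G) (a : G) :
    M.piece a = Submodule.span R (M.basis '' {i | M.deg i = a}) :=
  M.exists_basis.choose_spec.choose_spec.choose_spec.choose_spec a

theorem basis_mem (M : FreeGraded R G) (i : M.Index) : M.basis i ∈ M.piece (M.deg i) := by
  rw [piece_eq]
  exact Submodule.subset_span ⟨i, rfl, rfl⟩

/-- The `R`-module of `R`-linear maps which preserve the grading. -/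
def homSubmodule (M N : FreeGraded R G) : Submodule R (M.carrier →ₗ[R] N.carrier) where
  carrier := {f | ∀ a, ∀ x ∈ M.piece a, f x ∈ N.piece a}
  add_mem' hf hg a x hx := Submodule.add_mem _ (hf a x hx) (hg a x hx)
  zero_mem' _ _ _ := Submodule.zero_mem _
  smul_mem' r _ hf a x hx := Submodule.smul_mem _ r (hf a x hx)

theorem le_comap_of_basis {M N : FreeGraded R G} (f : M.carrier →ₗ[R] N.carrier)
    (h : ∀ i, f (M.basis i) ∈ N.piece (M.deg i)) : ∀ a, ∀ x ∈ M.piece a, f x ∈ N.piece a := by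
  intro a x hx
  rw [piece_eq] at hx
  have : Submodule.span R (M.basis '' {i | M.deg i = a}) ≤ (N.piece a).comap f := by
    rw [Submodule.span_le]
    rintro _ ⟨i, rfl, rfl⟩
    exact h i
  exact this hx

theorem lin_ext {M : FreeGraded R G} {P : Type*} [AddCommGroup P] [Module R P]
    {f f' : M.carrier →ₗ[R] P} (h : ∀ a, ∀ x ∈ M.piece a, f x = f' x) : f = f' :=
  M.basis.ext fun i => h _ _ (M.basis_mem i)

theorem tensor_ext {M N : FreeGraded R G} {P : Type*} [AddCommGroup P] [Module R P]
    {f f' : M.carrier ⊗[R] N.carrier →ₗ[R] P}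
    (h : ∀ a b, ∀ x ∈ M.piece a, ∀ y ∈ N.piece b, f (x ⊗ₜ y) = f' (x ⊗ₜ y)) : f = f' := by
  refine TensorProduct.ext ?_
  refine M.basis.ext fun i => N.basis.ext fun j => ?_
  exact h _ _ _ (M.basis_mem i) _ (N.basis_mem j)

theorem piece_induction {M : FreeGraded R G} {a : G} {p : ∀ x, x ∈ M.piece a → Prop}
    (zero : p 0 (Submodule.zero_mem _))
    (add : ∀ x y hx hy, p x hx → p y hy → p (x + y) (Submodule.add_mem _ hx hy))
    (smul : ∀ (r : R) x hx, p x hx → p (r • x) (Submodule.smul_mem _ r hx))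
    (mem : ∀ i (h : M.deg i = a), p (M.basis i) (h ▸ M.basis_mem i))
    {x : M.carrier} (hx : x ∈ M.piece a) : p x hx := by
  have key : ∀ y ∈ Submodule.span R (M.basis '' {i | M.deg i = a}), ∃ hy, p y hy := by
    intro y hy
    induction hy using Submodule.span_induction with
    | mem x h => obtain ⟨i, hi, rfl⟩ := h; exact ⟨_, mem i hi⟩
    | zero => exact ⟨_, zero⟩
    | add x y _ _ hx hy => exact ⟨_, add x y _ _ hx.2 hy.2⟩
    | smul r x _ hx => exact ⟨_, smul r x _ hx.2⟩
  exact (key x (by rwa [← piece_eq])).2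

open scoped Classical in
/-- The graded module which is `R` in degree `a` and `0` in all other degrees. -/
abbrev delta (a : G) : FreeGraded R G where
  carrier := R
  piece b := if b = a then ⊤ else ⊥
  exists_basis := by
    refine ⟨Unit, inferInstance, Module.Basis.singleton Unit R, fun _ => a, fun b => ?_⟩
    split_ifs with h
    · have : Module.Basis.singleton Unit R '' {_i : Unit | a = b} = {1} := by
        ext x; simp [h]
      rw [this]
      exact Ideal.span_singleton_one.symm
    · have : Module.Basis.singleton Unit R '' {_i : Unit | a = b} = ∅ := by
        ext x; simp [Ne.symm h]
      rw [this, Submodule.span_empty]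

theorem mem_delta (a : G) (x : R) : x ∈ (delta (R := R) a).piece a := by
  simp

theorem mem_delta_ne {a b : G} (h : b ≠ a) {x : R} (hx : x ∈ (delta (R := R) a).piece b) :
    x = 0 := by
  simpa [h] using hx

/-- The isomorphism `(M ⊗ N) ⊗ P ≃ M ⊗ (N ⊗ P)` given on the tensor product of pieces of degrees
`a, b, c` by the scalar `α a b c`; see `assocLin_apply`. -/
def assocLin (α : G → G → G → Rˣ) (M N P : FreeGraded R G) :
    (M.carrier ⊗[R] N.carrier) ⊗[R] P.carrier ≃ₗ[R] M.carrier ⊗[R] (N.carrier ⊗[R] P.carrier) :=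
  ((M.basis.tensorProduct N.basis).tensorProduct P.basis).equiv
    ((M.basis.tensorProduct (N.basis.tensorProduct P.basis)).unitsSMul
      fun i => α (M.deg i.1) (N.deg i.2.1) (P.deg i.2.2))
    (Equiv.prodAssoc _ _ _)

theorem assocLin_apply (α : G → G → G → Rˣ) {M N P : FreeGraded R G} {a b c : G}
    {x : M.carrier} {y : N.carrier} {z : P.carrier}
    (hx : x ∈ M.piece a) (hy : y ∈ N.piece b) (hz : z ∈ P.piece c) :
    assocLin α M N P ((x ⊗ₜ y) ⊗ₜ z) = (α a b c : R) • (x ⊗ₜ (y ⊗ₜ z)) := by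
  induction hx using piece_induction with
  | zero => simp
  | add x x' _ _ h h' => simp only [TensorProduct.add_tmul, map_add, h, h', smul_add]
  | smul r x _ h => simp only [← TensorProduct.smul_tmul', map_smul, h, smul_comm r]
  | mem i hi =>
    induction hy using piece_induction with
    | zero => simp
    | add x x' _ _ h h' =>
      simp only [TensorProduct.tmul_add, TensorProduct.add_tmul, map_add, h, h', smul_add]
    | smul r x _ h =>
      simp only [TensorProduct.tmul_smul, ← TensorProduct.smul_tmul', map_smul, h, smul_comm r]
    | mem j hj =>
      induction hz using piece_induction with
      | zero => simp
      | add x x' _ _ h h' =>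
        simp only [TensorProduct.tmul_add, map_add, h, h', smul_add]
      | smul r x _ h =>
        simp only [TensorProduct.tmul_smul, map_smul, h, smul_comm r]
      | mem l hl =>
        subst hi hj hl
        have := ((M.basis.tensorProduct N.basis).tensorProduct P.basis).equiv_apply ((i, j), l)
          ((M.basis.tensorProduct (N.basis.tensorProduct P.basis)).unitsSMul
            fun i => α (M.deg i.1) (N.deg i.2.1) (P.deg i.2.2))
          (Equiv.prodAssoc _ _ _)
        simpa [assocLin, Module.Basis.tensorProduct_apply', Module.Basis.unitsSMul_apply, Units.smul_def]
          using this

/-- The isomorphism `M ⊗ N ≃ N ⊗ M` given on the tensor product of pieces of degrees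
`a, b` by the scalar `γ a b`; see `commLin_apply`. -/
def commLin (γ : G → G → Rˣ) (M N : FreeGraded R G) :
    M.carrier ⊗[R] N.carrier ≃ₗ[R] N.carrier ⊗[R] M.carrier :=
  (M.basis.tensorProduct N.basis).equiv
    ((N.basis.tensorProduct M.basis).unitsSMul fun i => γ (M.deg i.2) (N.deg i.1))
    (Equiv.prodComm _ _)

theorem commLin_apply (γ : G → G → Rˣ) {M N : FreeGraded R G} {a b : G}
    {x : M.carrier} {y : N.carrier} (hx : x ∈ M.piece a) (hy : y ∈ N.piece b) :
    commLin γ M N (x ⊗ₜ y) = (γ a b : R) • (y ⊗ₜ x) := by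
  induction hx using piece_induction with
  | zero => simp
  | add x x' _ _ h h' =>
    simp only [TensorProduct.add_tmul, TensorProduct.tmul_add, map_add, h, h', smul_add]
  | smul r x _ h =>
    simp only [← TensorProduct.smul_tmul', TensorProduct.tmul_smul, map_smul, h, smul_comm r]
  | mem i hi =>
    induction hy using piece_induction with
    | zero => simp
    | add x x' _ _ h h' =>
      simp only [TensorProduct.add_tmul, TensorProduct.tmul_add, map_add, h, h', smul_add]
    | smul r x _ h =>
      simp only [← TensorProduct.smul_tmul', TensorProduct.tmul_smul, map_smul, h, smul_comm r]
    | mem j hj =>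
      subst hi hj
      have := (M.basis.tensorProduct N.basis).equiv_apply (i, j)
        ((N.basis.tensorProduct M.basis).unitsSMul fun i => γ (M.deg i.2) (N.deg i.1))
        (Equiv.prodComm _ _)
      simpa [commLin, Module.Basis.tensorProduct_apply', Module.Basis.unitsSMul_apply, Units.smul_def]
        using this

theorem assocLin_symm_apply (α : G → G → G → Rˣ) {M N P : FreeGraded R G} {a b c : G}
    {x : M.carrier} {y : N.carrier} {z : P.carrier}
    (hx : x ∈ M.piece a) (hy : y ∈ N.piece b) (hz : z ∈ P.piece c) :
    (assocLin α M N P).symm (x ⊗ₜ (y ⊗ₜ z)) = (((α a b c)⁻¹ : Rˣ) : R) • ((x ⊗ₜ y) ⊗ₜ z) := by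
  rw [LinearEquiv.symm_apply_eq, map_smul, assocLin_apply α hx hy hz, smul_smul]
  simp

theorem commLin_symm_apply (γ : G → G → Rˣ) {M N : FreeGraded R G} {a b : G}
    {x : M.carrier} {y : N.carrier} (hx : x ∈ M.piece a) (hy : y ∈ N.piece b) :
    (commLin γ M N).symm (y ⊗ₜ x) = (((γ a b)⁻¹ : Rˣ) : R) • (x ⊗ₜ y) := by
  rw [LinearEquiv.symm_apply_eq, map_smul, commLin_apply γ hx hy, smul_smul]
  simp

theorem tensor_ext_left {M N P : FreeGraded R G} {Q : Type*} [AddCommGroup Q] [Module R Q]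
    {f f' : (M.carrier ⊗[R] N.carrier) ⊗[R] P.carrier →ₗ[R] Q}
    (h : ∀ a b c, ∀ x ∈ M.piece a, ∀ y ∈ N.piece b, ∀ z ∈ P.piece c,
      f ((x ⊗ₜ y) ⊗ₜ z) = f' ((x ⊗ₜ y) ⊗ₜ z)) : f = f' :=
  ((M.basis.tensorProduct N.basis).tensorProduct P.basis).ext fun i => by
    simpa [Module.Basis.tensorProduct_apply'] using
      h _ _ _ _ (M.basis_mem i.1.1) _ (N.basis_mem i.1.2) _ (P.basis_mem i.2)

theorem tensor_ext_right {M N P : FreeGraded R G} {Q : Type*} [AddCommGroup Q] [Module R Q]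
    {f f' : M.carrier ⊗[R] (N.carrier ⊗[R] P.carrier) →ₗ[R] Q}
    (h : ∀ a b c, ∀ x ∈ M.piece a, ∀ y ∈ N.piece b, ∀ z ∈ P.piece c,
      f (x ⊗ₜ (y ⊗ₜ z)) = f' (x ⊗ₜ (y ⊗ₜ z))) : f = f' :=
  (M.basis.tensorProduct (N.basis.tensorProduct P.basis)).ext fun i => by
    simpa [Module.Basis.tensorProduct_apply'] using
      h _ _ _ _ (M.basis_mem i.1) _ (N.basis_mem i.2.1) _ (P.basis_mem i.2.2)

theorem tensor_ext_four {M N P L : FreeGraded R G} {Q : Type*} [AddCommGroup Q] [Module R Q]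
    {f f' : ((M.carrier ⊗[R] N.carrier) ⊗[R] P.carrier) ⊗[R] L.carrier →ₗ[R] Q}
    (h : ∀ a b c d, ∀ x ∈ M.piece a, ∀ y ∈ N.piece b, ∀ z ∈ P.piece c, ∀ t ∈ L.piece d,
      f (((x ⊗ₜ y) ⊗ₜ z) ⊗ₜ t) = f' (((x ⊗ₜ y) ⊗ₜ z) ⊗ₜ t)) : f = f' :=
  (((M.basis.tensorProduct N.basis).tensorProduct P.basis).tensorProduct L.basis).ext fun i => by
    simpa [Module.Basis.tensorProduct_apply'] using
      h _ _ _ _ _ (M.basis_mem i.1.1.1) _ (N.basis_mem i.1.1.2) _ (P.basis_mem i.1.2) _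
        (L.basis_mem i.2)

section Tensor

variable [CommGroup G]

/-- The graded tensor product: the piece of degree `c` is the span of the products of elements of
degrees `a` and `b` with `a * b = c`. -/
abbrev tensorObj (M N : FreeGraded R G) : FreeGraded R G where
  carrier := M.carrier ⊗[R] N.carrier
  piece c := ⨆ p : {p : G × G // p.1 * p.2 = c},
    Submodule.map₂ (TensorProduct.mk R M.carrier N.carrier) (M.piece p.1.1) (N.piece p.1.2)
  exists_basis := by
    refine ⟨M.Index × N.Index, inferInstance, M.basis.tensorProduct N.basis,
      fun i => M.deg i.1 * N.deg i.2, fun c => ?_⟩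
    simp only [piece_eq, Submodule.map₂_span_span, ← Submodule.span_iUnion]
    congr 1
    ext x
    simp only [Set.mem_iUnion, Set.mem_image2, Set.mem_image, Set.mem_ofPred_eq]
    constructor
    · rintro ⟨⟨⟨a, b⟩, rfl⟩, _, ⟨i, rfl, rfl⟩, _, ⟨j, rfl, rfl⟩, rfl⟩
      exact ⟨(i, j), rfl, by simp [Module.Basis.tensorProduct_apply']⟩
    · rintro ⟨⟨i, j⟩, rfl, rfl⟩
      exact ⟨⟨(M.deg i, N.deg j), rfl⟩, _, ⟨i, rfl, rfl⟩, _, ⟨j, rfl, rfl⟩,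
        by simp [Module.Basis.tensorProduct_apply']⟩

theorem tmul_mem {M N : FreeGraded R G} {a b : G} {x : M.carrier} {y : N.carrier}
    (hx : x ∈ M.piece a) (hy : y ∈ N.piece b) : x ⊗ₜ[R] y ∈ (tensorObj M N).piece (a * b) :=
  Submodule.mem_iSup_of_mem (⟨(a, b), rfl⟩ : {p : G × G // p.1 * p.2 = a * b})
    (Submodule.apply_mem_map₂ _ hx hy)

theorem tensor_mem_of {M N P : FreeGraded R G} (f : M.carrier ⊗[R] N.carrier →ₗ[R] P.carrier)
    (h : ∀ a b, ∀ x ∈ M.piece a, ∀ y ∈ N.piece b, f (x ⊗ₜ y) ∈ P.piece (a * b)) :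
    ∀ a, ∀ x ∈ (tensorObj M N).piece a, f x ∈ P.piece a := by
  intro a x hx
  have : (tensorObj M N).piece a ≤ (P.piece a).comap f := by
    refine iSup_le ?_
    rintro ⟨⟨b, c⟩, rfl⟩
    exact Submodule.map₂_le.2 fun x hx y hy => h _ _ x hx y hy
  exact this hx

theorem tensor_mem_left {M N P Q : FreeGraded R G}
    (f : (M.carrier ⊗[R] N.carrier) ⊗[R] P.carrier →ₗ[R] Q.carrier)
    (h : ∀ a b c, ∀ x ∈ M.piece a, ∀ y ∈ N.piece b, ∀ z ∈ P.piece c,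
      f ((x ⊗ₜ y) ⊗ₜ z) ∈ Q.piece (a * b * c)) :
    ∀ a, ∀ x ∈ (tensorObj (tensorObj M N) P).piece a, f x ∈ Q.piece a := by
  refine tensor_mem_of (M := tensorObj M N) f fun d c x hx z hz => ?_
  have : (tensorObj M N).piece d ≤
      (Q.piece (d * c)).comap (f ∘ₗ (TensorProduct.mk R (M.carrier ⊗[R] N.carrier) P.carrier).flip z) := by
    refine iSup_le ?_
    rintro ⟨⟨a, b⟩, rfl⟩
    exact Submodule.map₂_le.2 fun x hx y hy => h _ _ _ x hx y hy z hz
  exact this hx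

theorem tensor_mem_right {M N P Q : FreeGraded R G}
    (f : M.carrier ⊗[R] (N.carrier ⊗[R] P.carrier) →ₗ[R] Q.carrier)
    (h : ∀ a b c, ∀ x ∈ M.piece a, ∀ y ∈ N.piece b, ∀ z ∈ P.piece c,
      f (x ⊗ₜ (y ⊗ₜ z)) ∈ Q.piece (a * (b * c))) :
    ∀ a, ∀ x ∈ (tensorObj M (tensorObj N P)).piece a, f x ∈ Q.piece a := by
  refine tensor_mem_of (N := tensorObj N P) f fun a d x hx z hz => ?_
  have : (tensorObj N P).piece d ≤
      (Q.piece (a * d)).comap (f ∘ₗ (TensorProduct.mk R M.carrier (N.carrier ⊗[R] P.carrier)) x) := by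
    refine iSup_le ?_
    rintro ⟨⟨b, c⟩, rfl⟩
    exact Submodule.map₂_le.2 fun y hy z hz => h _ _ _ x hx y hy z hz
  exact this hz

end Tensor

end

end FreeGraded

open FreeGraded

/-- The category of graded modules, to be equipped with the twisted structure given by `ω`. -/
structure TwistedGraded {R : Type w} [CommRing R] {G : Type u} [CommGroup G]
    (ω : AbelianCocycle G Rˣ) where
  obj : FreeGraded R G

namespace TwistedGraded

noncomputable section

variable {R : Type w} [CommRing R] {G : Type u} [CommGroup G] {ω : AbelianCocycle G Rˣ}

instance : Category.{w} (TwistedGraded ω) where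
  Hom M N := homSubmodule M.obj N.obj
  id M := ⟨LinearMap.id, fun _ _ hx => hx⟩
  comp f g := ⟨g.1 ∘ₗ f.1, fun a x hx => g.2 a _ (f.2 a x hx)⟩

/-- The linear map underlying a morphism. -/
def toLin {M N : TwistedGraded ω} (f : M ⟶ N) : M.obj.carrier →ₗ[R] N.obj.carrier := f.1

theorem toLin_mem {M N : TwistedGraded ω} (f : M ⟶ N) {a : G} {x : M.obj.carrier}
    (hx : x ∈ M.obj.piece a) : toLin f x ∈ N.obj.piece a := f.2 a x hx

/-- A linear map which preserves the grading, as a morphism. -/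
def ofLin {M N : TwistedGraded ω} (f : M.obj.carrier →ₗ[R] N.obj.carrier)
    (h : ∀ a, ∀ x ∈ M.obj.piece a, f x ∈ N.obj.piece a) : M ⟶ N := ⟨f, h⟩

@[simp] theorem toLin_ofLin {M N : TwistedGraded ω} (f : M.obj.carrier →ₗ[R] N.obj.carrier)
    (h : ∀ a, ∀ x ∈ M.obj.piece a, f x ∈ N.obj.piece a) :
    toLin (ofLin f h : M ⟶ N) = f := rfl

@[ext]
theorem hom_ext {M N : TwistedGraded ω} {f f' : M ⟶ N} (h : toLin f = toLin f') : f = f' :=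
  Subtype.ext h

@[simp] theorem toLin_id (M : TwistedGraded ω) : toLin (𝟙 M) = LinearMap.id := rfl

@[simp] theorem toLin_comp {M N P : TwistedGraded ω} (f : M ⟶ N) (f' : N ⟶ P) :
    toLin (f ≫ f') = toLin f' ∘ₗ toLin f := rfl

/-- A linear equivalence which preserves the grading in both directions, as an isomorphism. -/
def isoOfLin {M N : TwistedGraded ω} (e : M.obj.carrier ≃ₗ[R] N.obj.carrier)
    (h : ∀ a, ∀ x ∈ M.obj.piece a, e x ∈ N.obj.piece a)
    (h' : ∀ a, ∀ x ∈ N.obj.piece a, e.symm x ∈ M.obj.piece a) : M ≅ N where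
  hom := ofLin e.toLinearMap h
  inv := ofLin e.symm.toLinearMap h'
  hom_inv_id := by ext x; exact e.symm_apply_apply x
  inv_hom_id := by ext x; exact e.apply_symm_apply x

@[simp] theorem toLin_isoOfLin_hom {M N : TwistedGraded ω}
    (e : M.obj.carrier ≃ₗ[R] N.obj.carrier) (h h') :
    toLin (isoOfLin e h h' : M ≅ N).hom = e.toLinearMap := rfl

@[simp] theorem toLin_isoOfLin_inv {M N : TwistedGraded ω}
    (e : M.obj.carrier ≃ₗ[R] N.obj.carrier) (h h') :
    toLin (isoOfLin e h h' : M ≅ N).inv = e.symm.toLinearMap := rfl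

instance : Preadditive (TwistedGraded ω) where
  homGroup M N := inferInstanceAs (AddCommGroup (homSubmodule M.obj N.obj))
  add_comp _ _ _ f f' h := hom_ext (LinearMap.comp_add f.1 f'.1 h.1)
  comp_add _ _ _ f h h' := hom_ext (LinearMap.add_comp f.1 h'.1 h.1)

instance : Linear R (TwistedGraded ω) where
  homModule M N := inferInstanceAs (Module R (homSubmodule M.obj N.obj))
  smul_comp _ _ _ r f h := hom_ext (LinearMap.comp_smul h.1 r f.1)
  comp_smul _ _ _ f r h := hom_ext (LinearMap.smul_comp r h.1 f.1)

@[simp] theorem toLin_add {M N : TwistedGraded ω} (f f' : M ⟶ N) :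
    toLin (f + f') = toLin f + toLin f' := rfl

@[simp] theorem toLin_zero {M N : TwistedGraded ω} : toLin (0 : M ⟶ N) = 0 := rfl

@[simp] theorem toLin_smul {M N : TwistedGraded ω} (r : R) (f : M ⟶ N) :
    toLin (r • f) = r • toLin f := rfl

/-- The monoidal operations: the standard graded tensor product, and the associativity
isomorphism multiplied by `ω.assoc a b c` on the product of pieces of degrees `a, b, c`. -/
instance : MonoidalCategoryStruct (TwistedGraded ω) where
  tensorObj M N := ⟨tensorObj M.obj N.obj⟩
  tensorUnit := ⟨delta 1⟩
  whiskerLeft M _ _ f := ofLin ((toLin f).lTensor M.obj.carrier)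
    (tensor_mem_of _ fun _ _ _ hx _ hy => tmul_mem hx (toLin_mem f hy))
  whiskerRight f N := ofLin ((toLin f).rTensor N.obj.carrier)
    (tensor_mem_of _ fun _ _ _ hx _ hy => tmul_mem (toLin_mem f hx) hy)
  tensorHom f f' := ofLin (TensorProduct.map (toLin f) (toLin f'))
    (tensor_mem_of _ fun _ _ _ hx _ hy => tmul_mem (toLin_mem f hx) (toLin_mem f' hy))
  associator M N P := isoOfLin (assocLin ω.assoc M.obj N.obj P.obj)
    (tensor_mem_left _ fun a b c x hx y hy z hz => by
      change assocLin _ _ _ _ _ ∈ _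
      rw [assocLin_apply _ hx hy hz, mul_assoc]
      exact Submodule.smul_mem _ _ (tmul_mem hx (tmul_mem hy hz)))
    (tensor_mem_right _ fun a b c x hx y hy z hz => by
      change (assocLin _ _ _ _).symm _ ∈ _
      rw [assocLin_symm_apply _ hx hy hz, ← mul_assoc]
      exact Submodule.smul_mem _ _ (tmul_mem (tmul_mem hx hy) hz))
  leftUnitor M := isoOfLin (TensorProduct.lid R M.obj.carrier)
    (tensor_mem_of _ fun a b x hx y hy => by
      by_cases h : a = 1
      · subst h
        simpa using Submodule.smul_mem _ x hy
      · rw [mem_delta_ne h hx]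
        simp)
    (fun a x hx => by
      have := tmul_mem (mem_delta (R := R) (1 : G) 1) hx
      rw [one_mul] at this
      simpa using this)
  rightUnitor M := isoOfLin (TensorProduct.rid R M.obj.carrier)
    (tensor_mem_of _ fun b a y hy x hx => by
      by_cases h : a = 1
      · subst h
        simpa using Submodule.smul_mem _ x hy
      · rw [mem_delta_ne h hx]
        simp)
    (fun a x hx => by
      have := tmul_mem hx (mem_delta (R := R) (1 : G) 1)
      rw [mul_one] at this
      simpa using this)

theorem toLin_whiskerLeft (M : TwistedGraded ω) {N P : TwistedGraded ω} (f : N ⟶ P) :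
    toLin (M ◁ f) = (toLin f).lTensor M.obj.carrier := rfl

theorem toLin_whiskerRight {N P : TwistedGraded ω} (f : N ⟶ P) (M : TwistedGraded ω) :
    toLin (f ▷ M) = (toLin f).rTensor M.obj.carrier := rfl

theorem toLin_tensorHom {M N P Q : TwistedGraded ω} (f : M ⟶ N) (f' : P ⟶ Q) :
    toLin (f ⊗ₘ f') = TensorProduct.map (toLin f) (toLin f') := rfl

theorem toLin_associator (M N P : TwistedGraded ω) :
    toLin (α_ M N P).hom = (assocLin ω.assoc M.obj N.obj P.obj).toLinearMap := rfl

theorem toLin_associator_inv (M N P : TwistedGraded ω) :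
    toLin (α_ M N P).inv = (assocLin ω.assoc M.obj N.obj P.obj).symm.toLinearMap := rfl

theorem toLin_leftUnitor (M : TwistedGraded ω) :
    toLin (λ_ M).hom = (TensorProduct.lid R M.obj.carrier).toLinearMap := rfl

theorem toLin_rightUnitor (M : TwistedGraded ω) :
    toLin (ρ_ M).hom = (TensorProduct.rid R M.obj.carrier).toLinearMap := rfl

instance : MonoidalCategory (TwistedGraded ω) where
  tensorHom_def f f' := hom_ext (TensorProduct.ext' fun _ _ => rfl)
  id_tensorHom_id _ _ := hom_ext (TensorProduct.ext' fun _ _ => rfl)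
  tensorHom_comp_tensorHom _ _ _ _ := hom_ext (TensorProduct.ext' fun _ _ => rfl)
  whiskerLeft_id _ _ := hom_ext (TensorProduct.ext' fun _ _ => rfl)
  id_whiskerRight _ _ := hom_ext (TensorProduct.ext' fun _ _ => rfl)
  associator_naturality {M N P M' N' P'} f f' f'' := by
    refine hom_ext (tensor_ext_left fun a b c x hx y hy z hz => ?_)
    change assocLin ω.assoc M'.obj N'.obj P'.obj ((toLin f x ⊗ₜ toLin f' y) ⊗ₜ toLin f'' z) =
      TensorProduct.map (toLin f) (TensorProduct.map (toLin f') (toLin f''))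
        (assocLin ω.assoc M.obj N.obj P.obj ((x ⊗ₜ y) ⊗ₜ z))
    rw [assocLin_apply _ hx hy hz,
      assocLin_apply _ (toLin_mem f hx) (toLin_mem f' hy) (toLin_mem f'' hz)]
    simp
  leftUnitor_naturality f := by
    refine hom_ext (TensorProduct.ext' fun x y => ?_)
    change (TensorProduct.lid R _) (x ⊗ₜ toLin f y) = toLin f (TensorProduct.lid R _ (x ⊗ₜ y))
    simp
  rightUnitor_naturality f := by
    refine hom_ext (TensorProduct.ext' fun x y => ?_)
    change (TensorProduct.rid R _) (toLin f x ⊗ₜ y) = toLin f (TensorProduct.rid R _ (x ⊗ₜ y))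
    simp
  pentagon M N P Q := by
    refine hom_ext (tensor_ext_four fun a b c d x hx y hy z hz t ht => ?_)
    change (assocLin ω.assoc N.obj P.obj Q.obj).toLinearMap.lTensor M.obj.carrier
        (assocLin ω.assoc M.obj (tensorObj N.obj P.obj) Q.obj
          (assocLin ω.assoc M.obj N.obj P.obj ((x ⊗ₜ y) ⊗ₜ z) ⊗ₜ t)) =
      assocLin ω.assoc M.obj N.obj (tensorObj P.obj Q.obj)
        (assocLin ω.assoc (tensorObj M.obj N.obj) P.obj Q.obj (((x ⊗ₜ y) ⊗ₜ z) ⊗ₜ t))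
    have e1 := assocLin_apply ω.assoc hx hy hz
    have e2 := assocLin_apply ω.assoc hx (tmul_mem hy hz) ht
    have e3 := assocLin_apply ω.assoc hy hz ht
    have e4 := assocLin_apply ω.assoc (tmul_mem hx hy) hz ht
    have e5 := assocLin_apply ω.assoc hx hy (tmul_mem hz ht)
    rw [e1, ← TensorProduct.smul_tmul', map_smul, map_smul, e2, map_smul,
      LinearMap.lTensor_tmul, LinearEquiv.coe_coe, e3, e4, map_smul, e5, TensorProduct.tmul_smul,
      smul_smul, smul_smul, smul_smul]
    have := congrArg (Units.val) (ω.pentagon a b c d)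
    push_cast at this
    rw [this]
  triangle M N := by
    refine hom_ext (tensor_ext_left (N := delta 1) fun a b c x hx y hy z hz => ?_)
    change (TensorProduct.lid R N.obj.carrier).toLinearMap.lTensor M.obj.carrier
        (assocLin ω.assoc M.obj (delta 1) N.obj ((x ⊗ₜ y) ⊗ₜ z)) =
      (TensorProduct.rid R M.obj.carrier).toLinearMap.rTensor N.obj.carrier ((x ⊗ₜ y) ⊗ₜ z)
    rw [assocLin_apply ω.assoc hx (mem_delta (1 : G) y) hz, ω.assoc_one]
    simp [TensorProduct.smul_tmul]

/-- The commutativity isomorphism is the natural one multiplied by `ω.comm a b` on the product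
of pieces of degrees `a, b`. -/
instance : BraidedCategory (TwistedGraded ω) where
  braiding M N := isoOfLin (M := M ⊗ N) (N := N ⊗ M) (commLin ω.comm M.obj N.obj)
    (tensor_mem_of _ fun a b x hx y hy => by
      change commLin _ _ _ _ ∈ _
      rw [commLin_apply _ hx hy, mul_comm]
      exact Submodule.smul_mem _ _ (tmul_mem hy hx))
    (tensor_mem_of _ fun a b x hx y hy => by
      change (commLin _ _ _).symm _ ∈ _
      rw [commLin_symm_apply _ hy hx, mul_comm]
      exact Submodule.smul_mem _ _ (tmul_mem hy hx))
  braiding_naturality_right M {N P} f := by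
    refine hom_ext (tensor_ext fun a b x hx y hy => ?_)
    change commLin ω.comm M.obj P.obj (x ⊗ₜ toLin f y) =
      (toLin f).rTensor M.obj.carrier (commLin ω.comm M.obj N.obj (x ⊗ₜ y))
    rw [commLin_apply _ hx hy, commLin_apply _ hx (toLin_mem f hy), map_smul,
      LinearMap.rTensor_tmul]
  braiding_naturality_left {M N} f P := by
    refine hom_ext (tensor_ext fun a b x hx y hy => ?_)
    change commLin ω.comm N.obj P.obj (toLin f x ⊗ₜ y) =
      (toLin f).lTensor P.obj.carrier (commLin ω.comm M.obj P.obj (x ⊗ₜ y))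
    rw [commLin_apply _ hx hy, commLin_apply _ (toLin_mem f hx) hy, map_smul,
      LinearMap.lTensor_tmul]
  hexagon_forward M N P := by
    refine hom_ext (tensor_ext_left fun a b c x hx y hy z hz => ?_)
    change assocLin ω.assoc N.obj P.obj M.obj
        (commLin ω.comm M.obj (tensorObj N.obj P.obj)
          (assocLin ω.assoc M.obj N.obj P.obj ((x ⊗ₜ y) ⊗ₜ z))) =
      (commLin ω.comm M.obj P.obj).toLinearMap.lTensor N.obj.carrier
        (assocLin ω.assoc N.obj M.obj P.obj (commLin ω.comm M.obj N.obj (x ⊗ₜ y) ⊗ₜ z))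
    have e1 := assocLin_apply ω.assoc hx hy hz
    have e2 := commLin_apply ω.comm hx (tmul_mem hy hz)
    have e3 := assocLin_apply ω.assoc hy hz hx
    have e4 := commLin_apply ω.comm hx hy
    have e5 := assocLin_apply ω.assoc hy hx hz
    have e6 := commLin_apply ω.comm hx hz
    rw [e1, map_smul, map_smul, e2, map_smul, e3, e4, ← TensorProduct.smul_tmul', map_smul, e5,
      map_smul, map_smul, LinearMap.lTensor_tmul, LinearEquiv.coe_coe, e6, TensorProduct.tmul_smul,
      smul_smul, smul_smul, smul_smul, smul_smul]
    have := congrArg (Units.val) (ω.hexagon_forward a b c)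
    push_cast at this
    rw [this]
  hexagon_reverse M N P := by
    refine hom_ext (tensor_ext_right fun a b c x hx y hy z hz => ?_)
    change (assocLin ω.assoc P.obj M.obj N.obj).symm
        (commLin ω.comm (tensorObj M.obj N.obj) P.obj
          ((assocLin ω.assoc M.obj N.obj P.obj).symm (x ⊗ₜ (y ⊗ₜ z)))) =
      (commLin ω.comm M.obj P.obj).toLinearMap.rTensor N.obj.carrier
        ((assocLin ω.assoc M.obj P.obj N.obj).symm (x ⊗ₜ commLin ω.comm N.obj P.obj (y ⊗ₜ z)))
    have e1 := assocLin_symm_apply ω.assoc hx hy hz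
    have e2 := commLin_apply ω.comm (tmul_mem hx hy) hz
    have e3 := assocLin_symm_apply ω.assoc hz hx hy
    have e4 := commLin_apply ω.comm hy hz
    have e5 := assocLin_symm_apply ω.assoc hx hz hy
    have e6 := commLin_apply ω.comm hx hz
    rw [e1, map_smul, map_smul, e2, map_smul, e3, e4, TensorProduct.tmul_smul, map_smul, e5,
      map_smul, map_smul, LinearMap.rTensor_tmul, LinearEquiv.coe_coe, e6,
      ← TensorProduct.smul_tmul', smul_smul, smul_smul, smul_smul, smul_smul]
    have := congrArg (Units.val) (ω.hexagon_reverse a b c)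
    push_cast at this
    rw [this]

instance : MonoidalPreadditive (TwistedGraded ω) where
  whiskerLeft_zero := hom_ext (LinearMap.lTensor_zero _)
  zero_whiskerRight := hom_ext (LinearMap.rTensor_zero _)
  whiskerLeft_add _ _ := hom_ext (LinearMap.lTensor_add _ _ _)
  add_whiskerRight _ _ := hom_ext (LinearMap.rTensor_add _ _ _)

instance : MonoidalLinear R (TwistedGraded ω) where
  whiskerLeft_smul _ _ _ r _ := hom_ext (LinearMap.lTensor_smul _ r _)
  smul_whiskerRight r _ _ _ _ := hom_ext (LinearMap.rTensor_smul _ r _)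

theorem associator_tmul {M N P : TwistedGraded ω} {a b c : G} {x : M.obj.carrier}
    {y : N.obj.carrier} {z : P.obj.carrier}
    (hx : x ∈ M.obj.piece a) (hy : y ∈ N.obj.piece b) (hz : z ∈ P.obj.piece c) :
    toLin (α_ M N P).hom ((x ⊗ₜ[R] y) ⊗ₜ[R] z : (M.obj.carrier ⊗[R] N.obj.carrier) ⊗[R] P.obj.carrier) =
      ((ω.assoc a b c : R) • (x ⊗ₜ[R] (y ⊗ₜ[R] z)) :
        M.obj.carrier ⊗[R] (N.obj.carrier ⊗[R] P.obj.carrier)) :=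
  assocLin_apply _ hx hy hz

theorem braiding_tmul {M N : TwistedGraded ω} {a b : G} {x : M.obj.carrier}
    {y : N.obj.carrier} (hx : x ∈ M.obj.piece a) (hy : y ∈ N.obj.piece b) :
    toLin (β_ M N).hom (x ⊗ₜ[R] y : M.obj.carrier ⊗[R] N.obj.carrier) =
      ((ω.comm a b : R) • (y ⊗ₜ[R] x) : N.obj.carrier ⊗[R] M.obj.carrier) :=
  commLin_apply _ hx hy

/-- The direct sum of a finite family of graded modules. -/
def piObj {J : Type} [Finite J] (M : J → TwistedGraded ω) : TwistedGraded ω where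
  obj :=
    { carrier := ∀ j, (M j).obj.carrier
      piece := fun a => Submodule.pi Set.univ fun j => (M j).obj.piece a
      exists_basis := by
        classical
        have := Fintype.ofFinite J
        refine ⟨Σ j, (M j).obj.Index, inferInstance, Pi.basis fun j => (M j).obj.basis,
          fun i => (M i.1).obj.deg i.2, fun a => le_antisymm ?_ ?_⟩
        · intro x hx
          rw [← Finset.univ_sum_single x]
          refine Submodule.sum_mem _ fun j _ => ?_
          have hj : x j ∈ (M j).obj.piece a := hx j trivial
          refine piece_induction (p := fun y _ => (Pi.single j y : ∀ j, (M j).obj.carrier) ∈ _)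
            ?_ ?_ ?_ ?_ hj
          · simp
          · intro y z _ _ hy hz
            rw [Pi.single_add]
            exact Submodule.add_mem _ hy hz
          · intro r y _ hy
            rw [Pi.single_smul]
            exact Submodule.smul_mem _ r hy
          · intro i hi
            exact Submodule.subset_span ⟨⟨j, i⟩, hi, by simp [Pi.basis_apply]⟩
        · rw [Submodule.span_le]
          rintro _ ⟨⟨j, i⟩, rfl, rfl⟩ j' -
          rw [Pi.basis_apply]
          by_cases h : j' = j
          · subst h
            simpa using (M j').obj.basis_mem i
          · simp [h] }

/-- The inclusions and projections of a direct sum. -/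
def piBicone {J : Type} [Finite J] [DecidableEq J] (M : J → TwistedGraded ω) : Bicone M where
  pt := piObj M
  π j := ofLin (M := piObj M) (LinearMap.proj j) fun _ _ hx => hx j trivial
  ι j := ofLin (N := piObj M) (LinearMap.single R (fun j => (M j).obj.carrier) j)
    fun a x hx j' _ => by
      by_cases h : j' = j
      · subst h
        change (Pi.single j' x : ∀ j, (M j).obj.carrier) j' ∈ _
        rw [Pi.single_eq_same]
        exact hx
      · change (Pi.single j x : ∀ j, (M j).obj.carrier) j' ∈ _
        rw [Pi.single_eq_of_ne h]
        exact Submodule.zero_mem _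
  ι_π i j := by
    split_ifs with h
    · subst h
      exact hom_ext (LinearMap.ext fun x => Pi.single_eq_same (M := fun j => (M j).obj.carrier) i x)
    · exact hom_ext (LinearMap.ext fun x =>
        Pi.single_eq_of_ne (M := fun j => (M j).obj.carrier) (Ne.symm h) x)

/-- The linear map underlying a morphism, additively in the morphism. -/
def toLinHom (M N : TwistedGraded ω) :
    (M ⟶ N) →+ (M.obj.carrier →ₗ[R] N.obj.carrier) where
  toFun := toLin
  map_zero' := rfl
  map_add' _ _ := rfl

theorem toLin_sum {M N : TwistedGraded ω} {J : Type} [Fintype J] (f : J → (M ⟶ N)) :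
    toLin (∑ j, f j) = ∑ j, toLin (f j) :=
  map_sum (toLinHom M N) f Finset.univ

instance : HasFiniteBiproducts (TwistedGraded ω) where
  out _ := ⟨fun F => by
    refine hasBiproduct_of_total (piBicone F) (hom_ext ?_)
    rw [toLin_sum]
    refine LinearMap.ext fun x => ?_
    rw [LinearMap.sum_apply]
    exact Finset.univ_sum_single (M := fun j => (F j).obj.carrier) x⟩

/-- The simple object concentrated in degree `a`. -/
abbrev simpleObj (ω : AbelianCocycle G Rˣ) (a : G) : TwistedGraded ω := ⟨delta a⟩

theorem eq_zero_of_ne {a b : G} (h : a ≠ b) (f : simpleObj ω a ⟶ simpleObj ω b) : f = 0 := by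
  refine hom_ext (LinearMap.ext fun x => ?_)
  exact mem_delta_ne h (toLin_mem f (mem_delta a x))

theorem eq_of_iso [Nontrivial R] {a b : G} (e : simpleObj ω a ≅ simpleObj ω b) : a = b := by
  by_contra h
  have h1 : 𝟙 (simpleObj ω a) = 0 := by rw [← e.hom_inv_id, eq_zero_of_ne h e.hom, zero_comp]
  exact one_ne_zero (α := R) (LinearMap.congr_fun (congrArg toLin h1) (1 : R))

/-- The product of simple objects of degrees `a` and `b` is simple of degree `a * b`. -/
def simpleTensorIso (ω : AbelianCocycle G Rˣ) (a b : G) :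
    simpleObj ω a ⊗ simpleObj ω b ≅ simpleObj ω (a * b) :=
  isoOfLin (M := simpleObj ω a ⊗ simpleObj ω b) (N := simpleObj ω (a * b)) (TensorProduct.lid R R)
    (tensor_mem_of (P := delta (a * b)) _ fun c d x hx y hy => by
      by_cases h : c = a
      · by_cases h' : d = b
        · subst h h'
          exact mem_delta _ _
        · rw [mem_delta_ne h' hy]
          simp
      · rw [mem_delta_ne h hx]
        simp)
    (fun c x hx => by
      by_cases h : c = a * b
      · subst h
        exact tmul_mem (mem_delta a (1 : R)) (mem_delta b (x : R))
      · rw [mem_delta_ne h hx]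
        simp)

theorem exists_iso_biproduct (X : TwistedGraded ω) :
    ∃ (m : ℕ) (a : Fin m → G), Nonempty (X ≅ ⨁ fun i => simpleObj ω (a i)) := by
  classical
  obtain ⟨m, ⟨e⟩⟩ := Finite.exists_equiv_fin X.obj.Index
  let b := X.obj.basis.reindex e
  have hb : ∀ i, b i ∈ X.obj.piece (X.obj.deg (e.symm i)) := fun i => by
    simpa [b] using X.obj.basis_mem (e.symm i)
  let B : Bicone fun i => simpleObj ω (X.obj.deg (e.symm i)) :=
    { pt := X
      π := fun i => ofLin (b.coord i) <| by
        refine le_comap_of_basis (N := delta _) (b.coord i) fun j => ?_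
        by_cases h : j = e.symm i
        · subst h
          exact mem_delta _ _
        · have : b.coord i (X.obj.basis j) = 0 := by
            have hj : X.obj.basis j = b (e j) := by simp [b]
            rw [hj, Module.Basis.coord_apply, Module.Basis.repr_self, Finsupp.single_eq_of_ne]
            rintro rfl
            simp at h
          rw [this]
          exact Submodule.zero_mem _
      ι := fun i => ofLin (LinearMap.toSpanSingleton R _ (b i)) fun a x hx => by
        by_cases h : a = X.obj.deg (e.symm i)
        · subst h
          simpa using Submodule.smul_mem _ x (hb i)
        · rw [mem_delta_ne h hx]
          simp
      ι_π := fun i j => by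
        split_ifs with h
        · subst h
          refine hom_ext (LinearMap.ext fun x => ?_)
          change b.coord i (x • b i) = x
          simp
        · refine hom_ext (LinearMap.ext fun x => ?_)
          change b.coord j (x • b i) = 0
          simp [h] }
  refine ⟨m, _, ⟨biproduct.uniqueUpToIso _ (isBilimitOfTotal B (hom_ext ?_))⟩⟩
  rw [toLin_sum]
  refine LinearMap.ext fun x => ?_
  rw [LinearMap.sum_apply]
  exact b.sum_repr x

end

end TwistedGraded

end Graded

section Main

/-- A group-category over `R`: an `R`-linear additive category with an `R`-bilinear product, and
with specified simple objects such that every object is a finite sum of simple objects, there are no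
nonzero morphisms between simple objects which are not isomorphic, simple objects are invertible
for the product, and the endomorphisms of the unit object are the scalars `R`.  (That the product
is additive and `R`-bilinear is expressed by the classes `MonoidalPreadditive` and
`MonoidalLinear`, which are required in `BraidedGroupCategory`.) -/
structure GroupCategory (R : Type w) [CommRing R] (C : Type u₁) [Category.{v₁} C]
    [Preadditive C] [Linear R C] [HasFiniteBiproducts C] [MonoidalCategory C] where
  simple : ObjectProperty C
  exists_iso_biproduct : ∀ X : C, ∃ (m : ℕ) (s : Fin m → C),
    (∀ i, simple (s i)) ∧ Nonempty (X ≅ ⨁ s)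
  eq_zero : ∀ X Y : C, simple X → simple Y → IsEmpty (X ≅ Y) → ∀ f : X ⟶ Y, f = 0
  invertible : ∀ X : C, simple X → ∃ Y : C, Nonempty (X ⊗ Y ≅ 𝟙_ C)
  end_unit : Function.Bijective fun r : R => r • 𝟙 (𝟙_ C)

/-- A braided group-category over `R` with underlying group `G`.  The function `label` identifies
the group of isomorphism classes of simple objects, under the product, with `G`. -/
structure BraidedGroupCategory (R : Type w) [CommRing R] (G : Type u) [CommGroup G] where
  carrier : Type u₁
  [category : Category.{v₁} carrier]
  [preadditive : Preadditive carrier]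
  [linear : Linear R carrier]
  [hasFiniteBiproducts : HasFiniteBiproducts carrier]
  [monoidal : MonoidalCategory carrier]
  [monoidalPreadditive : MonoidalPreadditive carrier]
  [monoidalLinear : MonoidalLinear R carrier]
  [braided : BraidedCategory carrier]
  toGroupCategory : GroupCategory R carrier
  label : {X : carrier // toGroupCategory.simple X} → G
  label_eq_iff : ∀ X Y : {X : carrier // toGroupCategory.simple X},
    label X = label Y ↔ Nonempty (X.1 ≅ Y.1)
  label_surjective : Function.Surjective label
  label_mul : ∀ X Y Z : {X : carrier // toGroupCategory.simple X},
    Nonempty (Z.1 ≅ MonoidalCategory.tensorObj X.1 Y.1) → label Z = label X * label Y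

attribute [instance] BraidedGroupCategory.category BraidedGroupCategory.preadditive
  BraidedGroupCategory.linear BraidedGroupCategory.hasFiniteBiproducts
  BraidedGroupCategory.monoidal BraidedGroupCategory.monoidalPreadditive
  BraidedGroupCategory.monoidalLinear BraidedGroupCategory.braided

/-- A balance (twist) on a braided category: a natural automorphism `θ` of the identity functor
with `θ_{X ⊗ Y} = (θ_X ⊗ θ_Y) ∘ β_{Y,X} ∘ β_{X,Y}`. -/
structure Balance (C : Type u₁) [Category.{v₁} C] [MonoidalCategory C] [BraidedCategory C] where
  twist : 𝟭 C ≅ 𝟭 C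
  twist_tensor : ∀ X Y : C, twist.hom.app (X ⊗ Y) =
    (β_ X Y).hom ≫ (β_ Y X).hom ≫ (twist.hom.app X ⊗ₘ twist.hom.app Y)

/-- The twist of a dual object is the dual of the twist: whenever `Y` is a dual of `X`, with
coevaluation `η : 𝟙 ⟶ X ⊗ Y`, one has `(θ_X ⊗ 1) ∘ η = (1 ⊗ θ_Y) ∘ η`. -/
def Balance.CompatibleWithDuals {C : Type u₁} [Category.{v₁} C] [MonoidalCategory C]
    [BraidedCategory C] (θ : Balance C) : Prop :=
  ∀ (X Y : C) [ExactPairing X Y],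
    η_ X Y ≫ (θ.twist.hom.app X ▷ Y) = η_ X Y ≫ (X ◁ θ.twist.hom.app Y)

namespace BraidedGroupCategory

variable {R : Type w} [CommRing R] {G : Type u} [CommGroup G]

/-- The simple objects. -/
abbrev Simple (𝒞 : BraidedGroupCategory.{w, u, v₁, u₁} R G) : Type u₁ :=
  {X : 𝒞.carrier // 𝒞.toGroupCategory.simple X}

/-- The category has invariants `d` with respect to the generators `g i`: the braiding of any simple
object of class `g i` with itself is multiplication by `σ_i`, and for `i > j` the double braiding of
simple objects of classes `g i` and `g j` is multiplication by `σ_{i,j}`. -/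
def HasInvariants (𝒞 : BraidedGroupCategory.{w, u, v₁, u₁} R G) {k : ℕ} (g : Fin k → G)
    {n : Fin k → ℕ} (d : BraidingData R n) : Prop :=
  (∀ (i : Fin k) (X : 𝒞.Simple), 𝒞.label X = g i →
    (β_ X.1 X.1).hom = (d.diag i : R) • 𝟙 (X.1 ⊗ X.1)) ∧
  ∀ (i j : Fin k) (h : j < i) (X Y : 𝒞.Simple), 𝒞.label X = g i → 𝒞.label Y = g j →
    (β_ X.1 Y.1).hom ≫ (β_ Y.1 X.1).hom = (d.off i j h : R) • 𝟙 (X.1 ⊗ Y.1)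

/-- Equivalence of braided group-categories with underlying group `G`: an `R`-linear braided
monoidal equivalence which induces the identity on the underlying group `G`. -/
def Equivalent (𝒞 : BraidedGroupCategory.{w, u, v₁, u₁} R G)
    (𝒟 : BraidedGroupCategory.{w, u, v₂, u₂} R G) : Prop :=
  ∃ (F : 𝒞.carrier ⥤ 𝒟.carrier) (_ : F.Braided) (_ : F.Additive),
    F.Linear R ∧ F.IsEquivalence ∧
      ∀ (X : 𝒞.Simple) (Y : 𝒟.Simple), 𝒞.label X = 𝒟.label Y → Nonempty (F.obj X.1 ≅ Y.1)

/-- The braiding is a symmetry. -/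
def IsSymmetric (𝒞 : BraidedGroupCategory.{w, u, v₁, u₁} R G) : Prop :=
  ∀ X Y : 𝒞.carrier, (β_ X Y).hom ≫ (β_ Y X).hom = 𝟙 (X ⊗ Y)

/-- The standard balance: on a simple object `X` the twist is the scalar by which the
braiding of `X` with itself acts. -/
def IsStandard (𝒞 : BraidedGroupCategory.{w, u, v₁, u₁} R G) (θ : Balance 𝒞.carrier) : Prop :=
  ∀ X : 𝒞.Simple, θ.twist.hom.app X.1 ▷ X.1 = (β_ X.1 X.1).hom

/-- `θ'` is obtained by scaling `θ` on the simple objects of class `a` by `χ a`. -/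
def IsScaling (𝒞 : BraidedGroupCategory.{w, u, v₁, u₁} R G) (χ : G →* Rˣ)
    (θ θ' : Balance 𝒞.carrier) : Prop :=
  ∀ X : 𝒞.Simple, θ'.twist.hom.app X.1 = ((χ (𝒞.label X) : Rˣ) : R) • θ.twist.hom.app X.1

end BraidedGroupCategory

noncomputable section

variable {R : Type w} [CommRing R] {G : Type u} [CommGroup G]

/-- The group-category of `G`-graded free modules; its simple objects are those which are
isomorphic to `R` concentrated in a single degree. -/
def twistedGroupCategory (ω : AbelianCocycle G Rˣ) : GroupCategory R (TwistedGraded ω) where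
  simple X := ∃ a, Nonempty (X ≅ TwistedGraded.simpleObj ω a)
  exists_iso_biproduct X := by
    obtain ⟨m, a, h⟩ := TwistedGraded.exists_iso_biproduct X
    exact ⟨m, _, fun i => ⟨a i, ⟨Iso.refl _⟩⟩, h⟩
  eq_zero := by
    rintro X Y ⟨a, ⟨e⟩⟩ ⟨b, ⟨e'⟩⟩ h f
    have hab : a ≠ b := by
      rintro rfl
      exact h.false (e ≪≫ e'.symm)
    have := TwistedGraded.eq_zero_of_ne hab (e.inv ≫ f ≫ e'.hom)
    rw [← cancel_epi e.inv, ← cancel_mono e'.hom, Category.assoc, this]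
    simp
  invertible := by
    rintro X ⟨a, ⟨e⟩⟩
    refine ⟨TwistedGraded.simpleObj ω a⁻¹, ⟨whiskerRightIso e _ ≪≫
      TwistedGraded.simpleTensorIso ω a a⁻¹ ≪≫ eqToIso ?_⟩⟩
    rw [mul_inv_cancel]
    rfl
  end_unit := by
    constructor
    · intro r s h
      have := LinearMap.congr_fun (congrArg TwistedGraded.toLin h) (1 : R)
      change r * 1 = s * 1 at this
      simpa using this
    · intro f
      refine ⟨(TwistedGraded.toLin f : R →ₗ[R] R) 1, ?_⟩
      refine TwistedGraded.hom_ext (LinearMap.ext_ring ?_)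
      change (TwistedGraded.toLin f : R →ₗ[R] R) 1 * 1 = _
      exact mul_one _

theorem twisted_label_unique [Nontrivial R] (ω : AbelianCocycle G Rˣ) {X : TwistedGraded ω}
    {a b : G} (e : X ≅ TwistedGraded.simpleObj ω a) (e' : X ≅ TwistedGraded.simpleObj ω b) :
    a = b :=
  TwistedGraded.eq_of_iso (e.symm ≪≫ e')

/-- The category of `G`-graded free `R`-modules of finite rank with the standard tensor product, and
with the associativity and commutativity isomorphisms twisted by `ω`, as a braided group-category
with underlying group `G`. -/
def twistedGroupRing [Nontrivial R] (ω : AbelianCocycle G Rˣ) :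
    BraidedGroupCategory.{w, u, w, max u (w + 1)} R G where
  carrier := TwistedGraded ω
  toGroupCategory := twistedGroupCategory ω
  label X := X.2.choose
  label_eq_iff X Y := by
    constructor
    · intro h
      exact ⟨X.2.choose_spec.some ≪≫ eqToIso (by rw [h]) ≪≫ Y.2.choose_spec.some.symm⟩
    · rintro ⟨e⟩
      exact twisted_label_unique ω X.2.choose_spec.some (e ≪≫ Y.2.choose_spec.some)
  label_surjective a := by
    let X : {X // (twistedGroupCategory ω).simple X} :=
      ⟨TwistedGraded.simpleObj ω a, a, ⟨Iso.refl _⟩⟩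
    exact ⟨X, twisted_label_unique ω X.2.choose_spec.some (Iso.refl _)⟩
  label_mul X Y Z := by
    rintro ⟨e⟩
    exact twisted_label_unique ω Z.2.choose_spec.some
      (e ≪≫ (X.2.choose_spec.some ⊗ᵢ Y.2.choose_spec.some) ≪≫
        TwistedGraded.simpleTensorIso ω _ _)

end

end Main

end GroupCat

/-! A braided group-category is governed by an abelian 3-cocycle on `G`. Simple objects are
invertible, so their endomorphisms are scalars (`isLine_of_invertible`). Choose a representative
`obj a` of each class and isomorphisms `obj a ⊗ obj b ≅ obj (a * b)`: associator and braiding turn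
into functions with values in `Rˣ`, and the pentagon and the hexagons turn into the identities of an
`AbelianCocycle` (`exists_frame`). Rescaling the chosen isomorphisms changes the cocycle by a
coboundary (`Frame.gauge`). Conversely, every object is a sum of representatives, and morphisms
between representatives are scalars or zero, so two categories with the same cocycle are equivalent
(`equivalent_of_represents`).

It remains to classify abelian cocycles up to coboundary. Following Eilenberg and Mac Lane, the
invariant is the quadratic function `a ↦ ω.comm a a`, whose polar form is the double braiding.
Pulled back to exponent vectors in `ℕ ^ k`, the associativity factor becomes the coboundary of an
explicit `t`, relative to which the commutativity factor is bimultiplicative (`exists_gauge`). For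
one generator `t` comes from the pentagon by induction; a further generator is added by the
interchange of the two middle factors in a fourfold product. Evaluating `t` on reduced exponents,
the carries in the addition produce exactly the standard associativity factor (`exists_isGauge`).
Thus `ω` is cohomologous to the standard cocycle of its data. The order conditions come from
bimultiplicativity of the double braiding and, for odd order, from `comm_pow_pow`.

A natural automorphism of the identity is a function `φ : G → Rˣ`, and it is a balance exactly when
`φ (a * b) = double a b * φ a * φ b`. The function `comm a a` is a solution (`comm_mul_self`), two
solutions differ by a character, and `comm a⁻¹ a⁻¹ = comm a a` gives compatibility with duals. Duals
exist for representatives, hence for direct sums. Symmetry means that the double braiding is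
trivial, which can be tested on generators. -/

namespace GroupCat

open CategoryTheory MonoidalCategory Limits

/-! ### Abelian cocycles: the double braiding, the quadratic function, the middle-four interchange.
-/

section Cocycle

variable {G : Type u} [CommGroup G] {A : Type w} [CommGroup A]

/-- The identity behind the associativity of the middle-four interchange in a braided category, for
an additively written abelian cocycle `(α, c)`. -/
theorem interchange_add {B : Type*} [AddCommGroup B] (α : G → G → G → B) (c : G → G → B)
    (P : ∀ a b c d, α a b c + α a (b * c) d + α b c d = α (a * b) c d + α a b (c * d))
    (F : ∀ x y z, α x y z + c x (y * z) + α y z x = c x y + α y x z + c x z)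
    (V : ∀ x y z, -α x y z + c (x * y) z + -α z x y = c y z + -α x z y + c x z)
    (a b p q x y : G) :
    α (a * b) (p * q) (x * y) +
        (α p q (x * y) + -α q x y + c q x + α x q y + -α p x (q * y)) +
        (α a b ((p * x) * (q * y)) + -α b (p * x) (q * y) + c b (p * x) + α (p * x) b (q * y) +
          -α a (p * x) (b * (q * y))) =
      α a p x + α b q y + (α a b (p * q) + -α b p q + c b p + α p b q + -α a p (b * q)) +
        (α (a * p) (b * q) (x * y) + -α (b * q) x y + c (b * q) x + α x (b * q) y +
          -α (a * p) x ((b * q) * y)) := by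
  have h1 := F b p x
  have h2 := V b q x
  have p1 := P a b (p * q) (x * y)
  have p2 := P a p (b * q) (x * y)
  have p3 := P a p x (b * (q * y))
  have p4 := P p x b (q * y)
  have p5 := P b q x y
  have p6 := P x b q y
  have p7 := P b x q y
  have p8 := P b p q (x * y)
  have p9 := P p b q (x * y)
  have p10 := P b p x (q * y)
  have p11 := P p b x (q * y)
  -- The arguments of `α` and `c` agree only up to reordering in the abelian group `G`. Once they
  -- are in normal form, the claim is a signed sum of the two hexagons and eleven pentagons above.
  simp only [mul_comm, mul_left_comm] at *
  linear_combination (norm := abel) h1 - h2 - p1 + p2 - p3 - p4 - p5 - p6 + p7 + p8 - p9 - p10 + p11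

/-- The failure of the middle-four interchange to be compatible with the braiding, additively. -/
theorem interchange_comm_add {B : Type*} [AddCommGroup B] (α : G → G → G → B) (c : G → G → B)
    (P : ∀ a b c d, α a b c + α a (b * c) d + α b c d = α (a * b) c d + α a b (c * d))
    (F : ∀ x y z, α x y z + c x (y * z) + α y z x = c x y + α y x z + c x z)
    (V : ∀ x y z, -α x y z + c (x * y) z + -α z x y = c y z + -α x z y + c x z)
    (a b p q : G) :
    c (a * b) (p * q) +
        (α p q (a * b) + -α q a b + c q a + α a q b + -α p a (q * b)) =
      c a p + c b q + (c a q + c q a) +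
        (α a b (p * q) + -α b p q + c b p + α p b q + -α a p (b * q)) := by
  have h1 := V a b (p * q)
  have h2 := F b p q
  have h3 := F a p q
  have p1 := P p q a b
  have p2 := P a p q b
  have p3 := P p a q b
  simp only [mul_comm] at *
  linear_combination (norm := abel) h1 + h2 + h3 - p1 - p2 + p3

namespace AbelianCocycle

variable (ω : AbelianCocycle G A)

theorem assoc_one_left (b c : G) : ω.assoc 1 b c = 1 := by
  simpa [ω.assoc_one] using ω.pentagon 1 1 b c

theorem assoc_one_right (b c : G) : ω.assoc b c 1 = 1 := by
  simpa [ω.assoc_one] using ω.pentagon b c 1 1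

theorem comm_one_right (a : G) : ω.comm a 1 = 1 := by
  simpa [ω.assoc_one, ω.assoc_one_left, ω.assoc_one_right] using ω.hexagon_forward a 1 1

theorem comm_one_left (a : G) : ω.comm 1 a = 1 := by
  simpa [ω.assoc_one, ω.assoc_one_left, ω.assoc_one_right] using ω.hexagon_reverse 1 1 a

/-- The scalar of the double braiding. -/
def double (a b : G) : A := ω.comm a b * ω.comm b a

theorem double_comm (a b : G) : ω.double a b = ω.double b a := mul_comm _ _

/-- The forward hexagon at `a, b, c` and the reverse hexagon at `b, c, a` contain the same
associativity factors with opposite signs. -/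
theorem double_mul_right (a b c : G) : ω.double a (b * c) = ω.double a b * ω.double a c := by
  have h1 := congrArg Additive.ofMul (ω.hexagon_forward a b c)
  have h2 := congrArg Additive.ofMul (ω.hexagon_reverse b c a)
  apply Additive.ofMul.injective
  simp only [double, ofMul_mul, ofMul_inv] at *
  linear_combination (norm := abel) h1 + h2

/-- The double braiding as a bimultiplicative map. -/
def doubleHom : G →* G →* A :=
  MonoidHom.mk' (fun a => MonoidHom.mk' (ω.double a) (ω.double_mul_right a)) fun a b => by
    ext c
    change ω.double (a * b) c = ω.double a c * ω.double b c
    rw [ω.double_comm, double_mul_right, ω.double_comm c, ω.double_comm c]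

@[simp] theorem doubleHom_apply (a b : G) : ω.doubleHom a b = ω.double a b := rfl

/-- The diagonal of `comm` is a quadratic function with polar form `double`. This is also the
balance axiom for the scalars of the standard twist. -/
theorem comm_mul_self (a b : G) :
    ω.comm (a * b) (a * b) = ω.double a b * ω.comm a a * ω.comm b b := by
  have h1 := congrArg Additive.ofMul (ω.hexagon_reverse a b (a * b))
  have h2 := congrArg Additive.ofMul (ω.hexagon_forward a a b)
  have h3 := congrArg Additive.ofMul (ω.hexagon_forward b a b)
  have h4 := congrArg Additive.ofMul (ω.pentagon a b a b)
  apply Additive.ofMul.injective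
  rw [mul_comm b a] at h4
  simp only [double, ofMul_mul, ofMul_inv] at *
  linear_combination (norm := abel) h1 + h2 + h3 - h4

/-- Put `b = a⁻¹` in `comm_mul_self`: the left side is 1 and `double a a⁻¹` is the inverse square of
`comm a a`. Needed for compatibility of the standard balance with duals. -/
theorem comm_inv_self (a : G) : ω.comm a⁻¹ a⁻¹ = ω.comm a a := by
  have h := ω.comm_mul_self a a⁻¹
  have h1 : ω.double a a⁻¹ = (ω.double a a)⁻¹ := map_inv (ω.doubleHom a) a
  rw [mul_inv_cancel, ω.comm_one_left, h1, double] at h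
  rw [← mul_one (ω.comm a a), h]
  group

/-- The change of trivialization for `(a b) (a' b') = (a a') (b b')`. -/
def interchange (a b a' b' : G) : A :=
  ω.assoc a b (a' * b') * (ω.assoc b a' b')⁻¹ * ω.comm b a' * ω.assoc a' b b' *
    (ω.assoc a a' (b * b'))⁻¹

/-- Multiplication `G × G → G` is a homomorphism because `G` is abelian. Up to the coboundary of
`interchange`, the pullback of the associativity factor along it is the product of the factors of
the two coordinates. -/
theorem interchange_assoc (a b p q x y : G) :
    ω.assoc (a * b) (p * q) (x * y) * ω.interchange p q x y *
        ω.interchange a b (p * x) (q * y) =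
      ω.assoc a p x * ω.assoc b q y * ω.interchange a b p q *
        ω.interchange (a * p) (b * q) x y :=
  interchange_add (B := Additive A) ω.assoc ω.comm ω.pentagon ω.hexagon_forward ω.hexagon_reverse
    a b p q x y

theorem interchange_one_left (a' b' : G) : ω.interchange 1 1 a' b' = 1 := by
  simp [interchange, ω.assoc_one, ω.assoc_one_left, ω.comm_one_left]

theorem interchange_one_right (a b : G) : ω.interchange a b 1 1 = 1 := by
  simp [interchange, ω.assoc_one, ω.assoc_one_left, ω.assoc_one_right, ω.comm_one_right]

/-- The same comparison for the commutativity factor leaves the extra term `double a q`. These terms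
accumulate to the off-diagonal part of the normal form. -/
theorem interchange_comm (a b p q : G) :
    ω.comm (a * b) (p * q) * ω.interchange p q a b =
      ω.comm a p * ω.comm b q * ω.double a q * ω.interchange a b p q :=
  interchange_comm_add (B := Additive A) ω.assoc ω.comm ω.pentagon ω.hexagon_forward
    ω.hexagon_reverse a b p q

end AbelianCocycle

end Cocycle

/-! ### Trivializing a cocycle on exponent vectors. -/

section Cocycle

variable {G : Type u} [CommGroup G] {A : Type w} [CommGroup A]

namespace AbelianCocycle

variable (ω : AbelianCocycle G A)

/-- The trivialization of `ω` on the powers of `x` which is normalized on `x ^ r * x`. -/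
def powGauge (x : G) (r s : ℕ) : A := ∏ l ∈ Finset.range s, (ω.assoc (x ^ r) (x ^ l) x)⁻¹

@[simp] theorem powGauge_zero (x : G) (r : ℕ) : ω.powGauge x r 0 = 1 := rfl

theorem powGauge_succ (x : G) (r s : ℕ) :
    ω.powGauge x r (s + 1) = ω.powGauge x r s * (ω.assoc (x ^ r) (x ^ s) x)⁻¹ :=
  Finset.prod_range_succ _ _

@[simp] theorem powGauge_one (x : G) (r : ℕ) : ω.powGauge x r 1 = 1 := by
  simp [powGauge, ω.assoc_one]

theorem powGauge_of_pow_eq_one {x : G} {r : ℕ} (h : x ^ r = 1) (s : ℕ) : ω.powGauge x r s = 1 := by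
  simp [powGauge, h, ω.assoc_one_left]

/-- On powers of one element every 3-cocycle is a coboundary, since the free monoid on one generator
has no cohomology in degree 3. Concretely: induction on `u`, with the pentagon at `x ^ r, x ^ s, x ^
u, x`. -/
theorem powGauge_assoc (x : G) (r s u : ℕ) :
    ω.assoc (x ^ r) (x ^ s) (x ^ u) * ω.powGauge x s u * ω.powGauge x r (s + u) =
      ω.powGauge x r s * ω.powGauge x (r + s) u := by
  induction u with
  | zero => simp [ω.assoc_one_right]
  | succ u ih =>
    have h := congrArg Additive.ofMul (ω.pentagon (x ^ r) (x ^ s) (x ^ u) x)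
    replace ih := congrArg Additive.ofMul ih
    rw [← add_assoc, powGauge_succ, powGauge_succ, powGauge_succ]
    rw [← pow_add, ← pow_add, ← pow_succ] at h
    apply Additive.ofMul.injective
    simp only [ofMul_mul, ofMul_inv] at *
    linear_combination (norm := abel) ih - h

/-- The commutativity factor on the powers of `x`, relative to `powGauge`. -/
def powComm (x : G) (r s : ℕ) : A :=
  ω.comm (x ^ r) (x ^ s) * ω.powGauge x s r * (ω.powGauge x r s)⁻¹

/-- By `powGauge_assoc` the associativity factors in the hexagon are coboundaries, and what remains
is additivity in one exponent. -/
theorem powComm_add_right (x : G) (r s u : ℕ) :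
    ω.powComm x r (s + u) = ω.powComm x r s * ω.powComm x r u := by
  have h := congrArg Additive.ofMul (ω.hexagon_forward (x ^ r) (x ^ s) (x ^ u))
  have h1 := congrArg Additive.ofMul (ω.powGauge_assoc x r s u)
  have h2 := congrArg Additive.ofMul (ω.powGauge_assoc x s u r)
  have h3 := congrArg Additive.ofMul (ω.powGauge_assoc x s r u)
  rw [← pow_add] at h
  rw [add_comm u r] at h2
  rw [add_comm s r] at h3
  apply Additive.ofMul.injective
  simp only [powComm, ofMul_mul, ofMul_inv] at *
  linear_combination (norm := abel) h - h1 - h2 + h3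

theorem powComm_add_left (x : G) (r s u : ℕ) :
    ω.powComm x (r + s) u = ω.powComm x r u * ω.powComm x s u := by
  have h := congrArg Additive.ofMul (ω.hexagon_reverse (x ^ r) (x ^ s) (x ^ u))
  have h1 := congrArg Additive.ofMul (ω.powGauge_assoc x r s u)
  have h2 := congrArg Additive.ofMul (ω.powGauge_assoc x u r s)
  have h3 := congrArg Additive.ofMul (ω.powGauge_assoc x r u s)
  rw [← pow_add] at h
  rw [add_comm u r] at h2
  rw [add_comm u s] at h3
  apply Additive.ofMul.injective
  simp only [powComm, ofMul_mul, ofMul_inv] at *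
  linear_combination (norm := abel) h + h1 + h2 - h3

/-- A function of two exponents that is additive in each is determined by its value at `(1, 1)`,
where the gauge is 1. -/
theorem powComm_eq (x : G) (r s : ℕ) : ω.powComm x r s = ω.comm x x ^ (r * s) := by
  have h0 : ∀ s, ω.powComm x 0 s = 1 := fun s => by
    simpa using ω.powComm_add_left x 0 0 s
  have h0' : ω.powComm x 1 0 = 1 := by simpa using ω.powComm_add_right x 1 0 0
  have h1 : ∀ s, ω.powComm x 1 s = ω.comm x x ^ s := fun s => by
    induction s with
    | zero => simpa using h0'
    | succ s ih => rw [powComm_add_right, ih, pow_succ]; simp [powComm]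
  induction r with
  | zero => simp [h0]
  | succ r ih => rw [powComm_add_left, ih, h1, ← pow_add, add_mul, one_mul]

theorem comm_pow_pow (x : G) (r s : ℕ) :
    ω.comm (x ^ r) (x ^ s) * ω.powGauge x s r = ω.comm x x ^ (r * s) * ω.powGauge x r s := by
  rw [← powComm_eq, powComm]
  group

theorem comm_self_pow_two_mul {x : G} {n : ℕ} (h : x ^ n = 1) : ω.comm x x ^ (2 * n) = 1 := by
  have h1 : ω.doubleHom x (x ^ n) = 1 := by rw [h, map_one]
  rw [map_pow, doubleHom_apply, double, ← pow_two, ← pow_mul] at h1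
  exact h1

/-- Since `x ^ n = 1`, `comm_pow_pow` at `(n, n)` gives `comm x x ^ (n * n) = 1`. For odd `n` the
number `n * n` is `n` modulo `2 * n`, and the power `2 * n` is already trivial. -/
theorem comm_self_pow_of_odd {x : G} {n : ℕ} (h : x ^ n = 1) (hn : Odd n) :
    ω.comm x x ^ n = 1 := by
  have h1 := ω.comm_pow_pow x n n
  rw [h, ω.comm_one_left, ω.powGauge_of_pow_eq_one h, mul_one, mul_one] at h1
  have h2 := ω.comm_self_pow_two_mul h
  obtain ⟨m, rfl⟩ := hn
  have h3 : (2 * m + 1) * (2 * m + 1) = 2 * (2 * m + 1) * m + (2 * m + 1) := by ring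
  rw [h3, pow_add, pow_mul, h2, one_pow, one_mul] at h1
  exact h1.symm

theorem double_pow_left {x : G} {n : ℕ} (h : x ^ n = 1) (y : G) : ω.double x y ^ n = 1 := by
  have h1 : ω.doubleHom (x ^ n) y = 1 := by rw [h, map_one, MonoidHom.one_apply]
  rwa [map_pow, MonoidHom.pow_apply, doubleHom_apply] at h1

theorem double_pow_right {y : G} {n : ℕ} (h : y ^ n = 1) (x : G) : ω.double x y ^ n = 1 := by
  rw [double_comm, ω.double_pow_left h]

theorem double_prod_right {k : ℕ} (g : Fin k → G) (r : Fin k → ℕ) (x : G) (m : ℕ) :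
    ω.double (∏ i, g i ^ r i) (x ^ m) = ∏ i, ω.double (g i) x ^ (r i * m) := by
  rw [← doubleHom_apply, map_pow, map_prod, MonoidHom.finsetProd_apply, ← Finset.prod_pow]
  refine Finset.prod_congr rfl fun i _ => ?_
  rw [map_pow, MonoidHom.pow_apply, doubleHom_apply, pow_mul]

/-- On the exponents of a family of elements an abelian cocycle has a trivialization for which
the commutativity factor is bimultiplicative. -/
theorem exists_gauge : ∀ {k : ℕ} (g : Fin k → G), ∃ t : (Fin k → ℕ) → (Fin k → ℕ) → A,
    (∀ r s u, ω.assoc (∏ i, g i ^ r i) (∏ i, g i ^ s i) (∏ i, g i ^ u i) * t s u * t r (s + u) =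
      t r s * t (r + s) u) ∧
    (∀ r s, ω.comm (∏ i, g i ^ r i) (∏ i, g i ^ s i) * t s r =
      (∏ i, ω.comm (g i) (g i) ^ (r i * s i)) *
        (∏ i, ∏ j, if i < j then ω.double (g i) (g j) ^ (r i * s j) else 1) * t r s) ∧
    (∀ r s, (∀ i, g i ^ r i = 1) → t r s = 1) ∧ ∀ r, t r 0 = 1
  | 0, g => ⟨fun _ _ => 1, by simp [ω.assoc_one], by simp [ω.comm_one_left], by simp, by simp⟩
  | k + 1, g => by
    obtain ⟨t, h1, h2, h3, h4⟩ := exists_gauge fun i : Fin k => g i.castSucc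
    obtain ⟨p, hp⟩ : ∃ p : (Fin (k + 1) → ℕ) → G,
      ∀ r, ∏ i : Fin k, g i.castSucc ^ r i.castSucc = p r := ⟨_, fun _ => rfl⟩
    obtain ⟨x, hx⟩ : ∃ x, g (Fin.last k) = x := ⟨_, rfl⟩
    have hp_add : ∀ r s, p (r + s) = p r * p s := fun r s => by
      simp only [← hp, Pi.add_apply, pow_add, Finset.prod_mul_distrib]
    -- Separate the last generator `x` from the product `p r` of the others. The new gauge
    -- multiplies the gauges of the two parts by the interchange that moves `x ^ r` past `p s`.
    refine ⟨fun r s => t (fun i => r i.castSucc) (fun i => s i.castSucc) *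
      ω.interchange (p r) (x ^ r (Fin.last k)) (p s) (x ^ s (Fin.last k)) *
      ω.powGauge x (r (Fin.last k)) (s (Fin.last k)), fun r s u => ?_, fun r s => ?_,
      fun r s hr => ?_, fun r => ?_⟩
    · have e1 := congrArg Additive.ofMul (h1 (fun i => r i.castSucc) (fun i => s i.castSucc)
        fun i => u i.castSucc)
      have e2 := congrArg Additive.ofMul (ω.powGauge_assoc x (r (Fin.last k)) (s (Fin.last k))
        (u (Fin.last k)))
      have e3 := congrArg Additive.ofMul (ω.interchange_assoc (p r) (x ^ r (Fin.last k))
        (p s) (x ^ s (Fin.last k)) (p u) (x ^ u (Fin.last k)))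
      simp only [Fin.prod_univ_castSucc, hp, hx, hp_add, Pi.add_apply, pow_add]
      apply Additive.ofMul.injective
      simp only [ofMul_mul, hp] at *
      change _ + Additive.ofMul (t _ fun i => s i.castSucc + u i.castSucc) =
        _ + Additive.ofMul (t (fun i => r i.castSucc + s i.castSucc) _) at e1
      linear_combination (norm := abel) e1 + e2 + e3
    · have e1 := congrArg Additive.ofMul (h2 (fun i => r i.castSucc) (fun i => s i.castSucc))
      have e2 := congrArg Additive.ofMul (ω.comm_pow_pow x (r (Fin.last k)) (s (Fin.last k)))
      have e3 := congrArg Additive.ofMul (ω.interchange_comm (p r) (x ^ r (Fin.last k))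
        (p s) (x ^ s (Fin.last k)))
      have e4 := ω.double_prod_right (fun i : Fin k => g i.castSucc) (fun i => r i.castSucc) x
        (s (Fin.last k))
      simp only [Fin.prod_univ_castSucc, Fin.castSucc_lt_castSucc_iff, Fin.castSucc_lt_last,
        if_true, Finset.prod_mul_distrib, lt_irrefl, if_false, not_lt_of_ge (Fin.le_last _),
        Finset.prod_const_one, hp, hx, mul_one] at e4 ⊢
      apply Additive.ofMul.injective
      rw [← e4]
      simp only [ofMul_mul, hp] at *
      linear_combination (norm := abel) e1 + e2 + e3
    · have e1 : p r = 1 := by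
        rw [← hp]
        exact Finset.prod_eq_one fun i _ => hr _
      beta_reduce
      rw [h3 _ _ fun i => hr _, e1, ← hx, hr (Fin.last k), ω.interchange_one_left,
        ω.powGauge_of_pow_eq_one (hr _), one_mul, one_mul]
    · have e1 : p 0 = 1 := by
        rw [← hp]
        exact Finset.prod_eq_one fun i _ => pow_zero _
      beta_reduce
      rw [e1, Pi.zero_apply, pow_zero, ω.interchange_one_right, powGauge_zero, mul_one, mul_one]
      exact h4 _

end AbelianCocycle

end Cocycle

/-! ### Cocycles are classified by their data. -/

section Cocycle

variable {G : Type u} [CommGroup G] {A : Type w} [CommGroup A]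

namespace AbelianCocycle

/-- `t` is a normalized change of trivialization which turns `ω` into `ω'`. -/
structure IsGauge (ω ω' : AbelianCocycle G A) (t : G → G → A) : Prop where
  one_left : ∀ a, t 1 a = 1
  one_right : ∀ a, t a 1 = 1
  assoc : ∀ a b c, ω.assoc a b c * t b c * t a (b * c) = ω'.assoc a b c * (t a b * t (a * b) c)
  comm : ∀ a b, ω.comm a b * t b a = ω'.comm a b * t a b

end AbelianCocycle

namespace IsCyclicBasis

variable {k : ℕ} {g : Fin k → G} {n : Fin k → ℕ} (hg : IsCyclicBasis g n)

include hg in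
theorem pow_eq_one (i : Fin k) : g i ^ n i = 1 := by
  rw [← hg.orderOf_eq i, pow_orderOf_eq_one]

/-- The multiple of the orders carried over in the addition of exponents. -/
noncomputable def carry (a b : G) (i : Fin k) : ℕ :=
  if hg.exponent a i + hg.exponent b i < n i then 0 else n i

theorem exponent_add (a b : G) :
    hg.exponent a + hg.exponent b = hg.exponent (a * b) + hg.carry a b := by
  funext i
  have h1 := hg.exponent_lt a i
  have h2 := hg.exponent_lt b i
  rw [Pi.add_apply, Pi.add_apply, hg.exponent_mul, carry]
  split_ifs with h
  · rw [Nat.mod_eq_of_lt h, add_zero]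
  · rw [Nat.mod_eq_sub_mod (by omega), Nat.mod_eq_of_lt (by omega)]
    omega

theorem pow_carry (a b : G) (i : Fin k) : g i ^ hg.carry a b i = 1 := by
  rw [carry]
  split_ifs
  · exact pow_zero _
  · exact hg.pow_eq_one i

end IsCyclicBasis

namespace AbelianCocycle

variable {R : Type w} [CommRing R] {k : ℕ} {g : Fin k → G} {n : Fin k → ℕ}

/-- The cocycle `ω` has the invariants `d` with respect to the generators `g i`. -/
structure HasData (ω : AbelianCocycle G Rˣ) (g : Fin k → G) (d : BraidingData R n) : Prop where
  diag : ∀ i, ω.comm (g i) (g i) = d.diag i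
  off : ∀ i j h, ω.double (g i) (g j) = d.off i j h

/-- An abelian cocycle is determined by its invariants up to a change of trivialization. -/
theorem exists_isGauge (ω : AbelianCocycle G Rˣ) (hg : IsCyclicBasis g n) {d : BraidingData R n}
    (hd : ω.HasData g d) : ∃ t, IsGauge ω (d.cocycle hg) t := by
  obtain ⟨t, h1, h2, h3, h4⟩ := ω.exists_gauge g
  have prod_pow_eq_one : ∀ {κ : Fin k → ℕ}, (∀ i, g i ^ κ i = 1) → ∏ i, g i ^ κ i = 1 := fun h =>
    Finset.prod_eq_one fun i _ => h i
  -- Compare `comm a 1 = 1` with the bimultiplicative normal form. The off-diagonal factors vanish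
  -- because `double` is bimultiplicative and `g j ^ κ j = 1`; the diagonal ones need not.
  have t_right : ∀ r κ : Fin k → ℕ, (∀ i, g i ^ κ i = 1) →
      (∏ i, d.diag i ^ (r i * κ i)) * t r κ = 1 := fun r κ h => by
    have h5 := h2 r κ
    rw [h3 κ r h, prod_pow_eq_one h, ω.comm_one_right, Finset.prod_eq_one (s := Finset.univ)
      (f := fun i => ∏ j, if i < j then ω.double (g i) (g j) ^ (r i * κ j) else 1)] at h5
    · simpa only [hd.diag, mul_one, one_mul] using h5.symm
    · refine fun i _ => Finset.prod_eq_one fun j _ => ?_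
      split_ifs
      · rw [mul_comm, pow_mul, ω.double_pow_right (h j), one_pow]
      · rfl
  -- Shifting the right argument of `t` by exponents of the identity costs a factor, whereas
  -- shifting the left argument costs nothing. This asymmetry is the source of the nontrivial
  -- associativity factor.
  have t_add_right : ∀ r s κ : Fin k → ℕ, (∀ i, g i ^ κ i = 1) →
      (∏ i, d.diag i ^ (r i * κ i)) * t r (s + κ) = t r s := fun r s κ h => by
    have h5 := congrArg Additive.ofMul (h1 r s κ)
    have e1 := congrArg Additive.ofMul (t_right s κ h)
    have e2 := congrArg Additive.ofMul (t_right (r + s) κ h)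
    simp only [Pi.add_apply, add_mul, pow_add, Finset.prod_mul_distrib] at e2
    rw [prod_pow_eq_one h, ω.assoc_one_right, one_mul] at h5
    apply Additive.ofMul.injective
    simp only [ofMul_mul, ofMul_one] at *
    linear_combination (norm := abel) h5 + e2 - e1
  have t_add_left : ∀ r s κ : Fin k → ℕ, (∀ i, g i ^ κ i = 1) → t (r + κ) s = t r s :=
    fun r s κ h => by
      have h5 := h1 κ r s
      rw [prod_pow_eq_one h, ω.assoc_one_left, h3 _ _ h, h3 _ _ h, one_mul, one_mul, mul_one] at h5
      rw [h5, add_comm]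
  -- The gauge on `G` is `t` at the reduced exponents, so it fails to be additive only through
  -- carries.
  refine ⟨fun a b => t (hg.exponent a) (hg.exponent b), fun a => ?_, fun a => ?_,
    fun a b c => ?_, fun a b => ?_⟩
  · refine h3 _ _ fun i => ?_
    rw [hg.exponent_one, Pi.zero_apply]
    exact pow_zero (g i)
  · rw [hg.exponent_one]
    exact h4 _
  · have h5 := h1 (hg.exponent a) (hg.exponent b) (hg.exponent c)
    rw [hg.exponent_add, hg.exponent_add, t_add_left _ _ _ (hg.pow_carry a b),
      ← hg.eq_prod_exponent, ← hg.eq_prod_exponent, ← hg.eq_prod_exponent] at h5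
    rw [← t_add_right (hg.exponent a) _ _ (hg.pow_carry b c), ← h5]
    -- The carry in the coordinate `i` is 0 or `n i`, so the cost of a right shift by `carry b c` is
    -- exactly the standard associativity factor.
    have h6 : (d.cocycle hg).assoc a b c = ∏ i, d.diag i ^ (hg.exponent a i * hg.carry b c i) := by
      change d.assocScalar hg a b c = _
      refine Finset.prod_congr rfl fun i _ => ?_
      rw [IsCyclicBasis.carry]
      split_ifs
      · rw [mul_zero, pow_zero]
      · rw [mul_comm]
    rw [h6]
    ac_rfl
  · have h5 := h2 (hg.exponent a) (hg.exponent b)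
    rw [← hg.eq_prod_exponent, ← hg.eq_prod_exponent] at h5
    rw [h5]
    congr 1
    change _ = d.commScalar hg a b
    simp only [BraidingData.commScalar, hd.diag]
    congr 1
    refine Finset.prod_congr rfl fun i _ => Finset.prod_congr rfl fun j _ => ?_
    split_ifs with h
    · rw [ω.double_comm, hd.off j i h]
    · rfl

/-- The invariants of an abelian cocycle. -/
theorem exists_hasData (ω : AbelianCocycle G Rˣ) (hg : IsCyclicBasis g n) :
    ∃ d : BraidingData R n, ω.HasData g d :=
  ⟨{  diag := fun i => ω.comm (g i) (g i)
      off := fun i j _ => ω.double (g i) (g j)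
      diag_pow := fun i => ω.comm_self_pow_two_mul (hg.pow_eq_one i)
      diag_pow_of_odd := fun i => ω.comm_self_pow_of_odd (hg.pow_eq_one i)
      off_pow_left := fun i _ _ => ω.double_pow_left (hg.pow_eq_one i) _
      off_pow_right := fun _ j _ => ω.double_pow_right (hg.pow_eq_one j) _ },
    fun _ => rfl, fun _ _ _ => rfl⟩

/-- The double braiding is bimultiplicative, so it is trivial as soon as it is trivial on pairs of
generators; on the diagonal it is the square of `comm (g i) (g i)`. -/
theorem double_eq_one_iff (ω : AbelianCocycle G Rˣ) (hg : IsCyclicBasis g n) {d : BraidingData R n}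
    (hd : ω.HasData g d) : (∀ a b, ω.double a b = 1) ↔
      (∀ i, d.diag i ^ 2 = 1) ∧ ∀ i j h, d.off i j h = 1 := by
  constructor
  · intro h
    refine ⟨fun i => ?_, fun i j hij => ?_⟩
    · rw [← hd.diag, pow_two]
      exact h _ _
    · rw [← hd.off, h]
  · rintro ⟨h1, h2⟩ a b
    have h3 : ∀ i j, ω.double (g i) (g j) = 1 := fun i j => by
      rcases lt_trichotomy i j with h | rfl | h
      · rw [double_comm, hd.off j i h, h2]
      · rw [double, hd.diag, ← pow_two, h1]
      · rw [hd.off i j h, h2]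
    have h4 : ∀ i b, ω.doubleHom (g i) b = 1 := fun i b => by
      rw [hg.eq_prod_exponent b, map_prod]
      refine Finset.prod_eq_one fun j _ => ?_
      rw [map_pow, doubleHom_apply, h3, one_pow]
    rw [← doubleHom_apply, hg.eq_prod_exponent a, map_prod, MonoidHom.finsetProd_apply]
    refine Finset.prod_eq_one fun i _ => ?_
    rw [map_pow, MonoidHom.pow_apply, h4, one_pow]

theorem hasData_cocycle (hg : IsCyclicBasis g n) (d : BraidingData R n) :
    (d.cocycle hg).HasData g d := by
  classical
  -- A generator of order 1 is the identity and has exponent 0, not 1; the residue `1 % n i` covers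
  -- both cases.
  have he : ∀ i, hg.exponent (g i) = Pi.single i (1 % n i) := fun i => by
    refine hg.exponent_eq (fun j => ?_) ?_
    · by_cases h : j = i
      · subst h
        rw [Pi.single_eq_same]
        exact Nat.mod_lt _ (hg.pos j)
      · rw [Pi.single_eq_of_ne h]
        exact hg.pos j
    · rw [Finset.prod_eq_single i]
      · rw [Pi.single_eq_same, ← hg.orderOf_eq i, pow_mod_orderOf, pow_one]
      · intro j _ h
        rw [Pi.single_eq_of_ne h, pow_zero]
      · simp
  -- When one of the orders is 1 the exponent is 0, but the order conditions then force the datum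
  -- itself to be 1.
  have key : ∀ {x : Rˣ} {m l : ℕ}, x ^ m = 1 → x ^ l = 1 → x ^ ((1 % m) * (1 % l)) = x :=
    fun {x m l} hm hl => by
      rcases eq_or_ne m 1 with rfl | h
      · rw [← pow_one x, hm]; simp
      · rcases eq_or_ne l 1 with rfl | h'
        · rw [← pow_one x, hl]; simp
        · rw [Nat.one_mod_eq_one.2 h, Nat.one_mod_eq_one.2 h', mul_one, pow_one]
  -- For order 1 the condition `diag_pow_of_odd` is what is needed; the condition with `2 * n i`
  -- alone would still allow a sign.
  have key_diag : ∀ i, d.diag i ^ ((1 % n i) * (1 % n i)) = d.diag i := fun i => by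
    by_cases h : n i = 1
    · exact key (d.diag_pow_of_odd i (by rw [h]; exact odd_one))
        (d.diag_pow_of_odd i (by rw [h]; exact odd_one))
    · rw [Nat.one_mod_eq_one.2 h, mul_one, pow_one]
  have diag_part : ∀ i j, (∏ l, d.diag l ^ (hg.exponent (g i) l * hg.exponent (g j) l)) =
      if i = j then d.diag i else 1 := fun i j => by
    rw [Finset.prod_eq_single i]
    · rw [he, he, Pi.single_eq_same]
      split_ifs with h
      · subst h
        rw [Pi.single_eq_same, key_diag]
      · rw [Pi.single_eq_of_ne h, mul_zero, pow_zero]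
    · intro l _ h
      rw [he, Pi.single_eq_of_ne h, zero_mul, pow_zero]
    · simp
  have off_part : ∀ i j, (∏ l, ∏ m, if h : l < m then
      d.off m l h ^ (hg.exponent (g i) l * hg.exponent (g j) m) else 1) =
        if h : i < j then d.off j i h else 1 := fun i j => by
    rw [Finset.prod_eq_single i, Finset.prod_eq_single j]
    · split_ifs with h
      · rw [he, he, Pi.single_eq_same, Pi.single_eq_same,
          key (d.off_pow_right _ _ _) (d.off_pow_left _ _ _)]
      · rfl
    · intro m _ h
      rw [he j, Pi.single_eq_of_ne h]
      simp
    · simp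
    · intro l _ h
      rw [he i, Pi.single_eq_of_ne h]
      simp
    · simp
  have hcomm : ∀ i j, (d.cocycle hg).comm (g i) (g j) =
      (if i = j then d.diag i else 1) * if h : i < j then d.off j i h else 1 := fun i j => by
    rw [← diag_part, ← off_part]
    rfl
  refine ⟨fun i => ?_, fun i j h => ?_⟩
  · rw [hcomm]
    simp
  · rw [double, hcomm, hcomm, if_neg h.ne', if_neg h.ne, dif_neg h.not_gt, dif_pos h]
    simp

end AbelianCocycle

end Cocycle

/-! ### Objects whose endomorphisms are the scalars. -/

section Line

variable (R : Type w) [CommRing R] {C : Type u₁} [Category.{v₁} C] [Preadditive C] [Linear R C]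

/-- The endomorphisms of `X` are the scalars. -/
def IsLine (X : C) : Prop := Function.Bijective fun r : R => r • 𝟙 X

variable {R}

theorem IsLine.of_iso {X Y : C} (h : IsLine R X) (e : X ≅ Y) : IsLine R Y := by
  have key : ∀ r : R, e.inv ≫ (r • 𝟙 X) ≫ e.hom = r • 𝟙 Y := fun r => by simp
  constructor
  · intro r s hrs
    refine h.1 ?_
    beta_reduce at hrs ⊢
    rw [← key, ← key, cancel_epi, cancel_mono] at hrs
    exact hrs
  · intro f
    obtain ⟨r, hr⟩ := h.2 (e.hom ≫ f ≫ e.inv)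
    refine ⟨r, ?_⟩
    beta_reduce at hr ⊢
    rw [← key, hr]
    simp

theorem IsLine.smul_injective {X Y : C} (h : IsLine R Y) {f : X ⟶ Y} [IsIso f] {r s : R}
    (hrs : r • f = s • f) : r = s := by
  refine h.1 ?_
  have := congrArg (fun x => inv f ≫ x) hrs
  simpa using this

theorem IsLine.units_smul_injective {X Y : C} (h : IsLine R Y) {f : X ⟶ Y} [IsIso f] {r s : Rˣ}
    (hrs : (r : R) • f = (s : R) • f) : r = s :=
  Units.ext (h.smul_injective hrs)

/-- Expressing each isomorphism as a multiple of the other gives two scalars with product 1. This is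
the source of all units extracted below. -/
theorem IsLine.exists_unit_smul {X Y : C} (h : IsLine R Y) (f f' : X ⟶ Y) [IsIso f] [IsIso f'] :
    ∃ r : Rˣ, f' = (r : R) • f := by
  obtain ⟨r, hr⟩ := h.2 (inv f ≫ f')
  obtain ⟨s, hs⟩ := h.2 (inv f' ≫ f)
  beta_reduce at hr hs
  have hr' : f' = r • f := by
    rw [← cancel_epi (inv f), ← hr]
    simp
  have hs' : f = s • f' := by
    rw [← cancel_epi (inv f'), ← hs]
    simp
  have h1 : r * s = 1 := h.smul_injective (f := f') (by rw [mul_smul, ← hs', ← hr', one_smul])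
  exact ⟨⟨r, s, h1, by rw [mul_comm, h1]⟩, hr'⟩

/-- The multiple of an isomorphism by a unit. -/
@[simps]
def unitSMulIso {X Y : C} (r : Rˣ) (e : X ≅ Y) : X ≅ Y where
  hom := (r : R) • e.hom
  inv := ((r⁻¹ : Rˣ) : R) • e.inv
  hom_inv_id := by simp [smul_smul]
  inv_hom_id := by simp [smul_smul]

variable [MonoidalCategory C] [MonoidalPreadditive C] [MonoidalLinear R C] [BraidedCategory C]

/-- Tensoring once more with the inverse object undoes the tensoring with `Y`. The braiding provides
the isomorphism `Y ⊗ X ≅ 𝟙_ C` from the given one. -/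
theorem eq_zero_of_whiskerRight {X Y : C} (e : X ⊗ Y ≅ 𝟙_ C) {Z Z' : C} (f : Z ⟶ Z')
    (h : f ▷ Y = 0) : f = 0 := by
  have e' : Y ⊗ X ≅ 𝟙_ C := β_ Y X ≪≫ e
  have h1 : f ▷ (Y ⊗ X) = 0 := by
    rw [whiskerRight_tensor, h]
    simp
  have h2 : f ▷ 𝟙_ C = 0 := by
    rw [← cancel_epi (Z ◁ e'.hom), whisker_exchange, h1]
    simp
  rw [whiskerRight_id] at h2
  simpa using h2

/-- Endomorphisms of `X ⊗ Y ≅ 𝟙_ C` are scalars, and tensoring with `Y` is faithful. -/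
theorem isLine_of_invertible (h1 : IsLine R (𝟙_ C)) {X Y : C} (e : X ⊗ Y ≅ 𝟙_ C) :
    IsLine R X := by
  have h : IsLine R (X ⊗ Y) := h1.of_iso e.symm
  constructor
  · intro r s hrs
    refine h.1 ?_
    have := congrArg (fun f => f ▷ Y) hrs
    simpa using this
  · intro f
    obtain ⟨r, hr⟩ := h.2 (f ▷ Y)
    refine ⟨r, sub_eq_zero.1 (eq_zero_of_whiskerRight e _ ?_)⟩
    have : (r • 𝟙 X) ▷ Y = (r • 𝟙 X - f) ▷ Y + f ▷ Y := by
      rw [← MonoidalPreadditive.add_whiskerRight, sub_add_cancel]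
    rw [MonoidalLinear.smul_whiskerRight, id_whiskerRight] at this
    beta_reduce at hr
    rw [hr] at this
    simpa using this

/-- The product of invertible objects is invertible. -/
def tensorInvertible {X X' Y Y' : C} (e : X ⊗ X' ≅ 𝟙_ C) (e' : Y ⊗ Y' ≅ 𝟙_ C) :
    (X ⊗ Y) ⊗ (X' ⊗ Y') ≅ 𝟙_ C :=
  { hom := tensorμ X Y X' Y'
    inv := tensorδ X Y X' Y' } ≪≫ (e ⊗ᵢ e') ≪≫ λ_ _

end Line

/-! ### Skeletons and frames: reading off the cocycle from chosen isomorphisms. -/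

/-- Representatives `obj a` of a group of isomorphism classes of invertible objects, together with
normalized isomorphisms `obj a ⊗ obj b ≅ obj (a * b)`. -/
structure Skeleton (R : Type w) [CommRing R] (G : Type u) [CommGroup G] (C : Type u₁)
    [Category.{v₁} C] [Preadditive C] [Linear R C] [MonoidalCategory C] where
  obj : G → C
  isLine : ∀ a, IsLine R (obj a)
  unit : 𝟙_ C ≅ obj 1
  -- The target is any `c` with a proof of `a * b = c`, so that differently bracketed products share
  -- one target without transport.
  mul : ∀ {a b c : G}, a * b = c → (obj a ⊗ obj b ≅ obj c)
  left_unit : ∀ {a : G} (h : 1 * a = a), unit.hom ▷ obj a ≫ (mul h).hom = (λ_ _).hom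
  right_unit : ∀ {a : G} (h : a * 1 = a), obj a ◁ unit.hom ≫ (mul h).hom = (ρ_ _).hom

namespace Skeleton

variable {R : Type w} [CommRing R] {G : Type u} [CommGroup G] {C : Type u₁}
    [Category.{v₁} C] [Preadditive C] [Linear R C] [MonoidalCategory C] (S : Skeleton R G C)

/-- The associativity factor of the chosen isomorphisms is `α a b c`. -/
def HasAssoc (α : G → G → G → Rˣ) : Prop :=
  ∀ {a b c d e f : G} (h₁ : b * c = d) (h₂ : a * d = f) (h₃ : a * b = e) (h₄ : e * c = f),
    (α_ (S.obj a) (S.obj b) (S.obj c)).hom ≫ S.obj a ◁ (S.mul h₁).hom ≫ (S.mul h₂).hom =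
      (α a b c : R) • ((S.mul h₃).hom ▷ S.obj c ≫ (S.mul h₄).hom)

/-- The commutativity factor of the chosen isomorphisms is `γ a b`. -/
def HasComm [BraidedCategory C] (γ : G → G → Rˣ) : Prop :=
  ∀ {a b c : G} (h₁ : b * a = c) (h₂ : a * b = c),
    (β_ (S.obj a) (S.obj b)).hom ≫ (S.mul h₁).hom = (γ a b : R) • (S.mul h₂).hom

theorem exists_hasAssoc : ∃ α : G → G → G → Rˣ, S.HasAssoc α := by
  have key : ∀ a b c : G, ∃ r : Rˣ, ∀ {d e f : G} (h₁ : b * c = d) (h₂ : a * d = f)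
      (h₃ : a * b = e) (h₄ : e * c = f),
      (α_ (S.obj a) (S.obj b) (S.obj c)).hom ≫ S.obj a ◁ (S.mul h₁).hom ≫ (S.mul h₂).hom =
        (r : R) • ((S.mul h₃).hom ▷ S.obj c ≫ (S.mul h₄).hom) := by
    intro a b c
    obtain ⟨r, hr⟩ := (S.isLine (a * (b * c))).exists_unit_smul
      ((S.mul rfl).hom ▷ S.obj c ≫ (S.mul (mul_assoc a b c)).hom)
      ((α_ (S.obj a) (S.obj b) (S.obj c)).hom ≫ S.obj a ◁ (S.mul rfl).hom ≫ (S.mul rfl).hom)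
    refine ⟨r, fun h₁ h₂ h₃ h₄ => ?_⟩
    subst h₁ h₂ h₃
    exact hr
  choose α hα using key
  exact ⟨α, fun h₁ h₂ h₃ h₄ => hα _ _ _ h₁ h₂ h₃ h₄⟩

theorem exists_hasComm [BraidedCategory C] : ∃ γ : G → G → Rˣ, S.HasComm γ := by
  have key : ∀ a b : G, ∃ r : Rˣ, ∀ {c : G} (h₁ : b * a = c) (h₂ : a * b = c),
      (β_ (S.obj a) (S.obj b)).hom ≫ (S.mul h₁).hom = (r : R) • (S.mul h₂).hom := by
    intro a b
    obtain ⟨r, hr⟩ := (S.isLine (a * b)).exists_unit_smul (S.mul rfl).hom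
      ((β_ (S.obj a) (S.obj b)).hom ≫ (S.mul (mul_comm b a)).hom)
    refine ⟨r, fun h₁ h₂ => ?_⟩
    subst h₂
    exact hr
  choose γ hγ using key
  exact ⟨γ, fun h₁ h₂ => hγ _ _ h₁ h₂⟩

variable {S} {α : G → G → G → Rˣ}

theorem HasAssoc.inv (hα : S.HasAssoc α) {a b c d e f : G} (h₁ : b * c = d) (h₂ : a * d = f)
    (h₃ : a * b = e) (h₄ : e * c = f) :
    (α_ (S.obj a) (S.obj b) (S.obj c)).inv ≫ (S.mul h₃).hom ▷ S.obj c ≫ (S.mul h₄).hom =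
      (((α a b c)⁻¹ : Rˣ) : R) • (S.obj a ◁ (S.mul h₁).hom ≫ (S.mul h₂).hom) := by
  rw [Iso.inv_comp_eq, Linear.comp_smul, hα h₁ h₂ h₃ h₄, smul_smul]
  simp

/-- The triangle identity, combined with the unit normalization of the chosen isomorphisms, makes
this factor trivial. -/
theorem HasAssoc.one (hα : S.HasAssoc α) (a b : G) : α a 1 b = 1 := by
  have h := congrArg (fun f => (S.obj a ◁ S.unit.hom) ▷ S.obj b ≫ f)
    (hα (one_mul b) (rfl : a * b = _) (mul_one a) rfl)
  beta_reduce at h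
  rw [associator_naturality_middle_assoc, ← whiskerLeft_comp_assoc, S.left_unit,
    Linear.comp_smul, ← comp_whiskerRight_assoc, S.right_unit, triangle_assoc] at h
  refine ((S.isLine (a * b)).units_smul_injective
    (f := (ρ_ (S.obj a)).hom ▷ S.obj b ≫ (S.mul rfl).hom) ?_).symm
  rw [← h, Units.val_one, one_smul]

variable [MonoidalPreadditive C] [MonoidalLinear R C]

/-- Compose the pentagon of the category with the chosen isomorphisms into one representative. Each
associator is absorbed at the price of one factor, and the total factors agree because the target is
a line. -/
theorem HasAssoc.pentagon (hα : S.HasAssoc α) (a b c d : G) :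
    α a b c * α a (b * c) d * α b c d = α (a * b) c d * α a b (c * d) := by
  have h := congrArg (fun f => f ≫ S.obj a ◁ S.obj b ◁ (S.mul (rfl : c * d = _)).hom ≫
    S.obj a ◁ (S.mul (rfl : b * (c * d) = _)).hom ≫ (S.mul (rfl : a * (b * (c * d)) = _)).hom)
    (MonoidalCategory.pentagon (S.obj a) (S.obj b) (S.obj c) (S.obj d))
  have e1 : a * (b * c * d) = a * (b * (c * d)) := by rw [mul_assoc b]
  have e2 : a * (b * c) * d = a * (b * (c * d)) := by rw [mul_assoc, mul_assoc b]
  have e3 : a * b * (c * d) = a * (b * (c * d)) := mul_assoc _ _ _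
  simp only [Category.assoc] at h
  rw [← whiskerLeft_comp_assoc, ← whiskerLeft_comp_assoc, Category.assoc,
    hα rfl rfl rfl (mul_assoc b c d), MonoidalLinear.whiskerLeft_smul, Linear.smul_comp,
    Linear.comp_smul, Linear.comp_smul, whiskerLeft_comp, Category.assoc,
    ← associator_naturality_middle_assoc, hα (mul_assoc b c d) rfl rfl e2, Linear.comp_smul,
    Linear.comp_smul, ← comp_whiskerRight_assoc, ← comp_whiskerRight_assoc, Category.assoc,
    hα rfl rfl rfl (mul_assoc a b c), MonoidalLinear.smul_whiskerRight, Linear.smul_comp,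
    ← associator_naturality_right_assoc, hα rfl rfl rfl e3, Linear.comp_smul, Linear.comp_smul,
    whisker_exchange_assoc, ← associator_naturality_left_assoc,
    hα rfl e3 (mul_assoc a b c) e2, Linear.comp_smul, comp_whiskerRight, Category.assoc,
    smul_smul, smul_smul, smul_smul] at h
  refine (S.isLine _).units_smul_injective (f := (S.mul (rfl : a * b = _)).hom ▷ S.obj c ▷ S.obj d ≫
    (S.mul (mul_assoc a b c)).hom ▷ S.obj d ≫ (S.mul e2).hom) ?_
  push_cast
  rw [show (α a b c * α a (b * c) d * α b c d : R) = α b c d * α a (b * c) d * α a b c by ring,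
    mul_comm (α (a * b) c d : R)]
  exact h

variable [BraidedCategory C] {γ : G → G → Rˣ}

/-- The same evaluation as for the pentagon, with braidings absorbed by `HasComm`. -/
theorem HasComm.hexagon_forward (hγ : S.HasComm γ) (hα : S.HasAssoc α) (a b c : G) :
    α a b c * γ a (b * c) * α b c a = γ a b * α b a c * γ a c := by
  have e1 : b * c * a = a * (b * c) := mul_comm _ _
  have e2 : b * (c * a) = a * (b * c) := by rw [← mul_assoc, e1]
  have e3 : b * a * c = a * (b * c) := by rw [mul_comm b, mul_assoc]
  have h := congrArg (fun f => f ≫ S.obj b ◁ (S.mul (rfl : c * a = _)).hom ≫ (S.mul e2).hom)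
    (BraidedCategory.hexagon_forward (S.obj a) (S.obj b) (S.obj c))
  simp only [Category.assoc] at h
  rw [hα rfl e2 rfl e1, Linear.comp_smul, Linear.comp_smul,
    ← BraidedCategory.braiding_naturality_right_assoc, hγ e1 rfl, Linear.comp_smul,
    Linear.comp_smul, hα rfl rfl (mul_comm a b) e3, ← whiskerLeft_comp_assoc,
    hγ rfl (mul_comm a c), MonoidalLinear.whiskerLeft_smul, Linear.smul_comp, Linear.comp_smul,
    Linear.comp_smul, hα (mul_comm a c) e2 rfl e3, Linear.comp_smul, ← comp_whiskerRight_assoc,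
    hγ rfl (mul_comm a b), MonoidalLinear.smul_whiskerRight, Linear.smul_comp,
    smul_smul, smul_smul, smul_smul, smul_smul] at h
  refine (S.isLine _).units_smul_injective
    (f := (S.mul (mul_comm a b)).hom ▷ S.obj c ≫ (S.mul e3).hom) ?_
  push_cast
  convert h using 2 <;> ring

theorem HasComm.hexagon_reverse (hγ : S.HasComm γ) (hα : S.HasAssoc α) (a b c : G) :
    (α a b c)⁻¹ * γ (a * b) c * (α c a b)⁻¹ = γ b c * (α a c b)⁻¹ * γ a c := by
  have e1 : c * (a * b) = a * (b * c) := by rw [mul_comm, mul_assoc]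
  have e2 : c * a * b = a * (b * c) := by rw [mul_assoc, e1]
  have e3 : a * (c * b) = a * (b * c) := by rw [mul_comm c]
  have h := congrArg (fun f => f ≫ (S.mul (rfl : c * a = _)).hom ▷ S.obj b ≫ (S.mul e2).hom)
    (BraidedCategory.hexagon_reverse (S.obj a) (S.obj b) (S.obj c))
  simp only [Category.assoc] at h
  rw [hα.inv rfl e1 rfl e2, Linear.comp_smul, Linear.comp_smul,
    ← BraidedCategory.braiding_naturality_left_assoc, hγ e1 (mul_assoc a b c), Linear.comp_smul,
    Linear.comp_smul, hα.inv (mul_comm b c) e3 rfl (mul_assoc a b c), ← comp_whiskerRight_assoc,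
    hγ rfl (mul_comm a c), MonoidalLinear.smul_whiskerRight, Linear.smul_comp, Linear.comp_smul,
    Linear.comp_smul, hα.inv rfl e3 (mul_comm a c) e2, Linear.comp_smul, ← whiskerLeft_comp_assoc,
    hγ rfl (mul_comm b c), MonoidalLinear.whiskerLeft_smul, Linear.smul_comp,
    smul_smul, smul_smul, smul_smul, smul_smul] at h
  refine (S.isLine _).units_smul_injective
    (f := S.obj a ◁ (S.mul (mul_comm b c)).hom ≫ (S.mul e3).hom) ?_
  push_cast
  convert h using 2 <;> ring

end Skeleton

/-- A skeleton with associativity and commutativity factors `ω`, such that every object is a finite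
direct sum of the objects of the skeleton, and such that there are no nonzero morphisms between
different objects of the skeleton. -/
structure Frame (R : Type w) [CommRing R] {G : Type u} [CommGroup G] (C : Type u₁)
    [Category.{v₁} C] [Preadditive C] [Linear R C] [MonoidalCategory C] [BraidedCategory C]
    (ω : AbelianCocycle G Rˣ) extends Skeleton R G C where
  eq_zero : ∀ {a b : G}, a ≠ b → ∀ f : obj a ⟶ obj b, f = 0
  exists_decomposition : ∀ X : C, ∃ (m : ℕ) (deg : Fin m → G) (ι : ∀ i, obj (deg i) ⟶ X)
    (π : ∀ i, X ⟶ obj (deg i)), (∀ i, ι i ≫ π i = 𝟙 _) ∧ (∀ i j, i ≠ j → ι i ≫ π j = 0) ∧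
      ∑ i, π i ≫ ι i = 𝟙 X
  hasAssoc : toSkeleton.HasAssoc ω.assoc
  hasComm : toSkeleton.HasComm ω.comm

section

variable {R : Type w} [CommRing R] {G : Type u} [CommGroup G] {C : Type u₁}
    [Category.{v₁} C] [Preadditive C] [Linear R C] [MonoidalCategory C]

/-- Only the isomorphisms with a factor of degree 1 have to be prescribed, by the unitors; all
others are arbitrary. -/
theorem exists_skeleton (S : G → C) (hS : ∀ a, IsLine R (S a)) (u : 𝟙_ C ≅ S 1)
    (hmul : ∀ a b, Nonempty (S a ⊗ S b ≅ S (a * b))) :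
    ∃ T : Skeleton R G C, T.obj = S := by
  have key : ∀ a b, ∃ m : S a ⊗ S b ≅ S (a * b),
      (∀ (h : 1 = a) (h' : a * b = b), (u.hom ≫ eqToHom (congrArg S h)) ▷ S b ≫ m.hom ≫
        eqToHom (congrArg S h') = (λ_ _).hom) ∧
      ∀ (h : 1 = b) (h' : a * b = a), S a ◁ (u.hom ≫ eqToHom (congrArg S h)) ≫ m.hom ≫
        eqToHom (congrArg S h') = (ρ_ _).hom := by
    intro a b
    by_cases ha : 1 = a
    · subst ha
      refine ⟨whiskerRightIso u.symm (S b) ≪≫ λ_ _ ≪≫ eqToIso (congrArg S (one_mul b).symm),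
        fun _ _ => ?_, fun hb _ => ?_⟩
      · simp [← comp_whiskerRight_assoc]
      · subst hb
        -- In degree `(1, 1)` both unit conditions apply to one isomorphism. They are consistent
        -- because the two unitors of the unit object coincide.
        have h1 : S 1 ◁ u.hom ≫ u.inv ▷ S 1 ≫ (λ_ (S 1)).hom = (ρ_ (S 1)).hom := by
          rw [whisker_exchange_assoc, leftUnitor_naturality, unitors_equal,
            rightUnitor_naturality_assoc, u.inv_hom_id, Category.comp_id]
        simpa using h1
    · by_cases hb : 1 = b
      · subst hb
        refine ⟨whiskerLeftIso (S a) u.symm ≪≫ ρ_ _ ≪≫ eqToIso (congrArg S (mul_one a).symm),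
          fun h => absurd h ha, fun _ _ => ?_⟩
        simp [← whiskerLeft_comp_assoc]
      · exact ⟨(hmul a b).some, fun h => absurd h ha, fun h => absurd h hb⟩
  choose m hm hm' using key
  exact ⟨{
    obj := S
    isLine := hS
    unit := u
    mul := fun {a b c} h => m a b ≪≫ eqToIso (congrArg S h)
    left_unit := fun h => by simpa using hm _ _ rfl h
    right_unit := fun h => by simpa using hm' _ _ rfl h }, rfl⟩

/-- Changing the isomorphisms of a skeleton by a normalized function. -/
def Skeleton.gauge (S : Skeleton R G C) (t : G → G → Rˣ) (h1 : ∀ a, t 1 a = 1)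
    (h2 : ∀ a, t a 1 = 1) : Skeleton R G C where
  obj := S.obj
  isLine := S.isLine
  unit := S.unit
  mul {a b _} h := unitSMulIso (t a b) (S.mul h)
  left_unit h := by simp [h1, S.left_unit]
  right_unit h := by simp [h2, S.right_unit]

variable [MonoidalPreadditive C] [MonoidalLinear R C] [BraidedCategory C]

/-- A change of trivialization of the cocycle changes a frame. -/
def Frame.gauge {ω ω' : AbelianCocycle G Rˣ} (F : Frame R C ω) {t : G → G → Rˣ}
    (ht : ω.IsGauge ω' t) : Frame R C ω' where
  toSkeleton := F.toSkeleton.gauge t ht.one_left ht.one_right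
  eq_zero := F.eq_zero
  exists_decomposition := F.exists_decomposition
  hasAssoc {a b c d e f} h₁ h₂ h₃ h₄ := by
    subst h₁ h₃
    have h := congrArg Units.val (ht.assoc a b c)
    push_cast at h
    change (α_ (F.obj a) (F.obj b) (F.obj c)).hom ≫
      F.obj a ◁ ((t b c : R) • (F.mul rfl).hom) ≫ ((t a (b * c) : R) • (F.mul h₂).hom) =
        (ω'.assoc a b c : R) • (((t a b : R) • (F.mul rfl).hom) ▷ F.obj c ≫
          ((t (a * b) c : R) • (F.mul h₄).hom))
    simp only [MonoidalLinear.whiskerLeft_smul, MonoidalLinear.smul_whiskerRight, Linear.comp_smul,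
      Linear.smul_comp, smul_smul]
    rw [F.hasAssoc rfl h₂ rfl h₄, smul_smul, mul_comm (t (a * b) c : R), ← h]
    congr 1
    ring
  hasComm {a b c} h₁ h₂ := by
    have h := congrArg Units.val (ht.comm a b)
    push_cast at h
    change (β_ (F.obj a) (F.obj b)).hom ≫ ((t b a : R) • (F.mul h₁).hom) =
      (ω'.comm a b : R) • ((t a b : R) • (F.mul h₂).hom)
    simp only [Linear.comp_smul, smul_smul]
    rw [F.hasComm h₁ h₂, smul_smul, ← h, mul_comm]

end

/-! ### Every braided group-category has a frame, which determines its invariants. -/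

namespace BraidedGroupCategory

variable {R : Type w} [CommRing R] {G : Type u} [CommGroup G]
  (𝒞 : BraidedGroupCategory.{w, u, v₁, u₁} R G)

theorem isLine_unit : IsLine R (𝟙_ 𝒞.carrier) := 𝒞.toGroupCategory.end_unit

variable {𝒞}

theorem isLine (X : 𝒞.Simple) : IsLine R X.1 :=
  isLine_of_invertible 𝒞.isLine_unit (𝒞.toGroupCategory.invertible X.1 X.2).choose_spec.some

/-- The projection to one simple summand is an idempotent of a line, hence a scalar; restricted to
that summand it is 1, so it is the identity. An empty sum is excluded because `1 ≠ 0` in `R`. -/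
theorem exists_iso_simple [Nontrivial R] {X : 𝒞.carrier} (hX : IsLine R X) :
    ∃ Y : 𝒞.Simple, Nonempty (X ≅ Y.1) := by
  obtain ⟨m, s, hs, ⟨e⟩⟩ := 𝒞.toGroupCategory.exists_iso_biproduct X
  have h : IsLine R (⨁ s) := hX.of_iso e
  rcases Nat.eq_zero_or_pos m with rfl | hm
  · have h0 : 𝟙 (⨁ s) = 0 := by
      rw [← biproduct.total]
      simp
    exact absurd (h.1 (a₁ := 1) (a₂ := 0) (by simp [h0])) one_ne_zero
  · let i : Fin m := ⟨0, hm⟩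
    obtain ⟨r, hr⟩ := h.2 (biproduct.π s i ≫ biproduct.ι s i)
    beta_reduce at hr
    have h1 : r • 𝟙 (s i) = (1 : R) • 𝟙 (s i) := by
      have := congrArg (fun f => biproduct.ι s i ≫ f ≫ biproduct.π s i) hr
      simpa using this
    have h2 : r = 1 := (isLine ⟨s i, hs i⟩).1 h1
    rw [h2, one_smul] at hr
    exact ⟨⟨s i, hs i⟩, ⟨e ≪≫ ⟨biproduct.π s i, biproduct.ι s i, hr.symm, biproduct.ι_π_self s i⟩⟩⟩

/-- The frame `F` represents the isomorphism classes of simple objects as labelled in `𝒞`. -/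
def Represents {ω : AbelianCocycle G Rˣ} (F : Frame R 𝒞.carrier ω) : Prop :=
  ∀ X : 𝒞.Simple, Nonempty (X.1 ≅ F.obj (𝒞.label X))

variable (𝒞) in
/-- Every braided group-category has a frame. -/
theorem exists_frame [Nontrivial R] :
    ∃ (ω : AbelianCocycle G Rˣ) (F : Frame R 𝒞.carrier ω), Represents F := by
  choose S hS using 𝒞.label_surjective
  have iso_S : ∀ X : 𝒞.Simple, Nonempty (X.1 ≅ (S (𝒞.label X)).1) := fun X =>
    (𝒞.label_eq_iff _ _).1 (hS _).symm
  obtain ⟨z, ⟨ez⟩⟩ := exists_iso_simple 𝒞.isLine_unit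
  -- The unit is isomorphic to its own square, so its label is idempotent in a group.
  have hz : 𝒞.label z = 1 := by
    have := 𝒞.label_mul z z z ⟨ez.symm ≪≫ (λ_ _).symm ≪≫ (ez ⊗ᵢ ez)⟩
    simpa using this
  -- The product of two simple objects is invertible, hence a line, hence isomorphic to a simple
  -- object, to which `label_mul` applies.
  have hmul : ∀ a b, Nonempty ((S a).1 ⊗ (S b).1 ≅ (S (a * b)).1) := fun a b => by
    obtain ⟨Y, hY⟩ := 𝒞.toGroupCategory.invertible (S a).1 (S a).2
    obtain ⟨Y', hY'⟩ := 𝒞.toGroupCategory.invertible (S b).1 (S b).2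
    obtain ⟨x, ⟨ex⟩⟩ := exists_iso_simple
      (isLine_of_invertible 𝒞.isLine_unit (tensorInvertible hY.some hY'.some))
    have hx := 𝒞.label_mul (S a) (S b) x ⟨ex.symm⟩
    rw [hS, hS] at hx
    obtain ⟨e⟩ := iso_S x
    exact ⟨ex ≪≫ e ≪≫ eqToIso (by rw [hx])⟩
  obtain ⟨T, hT⟩ := exists_skeleton (fun a => (S a).1) (fun a => isLine (S a))
    (ez ≪≫ (iso_S z).some ≪≫ eqToIso (by rw [hz])) hmul
  obtain ⟨α, hα⟩ := T.exists_hasAssoc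
  obtain ⟨γ, hγ⟩ := T.exists_hasComm
  let F : Frame R 𝒞.carrier ⟨α, γ, hα.one, hα.pentagon, hγ.hexagon_forward hα,
      hγ.hexagon_reverse hα⟩ :=
    { toSkeleton := T
      hasAssoc := hα
      hasComm := hγ
      eq_zero := by
        rw [hT]
        intro a b hab f
        refine 𝒞.toGroupCategory.eq_zero _ _ (S a).2 (S b).2 ⟨fun e => hab ?_⟩ f
        rw [← hS a, ← hS b]
        exact (𝒞.label_eq_iff _ _).2 ⟨e⟩
      exists_decomposition := by
        rw [hT]
        intro X
        obtain ⟨m, s, hs, ⟨e⟩⟩ := 𝒞.toGroupCategory.exists_iso_biproduct X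
        let f := fun i => (iso_S ⟨s i, hs i⟩).some
        refine ⟨m, fun i => 𝒞.label ⟨s i, hs i⟩, fun i => (f i).inv ≫ biproduct.ι s i ≫ e.inv,
          fun i => e.hom ≫ biproduct.π s i ≫ (f i).hom, fun i => by simp, fun i j h => ?_, ?_⟩
        · simp [biproduct.ι_π_ne_assoc s h]
        · have h1 : e.hom ≫ (∑ i, biproduct.π s i ≫ biproduct.ι s i) ≫ e.inv = 𝟙 X := by
            rw [biproduct.total]
            simp
          rw [Preadditive.sum_comp, Preadditive.comp_sum] at h1
          simpa using h1 }
  refine ⟨_, F, fun X => ?_⟩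
  change Nonempty (X.1 ≅ T.obj (𝒞.label X))
  rw [hT]
  exact iso_S X

theorem braiding_self_of_iso {C : Type u₁} [Category.{v₁} C] [Preadditive C] [Linear R C]
    [MonoidalCategory C] [BraidedCategory C] {X Y : C} (e : X ≅ Y) {r : R}
    (h : (β_ Y Y).hom = r • 𝟙 (Y ⊗ Y)) : (β_ X X).hom = r • 𝟙 (X ⊗ X) := by
  rw [← cancel_mono (e.hom ⊗ₘ e.hom), ← BraidedCategory.braiding_naturality, h]
  simp

theorem double_braiding_of_iso {C : Type u₁} [Category.{v₁} C] [Preadditive C] [Linear R C]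
    [MonoidalCategory C] [BraidedCategory C] {X Y X' Y' : C} (e : X ≅ Y) (e' : X' ≅ Y') {r : R}
    (h : (β_ Y Y').hom ≫ (β_ Y' Y).hom = r • 𝟙 (Y ⊗ Y')) :
    (β_ X X').hom ≫ (β_ X' X).hom = r • 𝟙 (X ⊗ X') := by
  rw [← cancel_mono (e.hom ⊗ₘ e'.hom), Category.assoc, ← BraidedCategory.braiding_naturality,
    ← BraidedCategory.braiding_naturality_assoc, h]
  simp

end BraidedGroupCategory

namespace Frame

variable {R : Type w} [CommRing R] {G : Type u} [CommGroup G] {C : Type u₁}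
    [Category.{v₁} C] [Preadditive C] [Linear R C] [MonoidalCategory C] [BraidedCategory C]
    {ω : AbelianCocycle G Rˣ} (F : Frame R C ω)

theorem braiding_self (a : G) :
    (β_ (F.obj a) (F.obj a)).hom = (ω.comm a a : R) • 𝟙 (F.obj a ⊗ F.obj a) := by
  rw [← cancel_mono (F.mul rfl).hom, F.hasComm rfl rfl]
  simp

theorem double_braiding (a b : G) : (β_ (F.obj a) (F.obj b)).hom ≫ (β_ (F.obj b) (F.obj a)).hom =
    (ω.double a b : R) • 𝟙 (F.obj a ⊗ F.obj b) := by
  rw [← cancel_mono (F.mul rfl).hom, Category.assoc, F.hasComm rfl (mul_comm b a),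
    Linear.comp_smul, F.hasComm (mul_comm b a) rfl]
  simp [smul_smul, AbelianCocycle.double, mul_comm]

theorem isLine_tensor (a b : G) : IsLine R (F.obj a ⊗ F.obj b) :=
  (F.isLine _).of_iso (F.mul rfl).symm

end Frame

namespace BraidedGroupCategory

variable {R : Type w} [CommRing R] {G : Type u} [CommGroup G]
  {𝒞 : BraidedGroupCategory.{w, u, v₁, u₁} R G} {ω : AbelianCocycle G Rˣ}
  {F : Frame R 𝒞.carrier ω} (hF : Represents F)

include hF

theorem braiding_self (X : 𝒞.Simple) :
    (β_ X.1 X.1).hom = (ω.comm (𝒞.label X) (𝒞.label X) : R) • 𝟙 (X.1 ⊗ X.1) :=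
  braiding_self_of_iso (hF X).some (F.braiding_self _)

theorem double_braiding (X Y : 𝒞.Simple) :
    (β_ X.1 Y.1).hom ≫ (β_ Y.1 X.1).hom =
      (ω.double (𝒞.label X) (𝒞.label Y) : R) • 𝟙 (X.1 ⊗ Y.1) :=
  double_braiding_of_iso (hF X).some (hF Y).some (F.double_braiding _ _)

theorem isLine_tensor (X Y : 𝒞.Simple) : IsLine R (X.1 ⊗ Y.1) :=
  (F.isLine_tensor _ _).of_iso ((hF X).some ⊗ᵢ (hF Y).some).symm

/-- The braidings in question are the scalars given by `ω`, by naturality along isomorphisms with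
representatives; these scalars are well defined because products of simple objects are lines. -/
theorem hasInvariants_iff {k : ℕ} {g : Fin k → G} {n : Fin k → ℕ} {d : BraidingData R n} :
    𝒞.HasInvariants g d ↔ ω.HasData g d := by
  constructor
  · rintro ⟨h1, h2⟩
    refine ⟨fun i => ?_, fun i j h => ?_⟩
    · obtain ⟨X, hX⟩ := 𝒞.label_surjective (g i)
      refine Units.ext ((isLine_tensor hF X X).1 ?_)
      beta_reduce
      rw [← hX, ← braiding_self hF X, h1 i X hX]
    · obtain ⟨X, hX⟩ := 𝒞.label_surjective (g i)
      obtain ⟨Y, hY⟩ := 𝒞.label_surjective (g j)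
      refine Units.ext ((isLine_tensor hF X Y).1 ?_)
      beta_reduce
      rw [← hX, ← hY, ← double_braiding hF X Y, h2 i j h X Y hX hY]
  · rintro ⟨h1, h2⟩
    refine ⟨fun i X hX => ?_, fun i j h X Y hX hY => ?_⟩
    · rw [braiding_self hF, hX, h1]
    · rw [double_braiding hF, hX, hY, h2 i j h]

end BraidedGroupCategory

theorem AbelianCocycle.HasData.unique {R : Type w} [CommRing R] {G : Type u} [CommGroup G] {k : ℕ}
    {g : Fin k → G} {n : Fin k → ℕ} {ω : AbelianCocycle G Rˣ} {d d' : BraidingData R n}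
    (h : ω.HasData g d) (h' : ω.HasData g d') : d = d' := by
  have h1 : d.diag = d'.diag := funext fun i => by rw [← h.diag, h'.diag]
  have h2 : d.off = d'.off := funext fun i => funext fun j => funext fun hij => by
    rw [← h.off, h'.off]
  cases d
  cases d'
  cases h1
  cases h2
  rfl

/-! ### The linear equivalence between categories with frames for one cocycle. -/

namespace Frame

noncomputable section

variable {R : Type w} [CommRing R] {G : Type u} [CommGroup G] {ω : AbelianCocycle G Rˣ}

section Decomposition

variable {C : Type u₁} [Category.{v₁} C] [Preadditive C] [Linear R C] [MonoidalCategory C]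
  [BraidedCategory C] (F : Frame R C ω)

/-- The number of summands of a chosen decomposition of `X`. -/
def rank (X : C) : ℕ := (F.exists_decomposition X).choose

/-- The degrees of the summands of a chosen decomposition of `X`. -/
def deg (X : C) : Fin (F.rank X) → G := (F.exists_decomposition X).choose_spec.choose

/-- The inclusions of a chosen decomposition of `X`. -/
def ι (X : C) (i : Fin (F.rank X)) : F.obj (F.deg X i) ⟶ X :=
  (F.exists_decomposition X).choose_spec.choose_spec.choose i

/-- The projections of a chosen decomposition of `X`. -/
def π (X : C) (i : Fin (F.rank X)) : X ⟶ F.obj (F.deg X i) :=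
  (F.exists_decomposition X).choose_spec.choose_spec.choose_spec.choose i

@[simp] theorem ι_π_self (X : C) (i : Fin (F.rank X)) : F.ι X i ≫ F.π X i = 𝟙 _ :=
  (F.exists_decomposition X).choose_spec.choose_spec.choose_spec.choose_spec.1 i

theorem ι_π_ne (X : C) {i j : Fin (F.rank X)} (h : i ≠ j) : F.ι X i ≫ F.π X j = 0 :=
  (F.exists_decomposition X).choose_spec.choose_spec.choose_spec.choose_spec.2.1 i j h

@[simp] theorem total (X : C) : ∑ i, F.π X i ≫ F.ι X i = 𝟙 X :=
  (F.exists_decomposition X).choose_spec.choose_spec.choose_spec.choose_spec.2.2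

theorem sum_comp_π_ι {X Z : C} (f : Z ⟶ X) : ∑ i, f ≫ F.π X i ≫ F.ι X i = f := by
  rw [← Preadditive.comp_sum, total, Category.comp_id]

theorem sum_π_ι_comp {X Z : C} (f : X ⟶ Z) : ∑ i, F.π X i ≫ F.ι X i ≫ f = f := by
  simp only [← Category.assoc]
  rw [← Preadditive.sum_comp, total, Category.id_comp]

/-- A morphism is determined by its compositions with the morphisms from the skeleton. -/
theorem hom_ext {X Y : C} {f f' : X ⟶ Y} (h : ∀ a (x : F.obj a ⟶ X), x ≫ f = x ≫ f') : f = f' := by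
  rw [← F.sum_π_ι_comp f, ← F.sum_π_ι_comp f']
  simp only [h]

/-- A morphism between objects of the skeleton is a multiple of an identity. -/
theorem hom_induction {P : ∀ {a b : G}, (F.obj a ⟶ F.obj b) → Prop}
    (zero : ∀ {a b : G}, P (0 : F.obj a ⟶ F.obj b))
    (smul : ∀ {a : G} (r : R), P (r • 𝟙 (F.obj a))) {a b : G} (f : F.obj a ⟶ F.obj b) : P f := by
  by_cases h : a = b
  · subst h
    obtain ⟨r, rfl⟩ := (F.isLine a).2 f
    exact smul r
  · rw [F.eq_zero h f]
    exact zero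

variable [MonoidalPreadditive C]

/-- Both factors are sums of representatives and the product is additive, so products of elements
suffice to test morphisms. -/
theorem tensor_hom_ext {X Y Z : C} {f f' : X ⊗ Y ⟶ Z}
    (h : ∀ a b (x : F.obj a ⟶ X) (y : F.obj b ⟶ Y), (x ⊗ₘ y) ≫ f = (x ⊗ₘ y) ≫ f') : f = f' := by
  have key : ∀ f : X ⊗ Y ⟶ Z, f = ∑ i, ∑ j, (F.π X i ⊗ₘ F.π Y j) ≫ (F.ι X i ⊗ₘ F.ι Y j) ≫ f := by
    intro f
    simp only [← Category.assoc, ← Preadditive.sum_comp, tensorHom_comp_tensorHom, ← tensor_sum,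
      ← sum_tensor, total]
    simp
  rw [key f, key f']
  simp only [h]

theorem sum_tensor_π_ι {X Y Z W : C} (x : Z ⟶ X) (y : W ⟶ Y) :
    ∑ i, ∑ j, ((x ≫ F.π X i ≫ F.ι X i) ⊗ₘ (y ≫ F.π Y j ≫ F.ι Y j)) = x ⊗ₘ y := by
  simp only [← tensor_sum, ← sum_tensor, sum_comp_π_ι]

end Decomposition

variable {C : Type u₁} [Category.{v₁} C] [Preadditive C] [Linear R C] [MonoidalCategory C]
  [BraidedCategory C]
  {D : Type u₂} [Category.{v₂} D] [Preadditive D] [Linear R D] [MonoidalCategory D]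
  [BraidedCategory D]
  (F : Frame R C ω) (H : Frame R D ω)

open scoped Classical in
/-- The bijection between the morphisms of two skeletons. -/
def transfer {a b : G} (f : F.obj a ⟶ F.obj b) : H.obj a ⟶ H.obj b :=
  if h : a = b then
    ((F.isLine a).2 (f ≫ eqToHom (by rw [h]))).choose • eqToHom (by rw [h])
  else 0

@[simp] theorem transfer_smul_id (a : G) (r : R) : F.transfer H (r • 𝟙 (F.obj a)) = r • 𝟙 _ := by
  rw [transfer, dif_pos rfl]
  change Exists.choose _ • 𝟙 (H.obj a) = _
  congr 1
  refine (F.isLine a).1 (((F.isLine a).2 _).choose_spec.trans ?_)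
  rw [eqToHom_refl, Category.comp_id]

@[simp] theorem transfer_id (a : G) : F.transfer H (𝟙 (F.obj a)) = 𝟙 _ := by
  simpa using F.transfer_smul_id H a 1

@[simp] theorem transfer_zero (a b : G) : F.transfer H (0 : F.obj a ⟶ F.obj b) = 0 := by
  by_cases h : a = b
  · subst h
    simpa using F.transfer_smul_id H a 0
  · rw [transfer, dif_neg h]

theorem transfer_add {a b : G} (f f' : F.obj a ⟶ F.obj b) :
    F.transfer H (f + f') = F.transfer H f + F.transfer H f' := by
  by_cases h : a = b
  · subst h
    obtain ⟨r, rfl⟩ := (F.isLine a).2 f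
    obtain ⟨s, rfl⟩ := (F.isLine a).2 f'
    simp [← add_smul]
  · rw [F.eq_zero h f, F.eq_zero h f']
    simp

/-- The bijection between the morphisms of two skeletons, as an additive map. -/
def transferHom (a b : G) : (F.obj a ⟶ F.obj b) →+ (H.obj a ⟶ H.obj b) where
  toFun := F.transfer H
  map_zero' := F.transfer_zero H a b
  map_add' := F.transfer_add H

theorem transfer_sum {a b : G} {J : Type} [Fintype J] (f : J → (F.obj a ⟶ F.obj b)) :
    F.transfer H (∑ j, f j) = ∑ j, F.transfer H (f j) :=
  map_sum (F.transferHom H a b) f Finset.univ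

theorem transfer_smul {a b : G} (r : R) (f : F.obj a ⟶ F.obj b) :
    F.transfer H (r • f) = r • F.transfer H f := by
  induction f using F.hom_induction with
  | zero => simp
  | smul s => simp [smul_smul]

theorem transfer_comp {a b c : G} (f : F.obj a ⟶ F.obj b) (f' : F.obj b ⟶ F.obj c) :
    F.transfer H (f ≫ f') = F.transfer H f ≫ F.transfer H f' := by
  induction f using F.hom_induction with
  | zero => simp
  | smul s => simp [transfer_smul]

theorem transfer_transfer {a b : G} (f : F.obj a ⟶ F.obj b) :
    H.transfer F (F.transfer H f) = f := by
  induction f using F.hom_induction with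
  | zero => simp
  | smul s => simp

/-- Both sides are multilinear, so only multiples of identities matter, and there the scalars
multiply. -/
theorem transfer_tensor [MonoidalPreadditive C] [MonoidalLinear R C] [MonoidalPreadditive D]
    [MonoidalLinear R D] {a b c a' b' c' : G} (f : F.obj a ⟶ F.obj a') (f' : F.obj b ⟶ F.obj b')
    (h : a * b = c) (h' : a' * b' = c') :
    F.transfer H ((F.mul h).inv ≫ (f ⊗ₘ f') ≫ (F.mul h').hom) =
      (H.mul h).inv ≫ (F.transfer H f ⊗ₘ F.transfer H f') ≫ (H.mul h').hom := by
  induction f using F.hom_induction with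
  | zero => simp
  | smul r =>
    induction f' using F.hom_induction with
    | zero => simp
    | smul s =>
      subst h h'
      simp [MonoidalCategory.tensorHom_def, transfer_smul]

variable [HasFiniteBiproducts D]

/-- The object of `D` with the same decomposition as `X`. -/
abbrev onObj (X : C) : D := ⨁ fun i => H.obj (F.deg X i)

/-- The element of `F.onObj H X` corresponding to an element of `X`. -/
def elem {X : C} {a : G} (x : F.obj a ⟶ X) : H.obj a ⟶ F.onObj H X :=
  biproduct.lift fun i => F.transfer H (x ≫ F.π X i)

/-- The functional on `F.onObj H X` corresponding to a functional on `X`. -/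
def coelem {X : C} {a : G} (p : X ⟶ F.obj a) : F.onObj H X ⟶ H.obj a :=
  biproduct.desc fun i => F.transfer H (F.ι X i ≫ p)

-- The duality formula through which all computations with the functor pass: `transfer` is
-- functorial and additive, so the sum over the decomposition of `X` collapses.
@[simp]
theorem elem_coelem {X : C} {a b : G} (x : F.obj a ⟶ X) (p : X ⟶ F.obj b) :
    F.elem H x ≫ F.coelem H p = F.transfer H (x ≫ p) := by
  refine biproduct.lift_desc.trans ?_
  simp only [← transfer_comp, ← transfer_sum, Category.assoc]
  rw [← Preadditive.comp_sum, sum_π_ι_comp]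

@[simp]
theorem elem_coelem_assoc {X : C} {Z : D} {a b : G} (x : F.obj a ⟶ X) (p : X ⟶ F.obj b)
    (f : H.obj b ⟶ Z) : F.elem H x ≫ F.coelem H p ≫ f = F.transfer H (x ≫ p) ≫ f := by
  rw [← Category.assoc, elem_coelem]

theorem transfer_comp_elem {X : C} {a b : G} (f : F.obj a ⟶ F.obj b) (x : F.obj b ⟶ X) :
    F.transfer H f ≫ F.elem H x = F.elem H (f ≫ x) := by
  refine biproduct.hom_ext _ _ fun i => ?_
  simp [elem, transfer_comp]

theorem elem_zero (X : C) (a : G) : F.elem H (0 : F.obj a ⟶ X) = 0 := by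
  refine biproduct.hom_ext _ _ fun i => ?_
  simp [elem]

theorem elem_add {X : C} {a : G} (x y : F.obj a ⟶ X) :
    F.elem H (x + y) = F.elem H x + F.elem H y := by
  refine biproduct.hom_ext _ _ fun i => ?_
  simp [elem, transfer_add]

theorem elem_smul {X : C} {a : G} (r : R) (x : F.obj a ⟶ X) :
    F.elem H (r • x) = r • F.elem H x := by
  refine biproduct.hom_ext _ _ fun i => ?_
  simp [elem, transfer_smul]

/-- The elements of `F.onObj H X`, additively in the element of `X`. -/
def elemHom (X : C) (a : G) : (F.obj a ⟶ X) →+ (H.obj a ⟶ F.onObj H X) where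
  toFun := F.elem H
  map_zero' := F.elem_zero H X a
  map_add' := F.elem_add H

theorem elem_sum {X : C} {a : G} {J : Type} [Fintype J] (f : J → (F.obj a ⟶ X)) :
    F.elem H (∑ j, f j) = ∑ j, F.elem H (f j) :=
  map_sum (F.elemHom H X a) f Finset.univ

theorem elem_ι (X : C) (i : Fin (F.rank X)) :
    F.elem H (F.ι X i) = biproduct.ι (fun i => H.obj (F.deg X i)) i := by
  refine biproduct.hom_ext _ _ fun j => ?_
  rw [elem, biproduct.lift_π]
  by_cases h : i = j
  · subst h
    simp
  · rw [F.ι_π_ne X h, biproduct.ι_π_ne _ h, transfer_zero]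

theorem coelem_π (X : C) (i : Fin (F.rank X)) :
    F.coelem H (F.π X i) = biproduct.π (fun i => H.obj (F.deg X i)) i := by
  refine biproduct.hom_ext' _ _ fun j => ?_
  rw [coelem, biproduct.ι_desc]
  by_cases h : j = i
  · subst h
    simp
  · rw [F.ι_π_ne X h, biproduct.ι_π_ne _ h, transfer_zero]

theorem onObj_total (X : C) :
    ∑ i, F.coelem H (F.π X i) ≫ F.elem H (F.ι X i) = 𝟙 (F.onObj H X) := by
  simp only [elem_ι, coelem_π]
  exact biproduct.total

/-- A morphism from `F.onObj H X` is determined by its values on the elements. -/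
theorem onObj_hom_ext {X : C} {Z : D} {f f' : F.onObj H X ⟶ Z}
    (h : ∀ a (x : F.obj a ⟶ X), F.elem H x ≫ f = F.elem H x ≫ f') : f = f' := by
  rw [← Category.id_comp f, ← Category.id_comp f', ← onObj_total]
  simp only [Preadditive.sum_comp, Category.assoc, h]

/-- The morphism corresponding to `f`. -/
def onHom {X Y : C} (f : X ⟶ Y) : F.onObj H X ⟶ F.onObj H Y :=
  ∑ i, F.coelem H (F.π X i) ≫ F.elem H (F.ι X i ≫ f)

@[simp]
theorem elem_onHom {X Y : C} {a : G} (x : F.obj a ⟶ X) (f : X ⟶ Y) :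
    F.elem H x ≫ F.onHom H f = F.elem H (x ≫ f) := by
  rw [onHom, Preadditive.comp_sum]
  simp only [elem_coelem_assoc, transfer_comp_elem, ← elem_sum]
  congr 1
  simp only [Category.assoc]
  rw [← Preadditive.comp_sum, sum_π_ι_comp]

@[simp]
theorem elem_onHom_assoc {X Y : C} {Z : D} {a : G} (x : F.obj a ⟶ X) (f : X ⟶ Y)
    (f' : F.onObj H Y ⟶ Z) : F.elem H x ≫ F.onHom H f ≫ f' = F.elem H (x ≫ f) ≫ f' := by
  rw [← Category.assoc, elem_onHom]

theorem onHom_id (X : C) : F.onHom H (𝟙 X) = 𝟙 _ := F.onObj_hom_ext H fun a x => by simp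

theorem onHom_comp {X Y Z : C} (f : X ⟶ Y) (f' : Y ⟶ Z) :
    F.onHom H (f ≫ f') = F.onHom H f ≫ F.onHom H f' := F.onObj_hom_ext H fun a x => by simp

theorem onHom_add {X Y : C} (f f' : X ⟶ Y) : F.onHom H (f + f') = F.onHom H f + F.onHom H f' :=
  F.onObj_hom_ext H fun a x => by simp [elem_add]

theorem onHom_smul {X Y : C} (r : R) (f : X ⟶ Y) : F.onHom H (r • f) = r • F.onHom H f :=
  F.onObj_hom_ext H fun a x => by simp [elem_smul]

theorem elem_injective {X : C} {a : G} {x y : F.obj a ⟶ X} (h : F.elem H x = F.elem H y) :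
    x = y := by
  have h1 : ∀ i, x ≫ F.π X i = y ≫ F.π X i := fun i => by
    rw [← F.transfer_transfer H (x ≫ _), ← F.transfer_transfer H (y ≫ _),
      ← F.elem_coelem H x, ← F.elem_coelem H y, h]
  rw [← F.sum_comp_π_ι x, ← F.sum_comp_π_ι y]
  refine Finset.sum_congr rfl fun i _ => ?_
  rw [← Category.assoc, h1, Category.assoc]

theorem elem_surjective {X : C} {a : G} (y : H.obj a ⟶ F.onObj H X) :
    ∃ x : F.obj a ⟶ X, F.elem H x = y := by
  refine ⟨∑ i, H.transfer F (y ≫ F.coelem H (F.π X i)) ≫ F.ι X i, ?_⟩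
  simp only [elem_sum, ← transfer_comp_elem, transfer_transfer, Category.assoc]
  rw [← Preadditive.comp_sum, onObj_total, Category.comp_id]

theorem onHom_injective {X Y : C} {f f' : X ⟶ Y} (h : F.onHom H f = F.onHom H f') : f = f' :=
  F.hom_ext fun a x => F.elem_injective H <| by rw [← elem_onHom, ← elem_onHom, h]

/-- Fullness: lift the images of the basis elements `F.ι X i` by `elem_surjective` and reassemble
them with the projections of `X`. -/
theorem onHom_surjective {X Y : C} (f : F.onObj H X ⟶ F.onObj H Y) :
    ∃ f' : X ⟶ Y, F.onHom H f' = f := by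
  choose y hy using fun i => F.elem_surjective H (F.elem H (F.ι X i) ≫ f)
  refine ⟨∑ i, F.π X i ≫ y i, F.onObj_hom_ext H fun a x => ?_⟩
  rw [elem_onHom, Preadditive.comp_sum, elem_sum]
  simp only [← Category.assoc x, ← transfer_comp_elem _ _ (x ≫ _), hy]
  simp only [← elem_coelem, Category.assoc]
  rw [← Preadditive.comp_sum]
  simp only [← Category.assoc]
  rw [← Preadditive.sum_comp, onObj_total, Category.id_comp]

/-- A direct sum of objects of the second skeleton is the image of a direct sum. -/
theorem exists_iso_onObj [HasFiniteBiproducts C] (Y : D) : ∃ X : C, Nonempty (F.onObj H X ≅ Y) := by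
  -- The preimage is the sum in the first category with the degrees occurring in `Y`. Its own chosen
  -- decomposition need not be this one, so the isomorphism is built from elements and functionals.
  let s := fun i => F.obj (H.deg Y i)
  let f : F.onObj H (⨁ s) ⟶ Y := ∑ i, F.coelem H (biproduct.π s i) ≫ H.ι Y i
  let f' : Y ⟶ F.onObj H (⨁ s) := ∑ i, H.π Y i ≫ F.elem H (biproduct.ι s i)
  have h1 : ∀ i, F.elem H (biproduct.ι s i) ≫ f = H.ι Y i := fun i => by
    simp only [f, Preadditive.comp_sum, elem_coelem_assoc]
    rw [Finset.sum_eq_single i]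
    · rw [biproduct.ι_π_self, transfer_id, Category.id_comp]
    · intro j _ h
      rw [biproduct.ι_π_ne _ h.symm, transfer_zero, zero_comp]
    · simp
  have h2 : ∀ i, H.ι Y i ≫ f' = F.elem H (biproduct.ι s i) := fun i => by
    simp only [f', Preadditive.comp_sum]
    rw [Finset.sum_eq_single i]
    · rw [← Category.assoc, ι_π_self, Category.id_comp]
    · intro j _ h
      rw [← Category.assoc, H.ι_π_ne _ h.symm, zero_comp]
    · simp
  refine ⟨⨁ s, ⟨⟨f, f', F.onObj_hom_ext H fun a x => ?_, ?_⟩⟩⟩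
  · have h3 : x = ∑ i : Fin (H.rank Y), (x ≫ biproduct.π s i) ≫ biproduct.ι s i := by
      simp only [Category.assoc]
      rw [← Preadditive.comp_sum, biproduct.total, Category.comp_id]
    rw [h3, elem_sum, Category.comp_id, Preadditive.sum_comp]
    refine Finset.sum_congr rfl fun i _ => ?_
    rw [← transfer_comp_elem, Category.assoc, ← Category.assoc (F.elem H _), h1, h2]
  · have h3 : f' ≫ f = ∑ i : Fin (H.rank Y), H.π Y i ≫ H.ι Y i := by
      simp only [f', Preadditive.sum_comp, Category.assoc, h1]
    rw [h3, total]

/-- The functor defined by two frames with the same cocycle. -/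
def functor : C ⥤ D where
  obj := F.onObj H
  map := F.onHom H
  map_id := F.onHom_id H
  map_comp := F.onHom_comp H

instance : (F.functor H).Additive where
  map_add {_ _ f f'} := F.onHom_add H f f'

instance : (F.functor H).Linear R where
  map_smul f r := F.onHom_smul H r f

instance : (F.functor H).Faithful where
  map_injective h := F.onHom_injective H h

instance : (F.functor H).Full where
  map_surjective := F.onHom_surjective H

instance [HasFiniteBiproducts C] : (F.functor H).EssSurj where
  mem_essImage := F.exists_iso_onObj H

instance [HasFiniteBiproducts C] : (F.functor H).IsEquivalence where

/-- The functor maps the first skeleton to the second one. -/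
def onObjIso (a : G) : F.onObj H (F.obj a) ≅ H.obj a where
  hom := F.coelem H (𝟙 _)
  inv := F.elem H (𝟙 _)
  hom_inv_id := F.onObj_hom_ext H fun b x => by
    rw [elem_coelem_assoc, transfer_comp_elem]
    simp
  inv_hom_id := by simp

end

end Frame

/-! ### The braided monoidal structure of the equivalence. -/

namespace Frame

noncomputable section

variable {R : Type w} [CommRing R] {G : Type u} [CommGroup G] {ω : AbelianCocycle G Rˣ}

section Pair

variable {C : Type u₁} [Category.{v₁} C] [Preadditive C] [Linear R C] [MonoidalCategory C]
  [BraidedCategory C] (F : Frame R C ω)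

/-- The element of `X ⊗ Y` given by an element of `X` and an element of `Y`. -/
def pair {X Y : C} {a b c : G} (h : a * b = c) (x : F.obj a ⟶ X) (y : F.obj b ⟶ Y) :
    F.obj c ⟶ X ⊗ Y := (F.mul h).inv ≫ (x ⊗ₘ y)

variable {X Y Z X' Y' : C} {a b c d e f : G}

theorem tensor_pair (h : a * b = c) (x : F.obj a ⟶ X) (y : F.obj b ⟶ Y) :
    x ⊗ₘ y = (F.mul h).hom ≫ F.pair h x y := by
  simp [pair]

theorem pair_tensor (h : a * b = c) (x : F.obj a ⟶ X) (y : F.obj b ⟶ Y) (f : X ⟶ X')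
    (f' : Y ⟶ Y') : F.pair h x y ≫ (f ⊗ₘ f') = F.pair h (x ≫ f) (y ≫ f') := by
  simp [pair]

theorem pair_tensor_assoc (h : a * b = c) (x : F.obj a ⟶ X) (y : F.obj b ⟶ Y) (f : X ⟶ X')
    (f' : Y ⟶ Y') (f'' : X' ⊗ Y' ⟶ Z) :
    F.pair h x y ≫ (f ⊗ₘ f') ≫ f'' = F.pair h (x ≫ f) (y ≫ f') ≫ f'' := by
  rw [← Category.assoc, pair_tensor]

/-- Rebracketing a triple of elements produces a scalar depending only on the cocycle and the
degrees. Together with `pair_braiding` this is where the cocycle enters the comparison. -/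
theorem pair_assoc [MonoidalPreadditive C] [MonoidalLinear R C] (h₁ : b * c = d) (h₂ : a * d = f)
    (h₃ : a * b = e) (h₄ : e * c = f) (x : F.obj a ⟶ X) (y : F.obj b ⟶ Y) (z : F.obj c ⟶ Z) :
    F.pair h₄ (F.pair h₃ x y) z ≫ (α_ X Y Z).hom =
      (ω.assoc a b c : R) • F.pair h₂ x (F.pair h₁ y z) := by
  have h : (F.mul h₄).inv ≫ (F.mul h₃).inv ▷ F.obj c ≫ (α_ _ _ _).hom =
      (ω.assoc a b c : R) • ((F.mul h₂).inv ≫ F.obj a ◁ (F.mul h₁).inv) := by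
    rw [← cancel_mono (F.obj a ◁ (F.mul h₁).hom), ← cancel_mono (F.mul h₂).hom]
    simp only [Category.assoc]
    rw [F.hasAssoc h₁ h₂ h₃ h₄]
    simp
  have h1 : F.pair h₄ (F.pair h₃ x y) z = (F.mul h₄).inv ≫ (F.mul h₃).inv ▷ F.obj c ≫
      ((x ⊗ₘ y) ⊗ₘ z) := by
    simp [pair, MonoidalCategory.tensorHom_def]
  have h2 : F.pair h₂ x (F.pair h₁ y z) = ((F.mul h₂).inv ≫ F.obj a ◁ (F.mul h₁).inv) ≫
      (x ⊗ₘ (y ⊗ₘ z)) := by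
    simp [pair, MonoidalCategory.tensorHom_def', MonoidalCategory.whiskerLeft_comp]
  rw [h1, h2, Category.assoc, Category.assoc, associator_naturality, ← Linear.smul_comp, ← h]
  simp only [Category.assoc]

theorem pair_braiding (h : a * b = c) (h' : b * a = c) (x : F.obj a ⟶ X) (y : F.obj b ⟶ Y) :
    F.pair h x y ≫ (β_ X Y).hom = (ω.comm a b : R) • F.pair h' y x := by
  have h1 : (F.mul h).inv ≫ (β_ _ _).hom = (ω.comm a b : R) • (F.mul h').inv := by
    rw [← cancel_mono (F.mul h').hom, Category.assoc, F.hasComm h' h]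
    simp
  rw [pair, pair, Category.assoc, BraidedCategory.braiding_naturality, ← Category.assoc, h1,
    Linear.smul_comp]

theorem pair_unit_left (h : 1 * a = a) (x : F.obj a ⟶ X) :
    F.pair h F.unit.inv x ≫ (λ_ X).hom = x := by
  rw [pair, MonoidalCategory.tensorHom_def, Category.assoc, Category.assoc, leftUnitor_naturality,
    ← F.left_unit h]
  simp

theorem pair_unit_right (h : a * 1 = a) (x : F.obj a ⟶ X) :
    F.pair h x F.unit.inv ≫ (ρ_ X).hom = x := by
  rw [pair, MonoidalCategory.tensorHom_def', Category.assoc, Category.assoc,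
    rightUnitor_naturality, ← F.right_unit h]
  simp

theorem sum_pair_π_ι [MonoidalPreadditive C] (h : a * b = c) (x : F.obj a ⟶ X)
    (y : F.obj b ⟶ Y) : ∑ i, ∑ j, F.pair h (x ≫ F.π X i ≫ F.ι X i) (y ≫ F.π Y j ≫ F.ι Y j) =
      F.pair h x y := by
  simp only [pair, ← Preadditive.comp_sum, sum_tensor_π_ι]

theorem whiskerLeft_hom_ext [MonoidalPreadditive C] {f f' : Y ⊗ X ⟶ Z}
    (h : ∀ a (x : F.obj a ⟶ X), Y ◁ x ≫ f = Y ◁ x ≫ f') : f = f' := by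
  refine F.tensor_hom_ext fun a b x y => ?_
  rw [MonoidalCategory.tensorHom_def, Category.assoc, Category.assoc, h]

theorem whiskerRight_hom_ext [MonoidalPreadditive C] {f f' : X ⊗ Y ⟶ Z}
    (h : ∀ a (x : F.obj a ⟶ X), x ▷ Y ≫ f = x ▷ Y ≫ f') : f = f' := by
  refine F.tensor_hom_ext fun a b x y => ?_
  rw [MonoidalCategory.tensorHom_def', Category.assoc, Category.assoc, h]

theorem tensor_tensor_hom_ext [MonoidalPreadditive C] {f f' : (X ⊗ Y) ⊗ Z ⟶ X'}
    (h : ∀ a b c (x : F.obj a ⟶ X) (y : F.obj b ⟶ Y) (z : F.obj c ⟶ Z),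
      ((x ⊗ₘ y) ⊗ₘ z) ≫ f = ((x ⊗ₘ y) ⊗ₘ z) ≫ f') : f = f' := by
  refine F.tensor_hom_ext fun e c t z => ?_
  have ht : t = ∑ i, ∑ j, t ≫ (F.π X i ⊗ₘ F.π Y j) ≫ (F.ι X i ⊗ₘ F.ι Y j) := by
    simp only [← Preadditive.comp_sum, tensorHom_comp_tensorHom, ← tensor_sum, ← sum_tensor, total]
    simp
  have key : ∀ i j (f : (X ⊗ Y) ⊗ Z ⟶ X'),
      ((t ≫ (F.π X i ⊗ₘ F.π Y j) ≫ (F.ι X i ⊗ₘ F.ι Y j)) ⊗ₘ z) ≫ f =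
      ((t ≫ (F.π X i ⊗ₘ F.π Y j)) ⊗ₘ 𝟙 _) ≫ ((F.ι X i ⊗ₘ F.ι Y j) ⊗ₘ z) ≫ f := fun i j f => by
    rw [tensorHom_comp_tensorHom_assoc, Category.id_comp, Category.assoc]
  rw [ht]
  simp only [sum_tensor, Preadditive.sum_comp, key, h]

end Pair

variable {C : Type u₁} [Category.{v₁} C] [Preadditive C] [Linear R C] [MonoidalCategory C]
  [BraidedCategory C] [MonoidalPreadditive C] [MonoidalLinear R C]
  {D : Type u₂} [Category.{v₂} D] [Preadditive D] [Linear R D] [MonoidalCategory D]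
  [BraidedCategory D] [MonoidalPreadditive D] [MonoidalLinear R D] [HasFiniteBiproducts D]
  (F : Frame R C ω) (H : Frame R D ω)

/-- The tensorator of the functor defined by two frames. -/
def tensorator (X Y : C) : F.onObj H X ⊗ F.onObj H Y ⟶ F.onObj H (X ⊗ Y) :=
  ∑ i, ∑ j, (F.coelem H (F.π X i) ⊗ₘ F.coelem H (F.π Y j)) ≫ (H.mul rfl).hom ≫
    F.elem H (F.pair rfl (F.ι X i) (F.ι Y j))

/-- The inverse of the tensorator. -/
def tensoratorInv (X Y : C) : F.onObj H (X ⊗ Y) ⟶ F.onObj H X ⊗ F.onObj H Y :=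
  ∑ i, ∑ j, F.coelem H ((F.π X i ⊗ₘ F.π Y j) ≫ (F.mul rfl).hom) ≫
    H.pair rfl (F.elem H (F.ι X i)) (F.elem H (F.ι Y j))

/-- The characterization of the tensorator independent of decompositions: it sends a pair of
transferred elements to the transferred pair. Naturality and coherence then reduce to identities
between pairs. -/
theorem elem_tensorator {X Y : C} {a b c : G} (h : a * b = c) (x : F.obj a ⟶ X)
    (y : F.obj b ⟶ Y) : (F.elem H x ⊗ₘ F.elem H y) ≫ F.tensorator H X Y =
      (H.mul h).hom ≫ F.elem H (F.pair h x y) := by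
  have key : ∀ i j, (F.elem H x ⊗ₘ F.elem H y) ≫
      (F.coelem H (F.π X i) ⊗ₘ F.coelem H (F.π Y j)) ≫
        (H.mul rfl).hom ≫ F.elem H (F.pair rfl (F.ι X i) (F.ι Y j)) =
      (H.mul h).hom ≫ F.elem H (F.pair h (x ≫ F.π X i ≫ F.ι X i) (y ≫ F.π Y j ≫ F.ι Y j)) :=
    fun i j => by
      have h1 := F.transfer_tensor H (x ≫ F.π X i) (y ≫ F.π Y j) h rfl
      rw [Iso.eq_inv_comp] at h1
      rw [tensorHom_comp_tensorHom_assoc, elem_coelem, elem_coelem, ← Category.assoc, ← h1,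
        Category.assoc, transfer_comp_elem]
      simp [pair]
  simp only [tensorator, Preadditive.comp_sum, key]
  rw [← F.sum_pair_π_ι h x y]
  simp only [← Preadditive.comp_sum, elem_sum]

theorem elem_tensorator_assoc {X Y : C} {Z : D} {a b c : G} (h : a * b = c) (x : F.obj a ⟶ X)
    (y : F.obj b ⟶ Y) (f : F.onObj H (X ⊗ Y) ⟶ Z) :
    (F.elem H x ⊗ₘ F.elem H y) ≫ F.tensorator H X Y ≫ f =
      (H.mul h).hom ≫ F.elem H (F.pair h x y) ≫ f := by
  rw [← Category.assoc, F.elem_tensorator H h, Category.assoc]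

omit [MonoidalPreadditive C] [MonoidalLinear R C] [MonoidalLinear R D] in
theorem onObj_tensor_hom_ext {X Y : C} {Z : D} {f f' : F.onObj H X ⊗ F.onObj H Y ⟶ Z}
    (h : ∀ a b (x : F.obj a ⟶ X) (y : F.obj b ⟶ Y),
      (F.elem H x ⊗ₘ F.elem H y) ≫ f = (F.elem H x ⊗ₘ F.elem H y) ≫ f') : f = f' := by
  refine H.tensor_hom_ext fun a b x y => ?_
  obtain ⟨x, rfl⟩ := F.elem_surjective H x
  obtain ⟨y, rfl⟩ := F.elem_surjective H y
  exact h _ _ _ _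

theorem pair_tensorator {X Y : C} {a b c : G} (h : a * b = c) (x : F.obj a ⟶ X)
    (y : F.obj b ⟶ Y) : H.pair h (F.elem H x) (F.elem H y) ≫ F.tensorator H X Y =
      F.elem H (F.pair h x y) := by
  rw [pair, Category.assoc, F.elem_tensorator H h, Iso.inv_hom_id_assoc]

theorem pair_tensorator_assoc {X Y : C} {Z : D} {a b c : G} (h : a * b = c) (x : F.obj a ⟶ X)
    (y : F.obj b ⟶ Y) (f : F.onObj H (X ⊗ Y) ⟶ Z) :
    H.pair h (F.elem H x) (F.elem H y) ≫ F.tensorator H X Y ≫ f = F.elem H (F.pair h x y) ≫ f := by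
  rw [← Category.assoc, pair_tensorator]

theorem tensoratorInv_tensorator (X Y : C) :
    F.tensoratorInv H X Y ≫ F.tensorator H X Y = 𝟙 _ := by
  refine F.onObj_hom_ext H fun a x => ?_
  simp only [tensoratorInv, Preadditive.comp_sum, Preadditive.sum_comp, Category.assoc,
    pair_tensorator, elem_coelem_assoc, transfer_comp_elem, ← elem_sum]
  simp only [pair, Iso.hom_inv_id_assoc, tensorHom_comp_tensorHom, ← tensor_sum, ← sum_tensor,
    ← Preadditive.comp_sum, total]
  simp

theorem tensorator_tensoratorInv (X Y : C) :
    F.tensorator H X Y ≫ F.tensoratorInv H X Y = 𝟙 _ := by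
  refine F.onObj_tensor_hom_ext H fun a b x y => ?_
  have key : ∀ i j, F.elem H (F.pair (rfl : a * b = _) x y) ≫
      F.coelem H ((F.π X i ⊗ₘ F.π Y j) ≫ (F.mul rfl).hom) ≫
        H.pair rfl (F.elem H (F.ι X i)) (F.elem H (F.ι Y j)) =
      H.pair rfl (F.elem H (x ≫ F.π X i ≫ F.ι X i)) (F.elem H (y ≫ F.π Y j ≫ F.ι Y j)) :=
    fun i j => by
      rw [elem_coelem_assoc, ← Category.assoc (F.pair _ x y), pair_tensor, pair, Category.assoc,
        transfer_tensor, pair, pair, ← Category.assoc x, ← Category.assoc y, ← transfer_comp_elem,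
        ← transfer_comp_elem]
      simp
  rw [F.elem_tensorator_assoc H rfl]
  simp only [tensoratorInv, Preadditive.comp_sum, key]
  simp only [pair, Iso.hom_inv_id_assoc, ← tensor_sum, ← sum_tensor, ← elem_sum, sum_comp_π_ι,
    Category.comp_id]

/-- The tensorator as an isomorphism. -/
def tensoratorIso (X Y : C) : F.onObj H X ⊗ F.onObj H Y ≅ F.onObj H (X ⊗ Y) where
  hom := F.tensorator H X Y
  inv := F.tensoratorInv H X Y
  hom_inv_id := F.tensorator_tensoratorInv H X Y
  inv_hom_id := F.tensoratorInv_tensorator H X Y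

/-- The comparison of unit objects. -/
@[simps]
def unitIso : 𝟙_ D ≅ F.onObj H (𝟙_ C) where
  hom := H.unit.hom ≫ F.elem H F.unit.inv
  inv := F.coelem H F.unit.hom ≫ H.unit.inv
  hom_inv_id := by simp
  inv_hom_id := F.onObj_hom_ext H fun a x => by
    rw [Category.assoc, Iso.inv_hom_id_assoc, elem_coelem_assoc, transfer_comp_elem]
    simp

theorem onHom_tensorator {X Y X' Y' : C} (f : X ⟶ X') (f' : Y ⟶ Y') :
    (F.onHom H f ⊗ₘ F.onHom H f') ≫ F.tensorator H X' Y' =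
      F.tensorator H X Y ≫ F.onHom H (f ⊗ₘ f') := by
  refine F.onObj_tensor_hom_ext H fun a b x y => ?_
  rw [tensorHom_comp_tensorHom_assoc, elem_onHom, elem_onHom, F.elem_tensorator H rfl,
    F.elem_tensorator_assoc H rfl, elem_onHom, pair_tensor]

/-- On triples of elements both sides equal the same transferred triple times `ω.assoc a b c`, since
the two frames share `ω`. -/
theorem tensorator_assoc (X Y Z : C) :
    F.tensorator H X Y ▷ F.onObj H Z ≫ F.tensorator H (X ⊗ Y) Z ≫ F.onHom H (α_ X Y Z).hom =
      (α_ (F.onObj H X) (F.onObj H Y) (F.onObj H Z)).hom ≫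
        F.onObj H X ◁ F.tensorator H Y Z ≫ F.tensorator H X (Y ⊗ Z) := by
  refine H.tensor_tensor_hom_ext fun a b c x y z => ?_
  obtain ⟨x, rfl⟩ := F.elem_surjective H x
  obtain ⟨y, rfl⟩ := F.elem_surjective H y
  obtain ⟨z, rfl⟩ := F.elem_surjective H z
  have h1 : (F.elem H x ⊗ₘ F.elem H y) ⊗ₘ F.elem H z =
      (H.mul rfl).hom ▷ H.obj c ≫ (H.mul rfl).hom ≫
        H.pair rfl (H.pair rfl (F.elem H x) (F.elem H y)) (F.elem H z) := by
    simp [pair, MonoidalCategory.tensorHom_def]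
  rw [h1]
  simp only [Category.assoc]
  congr 2
  rw [← tensorHom_id, ← id_tensorHom, pair_tensor_assoc, Category.comp_id, pair_tensorator,
    pair_tensorator_assoc, elem_onHom, F.pair_assoc rfl (mul_assoc a b c).symm rfl rfl, elem_smul,
    ← Category.assoc, H.pair_assoc rfl (mul_assoc a b c).symm rfl rfl, Linear.smul_comp,
    pair_tensor_assoc, Category.comp_id, pair_tensorator, pair_tensorator]

theorem tensorator_left_unit (X : C) : (λ_ (F.onObj H X)).hom =
    (F.unitIso H).hom ▷ F.onObj H X ≫ F.tensorator H (𝟙_ C) X ≫ F.onHom H (λ_ X).hom := by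
  -- Replacing the unit object by `H.obj 1` turns the first tensor factor into a source of elements,
  -- to which the formulas for pairs apply.
  rw [← cancel_epi (H.unit.inv ▷ F.onObj H X)]
  refine H.whiskerLeft_hom_ext fun a x => ?_
  obtain ⟨x, rfl⟩ := F.elem_surjective H x
  rw [← cancel_epi (H.mul (one_mul a)).inv]
  have h1 : (H.mul (one_mul a)).inv ≫ H.obj 1 ◁ F.elem H x ≫ H.unit.inv ▷ F.onObj H X =
      H.pair (one_mul a) H.unit.inv (F.elem H x) := by
    simp [pair, MonoidalCategory.tensorHom_def']
  have h2 : (H.mul (one_mul a)).inv ≫ H.obj 1 ◁ F.elem H x ≫ H.unit.inv ▷ F.onObj H X ≫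
      (F.unitIso H).hom ▷ F.onObj H X =
        H.pair (one_mul a) (F.elem H F.unit.inv) (F.elem H x) := by
    simp [pair, MonoidalCategory.tensorHom_def']
  rw [reassoc_of% h1, reassoc_of% h2, pair_unit_left, pair_tensorator_assoc, elem_onHom,
    pair_unit_left]

theorem tensorator_right_unit (X : C) : (ρ_ (F.onObj H X)).hom =
    F.onObj H X ◁ (F.unitIso H).hom ≫ F.tensorator H X (𝟙_ C) ≫ F.onHom H (ρ_ X).hom := by
  rw [← cancel_epi (F.onObj H X ◁ H.unit.inv)]
  refine H.whiskerRight_hom_ext fun a x => ?_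
  obtain ⟨x, rfl⟩ := F.elem_surjective H x
  rw [← cancel_epi (H.mul (mul_one a)).inv]
  have h1 : (H.mul (mul_one a)).inv ≫ F.elem H x ▷ H.obj 1 ≫ F.onObj H X ◁ H.unit.inv =
      H.pair (mul_one a) (F.elem H x) H.unit.inv := by
    simp [pair, MonoidalCategory.tensorHom_def]
  have h2 : (H.mul (mul_one a)).inv ≫ F.elem H x ▷ H.obj 1 ≫ F.onObj H X ◁ H.unit.inv ≫
      F.onObj H X ◁ (F.unitIso H).hom =
        H.pair (mul_one a) (F.elem H x) (F.elem H F.unit.inv) := by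
    simp [pair, MonoidalCategory.tensorHom_def]
  rw [reassoc_of% h1, reassoc_of% h2, pair_unit_right, pair_tensorator_assoc, elem_onHom,
    pair_unit_right]

theorem tensorator_braiding (X Y : C) : F.tensorator H X Y ≫ F.onHom H (β_ X Y).hom =
    (β_ _ _).hom ≫ F.tensorator H Y X := by
  refine F.onObj_tensor_hom_ext H fun a b x y => ?_
  rw [H.tensor_pair rfl]
  simp only [Category.assoc]
  rw [pair_tensorator_assoc, elem_onHom, F.pair_braiding rfl (mul_comm b a), elem_smul,
    ← Category.assoc (H.pair _ _ _), H.pair_braiding rfl (mul_comm b a), Linear.smul_comp,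
    pair_tensorator]

/-- The monoidal structure of the functor defined by two frames. -/
def coreMonoidal : (F.functor H).CoreMonoidal where
  εIso := F.unitIso H
  μIso := F.tensoratorIso H
  μIso_hom_natural_left {X Y} f X' := by
    have h := F.onHom_tensorator H f (𝟙 X')
    rwa [onHom_id, tensorHom_id, tensorHom_id] at h
  μIso_hom_natural_right {X Y} X' f := by
    have h := F.onHom_tensorator H (𝟙 X') f
    rwa [onHom_id, id_tensorHom, id_tensorHom] at h
  associativity := F.tensorator_assoc H
  left_unitality := F.tensorator_left_unit H
  right_unitality := F.tensorator_right_unit H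

instance : (F.functor H).Monoidal := (F.coreMonoidal H).toMonoidal

instance : (F.functor H).Braided where
  braided X Y := F.tensorator_braiding H X Y

end

end Frame

/-! ### Classification by the invariants. -/

namespace BraidedGroupCategory

variable {R : Type w} [CommRing R] {G : Type u} [CommGroup G]

theorem equivalent_of_represents {𝒞 : BraidedGroupCategory.{w, u, v₁, u₁} R G}
    {𝒟 : BraidedGroupCategory.{w, u, v₂, u₂} R G} {ω : AbelianCocycle G Rˣ}
    {F : Frame R 𝒞.carrier ω} {H : Frame R 𝒟.carrier ω} (hF : Represents F) (hH : Represents H) :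
    𝒞.Equivalent 𝒟 := by
  refine ⟨F.functor H, inferInstance, inferInstance, inferInstance, inferInstance,
    fun X Y h => ?_⟩
  obtain ⟨e⟩ := hF X
  obtain ⟨e'⟩ := hH Y
  exact ⟨(F.functor H).mapIso e ≪≫ F.onObjIso H _ ≪≫ eqToIso (by rw [h]) ≪≫ e'.symm⟩

variable {k : ℕ} {g : Fin k → G} {n : Fin k → ℕ}

/-- Normal form: the isomorphisms of any frame can be rescaled so that its cocycle is the standard
one of the invariants. -/
theorem exists_represents_cocycle [Nontrivial R] (hg : IsCyclicBasis g n)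
    {𝒞 : BraidedGroupCategory.{w, u, v₁, u₁} R G} {d : BraidingData R n}
    (h : 𝒞.HasInvariants g d) : ∃ F : Frame R 𝒞.carrier (d.cocycle hg), Represents F := by
  obtain ⟨ω, F, hF⟩ := 𝒞.exists_frame
  obtain ⟨t, ht⟩ := ω.exists_isGauge hg ((hasInvariants_iff hF).1 h)
  -- The rescaling leaves the representatives unchanged, so `hF` still applies.
  exact ⟨F.gauge ht, hF⟩

theorem existsUnique_hasInvariants [Nontrivial R] (hg : IsCyclicBasis g n)
    (𝒞 : BraidedGroupCategory.{w, u, v₁, u₁} R G) :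
    ∃! d : BraidingData R n, 𝒞.HasInvariants g d := by
  obtain ⟨ω, F, hF⟩ := 𝒞.exists_frame
  obtain ⟨d, hd⟩ := ω.exists_hasData hg
  exact ⟨d, (hasInvariants_iff hF).2 hd, fun d' h => ((hasInvariants_iff hF).1 h).unique hd⟩

/-- A braided functor carries braidings to braidings up to its tensorators, which cancel around a
scalar; faithfulness then reflects the equation. -/
theorem HasInvariants.of_equivalent {𝒞 : BraidedGroupCategory.{w, u, v₁, u₁} R G}
    {𝒟 : BraidedGroupCategory.{w, u, v₂, u₂} R G} {d : BraidingData R n}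
    (h : 𝒟.HasInvariants g d) (h' : 𝒞.Equivalent 𝒟) : 𝒞.HasInvariants g d := by
  obtain ⟨E, _, _, _, _, hE⟩ := h'
  refine ⟨fun i X hX => E.map_injective ?_, fun i j hij X Y hX hY => E.map_injective ?_⟩
  · obtain ⟨X', hX'⟩ := 𝒟.label_surjective (g i)
    obtain ⟨e⟩ := hE X X' (hX.trans hX'.symm)
    rw [Functor.map_braiding, braiding_self_of_iso e (h.1 i X' hX')]
    simp
  · obtain ⟨X', hX'⟩ := 𝒟.label_surjective (g i)
    obtain ⟨Y', hY'⟩ := 𝒟.label_surjective (g j)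
    obtain ⟨e⟩ := hE X X' (hX.trans hX'.symm)
    obtain ⟨e'⟩ := hE Y Y' (hY.trans hY'.symm)
    have h1 := double_braiding_of_iso e e' (h.2 i j hij X' Y' hX' hY')
    rw [Functor.map_comp, Functor.map_braiding, Functor.map_braiding]
    simp only [Category.assoc, Functor.Monoidal.μ_δ_assoc]
    rw [reassoc_of% h1]
    simp

theorem equivalent_iff [Nontrivial R] (hg : IsCyclicBasis g n)
    {𝒞 : BraidedGroupCategory.{w, u, v₁, u₁} R G} {𝒟 : BraidedGroupCategory.{w, u, v₂, u₂} R G}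
    {d d' : BraidingData R n} (h : 𝒞.HasInvariants g d) (h' : 𝒟.HasInvariants g d') :
    𝒞.Equivalent 𝒟 ↔ d = d' := by
  constructor
  · intro e
    exact (𝒞.existsUnique_hasInvariants hg).unique h (h'.of_equivalent e)
  · rintro rfl
    obtain ⟨F, hF⟩ := exists_represents_cocycle hg h
    obtain ⟨H, hH⟩ := exists_represents_cocycle hg h'
    exact equivalent_of_represents hF hH

end BraidedGroupCategory

/-! ### The twisted graded modules realize the data. -/

section Twisted

open scoped TensorProduct

variable {R : Type w} [CommRing R] {G : Type u} [CommGroup G] (ω : AbelianCocycle G Rˣ)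

namespace TwistedGraded

/-- The module underlying the product is `R ⊗ R`, generated by `1 ⊗ 1`, so braidings need only be
evaluated there. -/
theorem simpleObj_tensor_hom_ext {a b : G} {M : TwistedGraded ω}
    {f f' : simpleObj ω a ⊗ simpleObj ω b ⟶ M}
    (h : toLin f ((1 : R) ⊗ₜ[R] (1 : R) : R ⊗[R] R) =
      toLin f' ((1 : R) ⊗ₜ[R] (1 : R) : R ⊗[R] R)) : f = f' :=
  hom_ext (TensorProduct.ext (LinearMap.ext_ring (LinearMap.ext_ring h)))

theorem braiding_simpleObj (a b : G) : toLin (β_ (simpleObj ω a) (simpleObj ω b)).hom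
    ((1 : R) ⊗ₜ[R] (1 : R) : R ⊗[R] R) =
      ((ω.comm a b : R) • ((1 : R) ⊗ₜ[R] (1 : R)) : R ⊗[R] R) :=
  braiding_tmul (M := simpleObj ω a) (N := simpleObj ω b) (FreeGraded.mem_delta a (1 : R))
    (FreeGraded.mem_delta b (1 : R))

theorem braiding_simpleObj_self (a : G) : (β_ (simpleObj ω a) (simpleObj ω a)).hom =
    (ω.comm a a : R) • 𝟙 (simpleObj ω a ⊗ simpleObj ω a) :=
  simpleObj_tensor_hom_ext ω (braiding_simpleObj ω a a)

theorem double_braiding_simpleObj (a b : G) :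
    (β_ (simpleObj ω a) (simpleObj ω b)).hom ≫ (β_ (simpleObj ω b) (simpleObj ω a)).hom =
      (ω.double a b : R) • 𝟙 (simpleObj ω a ⊗ simpleObj ω b) := by
  refine simpleObj_tensor_hom_ext ω ?_
  change toLin (β_ (simpleObj ω b) (simpleObj ω a)).hom (toLin (β_ _ _).hom _) =
    (ω.double a b : R) • ((1 : R) ⊗ₜ[R] (1 : R) : R ⊗[R] R)
  rw [braiding_simpleObj]
  refine (map_smul (toLin (β_ (simpleObj ω b) (simpleObj ω a)).hom) _ _).trans ?_
  rw [braiding_simpleObj]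
  exact smul_smul _ _ _

end TwistedGraded

theorem twistedGroupRing_hasInvariants [Nontrivial R] {k : ℕ} {g : Fin k → G} {n : Fin k → ℕ}
    {d : BraidingData R n} (h : ω.HasData g d) : (twistedGroupRing ω).HasInvariants g d := by
  have iso : ∀ (X : (twistedGroupRing ω).Simple) (a : G), (twistedGroupRing ω).label X = a →
      Nonempty (X.1 ≅ TwistedGraded.simpleObj ω a) := by
    rintro X a rfl
    exact X.2.choose_spec
  refine ⟨fun i X hX => ?_, fun i j hij X Y hX hY => ?_⟩
  · obtain ⟨e⟩ := iso X _ hX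
    rw [← h.diag]
    exact BraidedGroupCategory.braiding_self_of_iso e (TwistedGraded.braiding_simpleObj_self ω _)
  · obtain ⟨e⟩ := iso X _ hX
    obtain ⟨e'⟩ := iso Y _ hY
    rw [← h.off]
    exact BraidedGroupCategory.double_braiding_of_iso e e'
      (TwistedGraded.double_braiding_simpleObj ω _ _)

end Twisted

/-! ### Duals. -/

section Duals

variable {C : Type u₁} [Category.{v₁} C] [Preadditive C] [MonoidalCategory C]
  [MonoidalPreadditive C]

/-- A direct sum of dual objects is dual to the direct sum. -/
@[reducible]
def exactPairingOfTotal {J : Type} [Fintype J] {X Y : C} {x y : J → C}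
    [∀ i, ExactPairing (x i) (y i)] (ι : ∀ i, x i ⟶ X) (π : ∀ i, X ⟶ x i) (ι' : ∀ i, y i ⟶ Y)
    (π' : ∀ i, Y ⟶ y i) (ι_π : ∀ i, ι i ≫ π i = 𝟙 _) (ι_π_ne : ∀ i j, i ≠ j → ι i ≫ π j = 0)
    (total : ∑ i, π i ≫ ι i = 𝟙 X) (ι_π' : ∀ i, ι' i ≫ π' i = 𝟙 _)
    (ι_π_ne' : ∀ i j, i ≠ j → ι' i ≫ π' j = 0) (total' : ∑ i, π' i ≫ ι' i = 𝟙 Y) :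
    ExactPairing X Y where
  coevaluation' := ∑ i, η_ (x i) (y i) ≫ (ι i ⊗ₘ ι' i)
  evaluation' := ∑ i, (π' i ⊗ₘ π i) ≫ ε_ (x i) (y i)
  coevaluation_evaluation' := by
    have key : ∀ i j, Y ◁ (η_ (x i) (y i) ≫ (ι i ⊗ₘ ι' i)) ≫ (α_ Y X Y).inv ≫
        ((π' j ⊗ₘ π j) ≫ ε_ (x j) (y j)) ▷ Y =
        Y ◁ η_ (x i) (y i) ≫ (α_ _ _ _).inv ≫ ((π' j ⊗ₘ (ι i ≫ π j)) ⊗ₘ ι' i) ≫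
          ε_ (x j) (y j) ▷ Y := fun i j => by
      rw [whiskerLeft_comp, comp_whiskerRight, Category.assoc, ← id_tensorHom Y (ι i ⊗ₘ ι' i),
        associator_inv_naturality_assoc, ← tensorHom_id (π' j ⊗ₘ π j),
        tensorHom_comp_tensorHom_assoc, tensorHom_comp_tensorHom, Category.id_comp,
        Category.comp_id]
    have key' : ∀ i, Y ◁ η_ (x i) (y i) ≫ (α_ _ _ _).inv ≫ ((π' i ⊗ₘ 𝟙 (x i)) ⊗ₘ ι' i) ≫
          ε_ (x i) (y i) ▷ Y = (ρ_ Y).hom ≫ (π' i ≫ ι' i) ≫ (λ_ Y).inv := fun i => by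
      rw [tensorHom_id, MonoidalCategory.tensorHom_def, Category.assoc, whisker_exchange,
        ← associator_inv_naturality_left_assoc, whisker_exchange_assoc,
        ExactPairing.coevaluation_evaluation_assoc]
      simp
    simp only [whiskerLeft_sum, sum_whiskerRight,
      Preadditive.sum_comp, Preadditive.comp_sum, key]
    rw [← Category.id_comp (λ_ Y).inv, ← total', Preadditive.sum_comp, Preadditive.comp_sum]
    refine Finset.sum_congr rfl fun i _ => ?_
    -- The mixed terms contain `ι i ≫ π j` with `i ≠ j` and vanish; the diagonal terms are the
    -- zigzag identities of the summands.
    rw [Finset.sum_eq_single i, ι_π, key']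
    · intro j _ h
      rw [ι_π_ne _ _ (by tauto)]
      simp
    · simp
  evaluation_coevaluation' := by
    have key : ∀ i j, (η_ (x i) (y i) ≫ (ι i ⊗ₘ ι' i)) ▷ X ≫ (α_ X Y X).hom ≫
        X ◁ ((π' j ⊗ₘ π j) ≫ ε_ (x j) (y j)) =
        η_ (x i) (y i) ▷ X ≫ (α_ _ _ _).hom ≫ (ι i ⊗ₘ ((ι' i ≫ π' j) ⊗ₘ π j)) ≫
          X ◁ ε_ (x j) (y j) := fun i j => by
      rw [whiskerLeft_comp, comp_whiskerRight, Category.assoc, ← tensorHom_id (ι i ⊗ₘ ι' i),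
        associator_naturality_assoc, ← id_tensorHom X (π' j ⊗ₘ π j),
        tensorHom_comp_tensorHom_assoc, tensorHom_comp_tensorHom, Category.id_comp,
        Category.comp_id]
    have key' : ∀ i, η_ (x i) (y i) ▷ X ≫ (α_ _ _ _).hom ≫ (ι i ⊗ₘ (𝟙 (y i) ⊗ₘ π i)) ≫
          X ◁ ε_ (x i) (y i) = (λ_ X).hom ≫ (π i ≫ ι i) ≫ (ρ_ X).inv := fun i => by
      rw [id_tensorHom, MonoidalCategory.tensorHom_def', Category.assoc, ← whisker_exchange,
        ← associator_naturality_right_assoc, ← whisker_exchange_assoc,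
        ExactPairing.evaluation_coevaluation_assoc]
      simp
    simp only [whiskerLeft_sum, sum_whiskerRight,
      Preadditive.sum_comp, Preadditive.comp_sum, key]
    rw [← Category.id_comp (ρ_ X).inv, ← total, Preadditive.sum_comp, Preadditive.comp_sum]
    refine Finset.sum_congr rfl fun i _ => ?_
    rw [Finset.sum_eq_single i, ι_π', key']
    · intro j _ h
      rw [ι_π_ne' _ _ (by tauto)]
      simp
    · simp

end Duals

namespace Frame

variable {R : Type w} [CommRing R] {G : Type u} [CommGroup G] {C : Type u₁}
    [Category.{v₁} C] [Preadditive C] [Linear R C] [MonoidalCategory C] [BraidedCategory C]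
    [MonoidalPreadditive C] [MonoidalLinear R C] {ω : AbelianCocycle G Rˣ} (F : Frame R C ω)

/-- The two zigzag identities involve the two factors here; this relation lets one correction of the
evaluation settle both. -/
theorem _root_.GroupCat.AbelianCocycle.assoc_inv_mul_assoc_inv {A : Type*} [CommGroup A]
    (ω : AbelianCocycle G A) (a : G) : ω.assoc a a⁻¹ a * ω.assoc a⁻¹ a a⁻¹ = 1 := by
  simpa [ω.assoc_one, ω.assoc_one_left, ω.assoc_one_right] using ω.pentagon a a⁻¹ a a⁻¹

/-- The objects of the skeleton have duals. -/
@[reducible]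
noncomputable def exactPairing (a : G) : ExactPairing (F.obj a) (F.obj a⁻¹) where
  coevaluation' := F.unit.hom ≫ (F.mul (mul_inv_cancel a)).inv
  -- The scalar is dictated by the zigzag on `F.obj a`, where the associator contributes `ω.assoc a
  -- a⁻¹ a`.
  evaluation' := (((ω.assoc a a⁻¹ a)⁻¹ : Rˣ) : R) • ((F.mul (inv_mul_cancel a)).hom ≫ F.unit.inv)
  coevaluation_evaluation' := by
    have h := Skeleton.HasAssoc.inv F.hasAssoc (mul_inv_cancel a) (mul_one a⁻¹) (inv_mul_cancel a) (one_mul a⁻¹)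
    have h1 : (ω.assoc a a⁻¹ a)⁻¹ * (ω.assoc a⁻¹ a a⁻¹)⁻¹ = 1 := by
      rw [← mul_inv, ω.assoc_inv_mul_assoc_inv, inv_one]
    have h2 : (α_ (F.obj a⁻¹) (F.obj a) (F.obj a⁻¹)).inv ≫
        ((F.mul (inv_mul_cancel a)).hom ≫ F.unit.inv) ▷ F.obj a⁻¹ ≫ (λ_ _).hom =
        (((ω.assoc a⁻¹ a a⁻¹)⁻¹ : Rˣ) : R) •
          (F.obj a⁻¹ ◁ ((F.mul (mul_inv_cancel a)).hom ≫ F.unit.inv) ≫ (ρ_ _).hom) := by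
      rw [← F.left_unit (one_mul _), ← F.right_unit (mul_one _)]
      simpa using h
    rw [← cancel_mono (λ_ (F.obj a⁻¹)).hom]
    simp only [Category.assoc, MonoidalLinear.smul_whiskerRight, Linear.comp_smul,
      Linear.smul_comp, h2, smul_smul]
    rw [← Units.val_mul, h1]
    have h3 : F.obj a⁻¹ ◁ (F.unit.hom ≫ (F.mul (mul_inv_cancel a)).inv) ≫
        F.obj a⁻¹ ◁ ((F.mul (mul_inv_cancel a)).hom ≫ F.unit.inv) = 𝟙 _ := by
      rw [← whiskerLeft_comp]
      simp
    rw [reassoc_of% h3]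
    simp
  evaluation_coevaluation' := by
    have h := F.hasAssoc (inv_mul_cancel a) (mul_one a) (mul_inv_cancel a) (one_mul a)
    have h2 : (α_ (F.obj a) (F.obj a⁻¹) (F.obj a)).hom ≫
        F.obj a ◁ ((F.mul (inv_mul_cancel a)).hom ≫ F.unit.inv) ≫ (ρ_ _).hom =
        (ω.assoc a a⁻¹ a : R) •
          (((F.mul (mul_inv_cancel a)).hom ≫ F.unit.inv) ▷ F.obj a ≫ (λ_ _).hom) := by
      rw [← F.left_unit (one_mul _), ← F.right_unit (mul_one _)]
      simpa using h
    rw [← cancel_mono (ρ_ (F.obj a)).hom]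
    simp only [Category.assoc, MonoidalLinear.whiskerLeft_smul, Linear.comp_smul,
      Linear.smul_comp, h2, smul_smul]
    have h3 : (F.unit.hom ≫ (F.mul (mul_inv_cancel a)).inv) ▷ F.obj a ≫
        ((F.mul (mul_inv_cancel a)).hom ≫ F.unit.inv) ▷ F.obj a = 𝟙 _ := by
      rw [← comp_whiskerRight]
      simp
    rw [reassoc_of% h3]
    simp

/-- Every object has a dual. -/
@[reducible]
noncomputable def hasRightDual [HasFiniteBiproducts C] (X : C) : HasRightDual X :=
  have := fun i => F.exactPairing (F.deg X i)
  have := exactPairingOfTotal (F.ι X) (F.π X)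
    (biproduct.ι fun i => F.obj (F.deg X i)⁻¹) (biproduct.π fun i => F.obj (F.deg X i)⁻¹)
    (F.ι_π_self X) (fun _ _ => F.ι_π_ne X) (F.total X) (biproduct.ι_π_self _)
    (fun _ _ => biproduct.ι_π_ne _) biproduct.total
  ⟨⨁ fun i => F.obj (F.deg X i)⁻¹⟩

/-- Right duals are constructed from decompositions; the braiding converts them into left duals. -/
theorem nonempty_rigidCategory (F : Frame R C ω) [HasFiniteBiproducts C] : Nonempty (RigidCategory C) :=
  have : RightRigidCategory C := { rightDual := F.hasRightDual }
  ⟨BraidedCategory.rigidCategoryOfRightRigidCategory⟩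

end Frame

/-! ### Balances and symmetry. -/

/-- The condition on the scalars of a balance. -/
def AbelianCocycle.IsTwist {G : Type u} [CommGroup G] {A : Type w} [CommGroup A]
    (ω : AbelianCocycle G A) (φ : G → A) : Prop :=
  ∀ a b, φ (a * b) = ω.double a b * φ a * φ b

/-- In the quotient of two solutions the common factor `double a b` cancels. -/
theorem AbelianCocycle.IsTwist.exists_eq_mul {G : Type u} [CommGroup G] {A : Type w} [CommGroup A]
    {ω : AbelianCocycle G A} {φ φ' : G → A} (h : ω.IsTwist φ) (h' : ω.IsTwist φ') :
    ∃ χ : G →* A, ∀ a, φ' a = χ a * φ a := by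
  refine ⟨MonoidHom.mk' (fun a => φ' a / φ a) fun a b => ?_, fun a => (div_mul_cancel _ _).symm⟩
  rw [h, h', mul_assoc, mul_assoc, mul_div_mul_left_eq_div, mul_div_mul_comm]

theorem AbelianCocycle.IsTwist.mul {G : Type u} [CommGroup G] {A : Type w} [CommGroup A]
    {ω : AbelianCocycle G A} {φ : G → A} (h : ω.IsTwist φ) (χ : G →* A) :
    ω.IsTwist fun a => χ a * φ a := fun a b => by
  beta_reduce
  rw [h, map_mul]
  ac_rfl

theorem Balance.ext {C : Type u₁} [Category.{v₁} C] [MonoidalCategory C] [BraidedCategory C]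
    {θ θ' : Balance C} (h : θ.twist = θ'.twist) : θ = θ' := by
  cases θ
  cases θ'
  cases h
  rfl

namespace Frame

variable {R : Type w} [CommRing R] {G : Type u} [CommGroup G] {C : Type u₁}
    [Category.{v₁} C] [Preadditive C] [Linear R C] [MonoidalCategory C] [BraidedCategory C]
    {ω : AbelianCocycle G Rˣ} (F : Frame R C ω)

/-- The natural endomorphism `θ` acts on the object of degree `a` of the skeleton as the scalar
`φ a`. -/
def HasScalars (θ : 𝟭 C ⟶ 𝟭 C) (φ : G → Rˣ) : Prop :=
  ∀ a, θ.app (F.obj a) = (φ a : R) • 𝟙 (F.obj a)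

theorem exists_hasScalars (θ : 𝟭 C ≅ 𝟭 C) : ∃ φ : G → Rˣ, F.HasScalars θ.hom φ := by
  choose φ hφ using fun a => (F.isLine a).exists_unit_smul (𝟙 (F.obj a)) (θ.hom.app (F.obj a))
  exact ⟨φ, hφ⟩

/-- Between different degrees only the zero morphism exists, so arbitrary scalars on the
representatives are natural. -/
theorem eq_smul_comp {a b : G} (φ : G → Rˣ) (f : F.obj a ⟶ F.obj b) :
    (φ b : R) • f = (φ a : R) • f := by
  by_cases h : a = b
  · subst h
    rfl
  · rw [F.eq_zero h f, smul_zero, smul_zero]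

/-- The component of the natural endomorphism with given scalars. -/
noncomputable def scalarApp (φ : G → Rˣ) (X : C) : X ⟶ X :=
  ∑ i, F.π X i ≫ ((φ (F.deg X i) : R) • F.ι X i)

theorem comp_scalarApp (φ : G → Rˣ) {X : C} {a : G} (x : F.obj a ⟶ X) :
    x ≫ F.scalarApp φ X = (φ a : R) • x := by
  rw [scalarApp, Preadditive.comp_sum]
  conv_rhs => rw [← F.sum_comp_π_ι x, Finset.smul_sum]
  refine Finset.sum_congr rfl fun i _ => ?_
  rw [Linear.comp_smul, Linear.comp_smul, ← Category.assoc, ← Linear.smul_comp, eq_smul_comp,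
    Linear.smul_comp]

theorem scalarApp_comp (φ ψ : G → Rˣ) (h : ∀ a, φ a * ψ a = 1) (X : C) :
    F.scalarApp φ X ≫ F.scalarApp ψ X = 𝟙 X := F.hom_ext fun a x => by
  rw [← Category.assoc, comp_scalarApp, comp_scalarApp, smul_smul, ← Units.val_mul, mul_comm, h, Units.val_one, one_smul, Category.comp_id]

theorem scalarApp_naturality (φ : G → Rˣ) {X Y : C} (f : X ⟶ Y) :
    f ≫ F.scalarApp φ Y = F.scalarApp φ X ≫ f := F.hom_ext fun a x => by
  rw [← Category.assoc, comp_scalarApp, ← Category.assoc, comp_scalarApp, Linear.smul_comp]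

/-- The natural automorphism with given scalars. -/
noncomputable def scalarIso (φ : G → Rˣ) : 𝟭 C ≅ 𝟭 C :=
  NatIso.ofComponents
    (fun X => ⟨F.scalarApp φ X, F.scalarApp φ⁻¹ X, F.scalarApp_comp _ _ (by simp) X,
      F.scalarApp_comp _ _ (by simp) X⟩)
    fun f => F.scalarApp_naturality φ f

theorem hasScalars_scalarIso (φ : G → Rˣ) : F.HasScalars (F.scalarIso φ).hom φ := fun a => by
  have h := F.comp_scalarApp φ (𝟙 (F.obj a))
  rwa [Category.id_comp] at h

variable {F} {θ θ' : 𝟭 C ≅ 𝟭 C} {φ φ' : G → Rˣ}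

theorem HasScalars.comp_app (h : F.HasScalars θ.hom φ) {X : C} {a : G} (x : F.obj a ⟶ X) :
    x ≫ θ.hom.app X = (φ a : R) • x := by
  have h1 := θ.hom.naturality x
  rw [h] at h1
  simpa using h1

theorem HasScalars.app_of_iso (h : F.HasScalars θ.hom φ) {X : C} {a : G} (e : X ≅ F.obj a) :
    θ.hom.app X = (φ a : R) • 𝟙 X := by
  rw [← cancel_epi e.inv, h.comp_app]
  simp

theorem HasScalars.ext (h : F.HasScalars θ.hom φ) (h' : F.HasScalars θ'.hom φ) : θ = θ' := by
  ext X
  exact F.hom_ext fun a x => (h.comp_app x).trans (h'.comp_app x).symm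

theorem tensor_double_braiding {X Y : C} {a b : G} (x : F.obj a ⟶ X) (y : F.obj b ⟶ Y) :
    (x ⊗ₘ y) ≫ (β_ X Y).hom ≫ (β_ Y X).hom = (ω.double a b : R) • (x ⊗ₘ y) := by
  rw [BraidedCategory.braiding_naturality_assoc, BraidedCategory.braiding_naturality,
    ← Category.assoc, double_braiding, Linear.smul_comp, Category.id_comp]

theorem HasScalars.tensor_app (h : F.HasScalars θ.hom φ) {X Y : C} {a b : G}
    (x : F.obj a ⟶ X) (y : F.obj b ⟶ Y) :
    (x ⊗ₘ y) ≫ θ.hom.app (X ⊗ Y) = (φ (a * b) : R) • (x ⊗ₘ y) := by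
  rw [F.tensor_pair rfl x y, Category.assoc, h.comp_app, Linear.comp_smul]

variable [MonoidalPreadditive C] [MonoidalLinear R C]

theorem HasScalars.tensor_tensor_app (h : F.HasScalars θ.hom φ) {X Y : C} {a b : G}
    (x : F.obj a ⟶ X) (y : F.obj b ⟶ Y) :
    (x ⊗ₘ y) ≫ (β_ X Y).hom ≫ (β_ Y X).hom ≫ (θ.hom.app X ⊗ₘ θ.hom.app Y) =
      ((ω.double a b * φ a * φ b : Rˣ) : R) • (x ⊗ₘ y) := by
  have h1 := tensor_double_braiding (F := F) x y
  rw [reassoc_of% h1, Linear.smul_comp]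
  erw [tensorHom_comp_tensorHom]
  rw [h.comp_app, h.comp_app]
  simp only [MonoidalCategory.tensorHom_def, MonoidalLinear.smul_whiskerRight,
    MonoidalLinear.whiskerLeft_smul, Linear.smul_comp, Linear.comp_smul, smul_smul]
  push_cast
  rw [mul_right_comm]
  congr 1
  ring

/-- On a product of elements of degrees `a` and `b` one side of the balance axiom acts by `φ (a *
b)`, the other by the double braiding and the two twists. -/
theorem HasScalars.twist_tensor_iff (h : F.HasScalars θ.hom φ) :
    (∀ X Y : C, θ.hom.app (X ⊗ Y) =
      (β_ X Y).hom ≫ (β_ Y X).hom ≫ (θ.hom.app X ⊗ₘ θ.hom.app Y)) ↔ ω.IsTwist φ := by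
  constructor
  · intro H a b
    have h1 := h.tensor_app (𝟙 (F.obj a)) (𝟙 (F.obj b))
    rw [H, h.tensor_tensor_app] at h1
    rw [id_tensorHom_id] at h1
    exact (F.isLine_tensor a b).units_smul_injective h1.symm
  · intro H X Y
    refine F.tensor_hom_ext fun a b x y => ?_
    rw [h.tensor_app, h.tensor_tensor_app, H]

/-- Any morphism from the unit has components only in pairs of inverse degrees, and there `φ` takes
equal values. No property of a coevaluation is used. -/
theorem HasScalars.compatible (h : F.HasScalars θ.hom φ) (hφ : ∀ a, φ a⁻¹ = φ a) {X Y : C}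
    (f : 𝟙_ C ⟶ X ⊗ Y) : f ≫ (θ.hom.app X ▷ Y) = f ≫ (X ◁ θ.hom.app Y) := by
  have hf : f = ∑ i, ∑ j, f ≫ (F.π X i ⊗ₘ F.π Y j) ≫ (F.ι X i ⊗ₘ F.ι Y j) := by
    simp only [← Preadditive.comp_sum, tensorHom_comp_tensorHom, ← tensor_sum, ← sum_tensor, total]
    simp
  rw [hf]
  simp only [Preadditive.sum_comp]
  refine Finset.sum_congr rfl fun i _ => Finset.sum_congr rfl fun j _ => ?_
  have h1 : (F.ι X i ⊗ₘ F.ι Y j) ≫ (θ.hom.app X ▷ Y) =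
      (φ (F.deg X i) : R) • (F.ι X i ⊗ₘ F.ι Y j) := by
    have := h.comp_app (F.ι X i)
    rw [← tensorHom_id]
    erw [tensorHom_comp_tensorHom, this]
    simp [MonoidalCategory.tensorHom_def]
  have h2 : (F.ι X i ⊗ₘ F.ι Y j) ≫ (X ◁ θ.hom.app Y) =
      (φ (F.deg Y j) : R) • (F.ι X i ⊗ₘ F.ι Y j) := by
    have := h.comp_app (F.ι Y j)
    rw [← id_tensorHom]
    erw [tensorHom_comp_tensorHom, this]
    simp [MonoidalCategory.tensorHom_def]
  by_cases hij : F.deg X i * F.deg Y j = 1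
  · simp only [Category.assoc, h1, h2]
    have h3 : φ (F.deg Y j) = φ (F.deg X i) := by
      rw [eq_inv_of_mul_eq_one_right hij, hφ]
    rw [h3]
  -- After identification of the unit with `F.obj 1` this component runs between representatives of
  -- different degrees.
  · have h3 : f ≫ (F.π X i ⊗ₘ F.π Y j) = 0 := by
      rw [← cancel_mono (F.mul rfl).hom, ← cancel_epi F.unit.inv]
      simpa using F.eq_zero (Ne.symm hij) (F.unit.inv ≫ (f ≫ (F.π X i ⊗ₘ F.π Y j)) ≫ (F.mul rfl).hom)
    simp only [reassoc_of% h3, zero_comp]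

end Frame

namespace BraidedGroupCategory

open GroupCat.Frame

variable {R : Type w} [CommRing R] {G : Type u} [CommGroup G]
  {𝒞 : BraidedGroupCategory.{w, u, v₁, u₁} R G} {ω : AbelianCocycle G Rˣ}
  {F : Frame R 𝒞.carrier ω} (hF : Represents F)

theorem exists_balance {φ : G → Rˣ} (h : ω.IsTwist φ) :
    ∃ θ : Balance 𝒞.carrier, F.HasScalars θ.twist.hom φ :=
  ⟨⟨F.scalarIso φ, (F.hasScalars_scalarIso φ).twist_tensor_iff.2 h⟩, F.hasScalars_scalarIso φ⟩

/-- The double braiding is the scalar `double a b` on products of elements, which detect morphisms.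
-/
theorem isSymmetric_iff (F : Frame R 𝒞.carrier ω) : 𝒞.IsSymmetric ↔ ∀ a b, ω.double a b = 1 := by
  constructor
  · intro h a b
    refine (F.isLine_tensor a b).units_smul_injective (f := 𝟙 (F.obj a ⊗ F.obj b)) ?_
    rw [← F.double_braiding, h, Units.val_one, one_smul]
  · intro h X Y
    refine F.tensor_hom_ext fun a b x y => ?_
    rw [tensor_double_braiding, h, Units.val_one, one_smul, Category.comp_id]

include hF

theorem isStandard_iff {θ : Balance 𝒞.carrier} {φ : G → Rˣ} (h : F.HasScalars θ.twist.hom φ) :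
    𝒞.IsStandard θ ↔ ∀ a, φ a = ω.comm a a := by
  have key : ∀ X : 𝒞.Simple, θ.twist.hom.app X.1 ▷ X.1 =
      (φ (𝒞.label X) : R) • 𝟙 (X.1 ⊗ X.1) := fun X => by
    have h1 := h.app_of_iso (hF X).some
    erw [h1]
    simp
  constructor
  · intro H a
    obtain ⟨X, rfl⟩ := 𝒞.label_surjective a
    have h1 := H X
    rw [key, braiding_self hF] at h1
    exact (isLine_tensor hF X X).units_smul_injective h1
  · intro H X
    rw [key, braiding_self hF, H]

theorem isScaling_iff {θ θ' : Balance 𝒞.carrier} {φ φ' : G → Rˣ}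
    (h : F.HasScalars θ.twist.hom φ) (h' : F.HasScalars θ'.twist.hom φ') (χ : G →* Rˣ) :
    𝒞.IsScaling χ θ θ' ↔ ∀ a, φ' a = χ a * φ a := by
  constructor
  · intro H a
    obtain ⟨X, rfl⟩ := 𝒞.label_surjective a
    have h1 := H X
    rw [h.app_of_iso (hF X).some, h'.app_of_iso (hF X).some] at h1
    refine (isLine X).units_smul_injective (f := 𝟙 X.1) (h1.trans ?_)
    rw [smul_smul, Units.val_mul]
  · intro H X
    rw [h.app_of_iso (hF X).some, h'.app_of_iso (hF X).some, smul_smul, H, Units.val_mul]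

theorem existsUnique_isStandard : ∃! θ : Balance 𝒞.carrier, 𝒞.IsStandard θ := by
  -- The quadratic law `comm_mul_self` is exactly the twist condition for `φ a = comm a a`.
  obtain ⟨θ, hθ⟩ := exists_balance (F := F) (φ := fun a => ω.comm a a) ω.comm_mul_self
  refine ⟨θ, (isStandard_iff hF hθ).2 fun _ => rfl, fun θ' h => ?_⟩
  obtain ⟨φ, hφ⟩ := F.exists_hasScalars θ'.twist
  obtain rfl := funext ((isStandard_iff hF hφ).1 h)
  exact Balance.ext (hφ.ext hθ)

theorem IsStandard.compatibleWithDuals {θ : Balance 𝒞.carrier} (h : 𝒞.IsStandard θ) :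
    θ.CompatibleWithDuals := by
  obtain ⟨φ, hφ⟩ := F.exists_hasScalars θ.twist
  obtain rfl := funext ((isStandard_iff hF hφ).1 h)
  exact fun X Y _ => hφ.compatible ω.comm_inv_self _

theorem existsUnique_isScaling (θ θ' : Balance 𝒞.carrier) :
    ∃! χ : G →* Rˣ, 𝒞.IsScaling χ θ θ' := by
  obtain ⟨φ, hφ⟩ := F.exists_hasScalars θ.twist
  obtain ⟨φ', hφ'⟩ := F.exists_hasScalars θ'.twist
  simp only [isScaling_iff hF hφ hφ']
  obtain ⟨χ, hχ⟩ := (hφ.twist_tensor_iff.1 θ.twist_tensor).exists_eq_mul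
    (hφ'.twist_tensor_iff.1 θ'.twist_tensor)
  refine ⟨χ, hχ, fun χ' h => MonoidHom.ext fun a => ?_⟩
  exact mul_right_cancel ((h a).symm.trans (hχ a))

theorem existsUnique_scaled (θ : Balance 𝒞.carrier) (χ : G →* Rˣ) :
    ∃! θ' : Balance 𝒞.carrier, 𝒞.IsScaling χ θ θ' := by
  obtain ⟨φ, hφ⟩ := F.exists_hasScalars θ.twist
  obtain ⟨θ', hθ'⟩ := exists_balance (F := F) ((hφ.twist_tensor_iff.1 θ.twist_tensor).mul χ)
  refine ⟨θ', (isScaling_iff hF hφ hθ' χ).2 fun _ => rfl, fun θ'' h => ?_⟩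
  obtain ⟨ψ, hψ⟩ := F.exists_hasScalars θ''.twist
  obtain rfl := funext ((isScaling_iff hF hφ hψ χ).1 h)
  exact Balance.ext (hψ.ext hθ')

end BraidedGroupCategory

end GroupCat

theorem mainTheorem3 {R : Type w} [CommRing R] [Nontrivial R] {G : Type u} [CommGroup G]
    {k : ℕ} (g : Fin k → G) (n : Fin k → ℕ) (hg : GroupCat.IsCyclicBasis g n) :
    -- the invariants of a braided group-category are well defined and satisfy the order conditions
    (∀ 𝒞 : GroupCat.BraidedGroupCategory.{w, u, v₁, u₁} R G,
      ∃! d : GroupCat.BraidingData R n, 𝒞.HasInvariants g d) ∧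
    -- two braided group-categories are equivalent exactly when their invariants are equal
    (∀ (𝒞 : GroupCat.BraidedGroupCategory.{w, u, v₁, u₁} R G)
      (𝒟 : GroupCat.BraidedGroupCategory.{w, u, v₂, u₂} R G) (d d' : GroupCat.BraidingData R n),
      𝒞.HasInvariants g d → 𝒟.HasInvariants g d' → (𝒞.Equivalent 𝒟 ↔ d = d')) ∧
    -- all data are realized, by the explicitly twisted standard group-category
    (∀ d : GroupCat.BraidingData R n,
      (GroupCat.twistedGroupRing (d.cocycle hg)).HasInvariants g d) ∧
    (∀ (𝒞 : GroupCat.BraidedGroupCategory.{w, u, v₁, u₁} R G) (d : GroupCat.BraidingData R n),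
      𝒞.HasInvariants g d → 𝒞.Equivalent (GroupCat.twistedGroupRing (d.cocycle hg))) ∧
    -- all these categories are tortile, and tortile structures are unique up to scaling
    (∀ 𝒞 : GroupCat.BraidedGroupCategory.{w, u, v₁, u₁} R G,
      Nonempty (CategoryTheory.RigidCategory 𝒞.carrier) ∧
      (∃! θ : GroupCat.Balance 𝒞.carrier, 𝒞.IsStandard θ) ∧
      (∀ θ : GroupCat.Balance 𝒞.carrier, 𝒞.IsStandard θ → θ.CompatibleWithDuals) ∧
      (∀ θ θ' : GroupCat.Balance 𝒞.carrier, ∃! χ : G →* Rˣ, 𝒞.IsScaling χ θ θ') ∧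
      (∀ (θ : GroupCat.Balance 𝒞.carrier) (χ : G →* Rˣ),
        ∃! θ' : GroupCat.Balance 𝒞.carrier, 𝒞.IsScaling χ θ θ')) ∧
    -- the symmetric ones
    (∀ (𝒞 : GroupCat.BraidedGroupCategory.{w, u, v₁, u₁} R G) (d : GroupCat.BraidingData R n),
      𝒞.HasInvariants g d →
        (𝒞.IsSymmetric ↔ (∀ i, d.diag i ^ 2 = 1) ∧ ∀ i j h, d.off i j h = 1)) := by
  have twisted : ∀ d : GroupCat.BraidingData R n,
      (GroupCat.twistedGroupRing (d.cocycle hg)).HasInvariants g d := fun d =>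
    GroupCat.twistedGroupRing_hasInvariants _ (GroupCat.AbelianCocycle.hasData_cocycle hg d)
  refine ⟨fun 𝒞 => 𝒞.existsUnique_hasInvariants hg,
    fun 𝒞 𝒟 d d' h h' => GroupCat.BraidedGroupCategory.equivalent_iff hg h h', twisted,
    fun 𝒞 d h => (GroupCat.BraidedGroupCategory.equivalent_iff hg h (twisted d)).2 rfl,
    fun 𝒞 => ?_, fun 𝒞 d h => ?_⟩
  · obtain ⟨ω, F, hF⟩ := 𝒞.exists_frame
    exact ⟨F.nonempty_rigidCategory, GroupCat.BraidedGroupCategory.existsUnique_isStandard hF,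
      fun θ h => GroupCat.BraidedGroupCategory.IsStandard.compatibleWithDuals hF h,
      GroupCat.BraidedGroupCategory.existsUnique_isScaling hF,
      GroupCat.BraidedGroupCategory.existsUnique_scaled hF⟩
  · obtain ⟨ω, F, hF⟩ := 𝒞.exists_frame
    rw [GroupCat.BraidedGroupCategory.isSymmetric_iff F]
    exact GroupCat.AbelianCocycle.double_eq_one_iff ω hg
      ((GroupCat.BraidedGroupCategory.hasInvariants_iff hF).1 h)
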